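/- **Setting.** All distances and diameters are Euclidean. For a domain $G\subset\hat{\mathbb C}$ let $\mathcal C(G)$ be the set of connected components of $\hat{\mathbb C}\setminus G$, let $\mathcal C_N(G)$ be the set of those $p\in\mathcal C(G)$ with $\operatorname{diam}(p\cap\mathbb C)>0$, and let $\pi_G\colon\hat{\mathbb C}\to\hat G$ be the quotient map that collapses each $p\in\mathcal C(G)$ to a point. A homeomorphism $f\colon G\to G'$ between domains has a unique homeomorphic extension $\hat f\colon\hat G\to\hat G'$; for $A\subset\hat{\mathbb C}$ we also write $\hat f(A)$ for the set $\pi_{G'}^{-1}(\hat f(\pi_G(A)))\subset\hat{\mathbb C}$. The *transboundary modulus* of a family $\Gamma$ of paths in $\hat G$ is $$\operatorname{Mod}(\Gamma)=\inf_\rho\Big(\int_{G\cap\mathbb C}\rho^2\,dA+\sum_{p\in\mathcal C(G)}\rho(p)^2\Big),$$ where the infimum is over the Borel functions $\rho\colon\hat G\to[0,\infty]$ with $\int_\gamma\rho\,ds+\sum_{p\in\mathcal C(G)\cap|\gamma|}\rho(p)\ge1$ for all $\gamma\in\Gamma$. Here $|\gamma|$ is the image of $\gamma$, and $\int_\gamma\rho\,ds$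 is the sum of the arclength integrals over the pieces of $\gamma$ that run in $G\cap\mathbb C$, with the value $\infty$ on compact non-rectifiable subpaths. Let $\Omega\subset\hat{\mathbb C}$ be a domain with $\infty\in\Omega$, and assume that there are $H,N\ge1$ such that * every $p\in\mathcal C_N(\Omega)$ contains a set $T$ with $\operatorname{diam}T\ge\operatorname{diam}(p)/H$ that is the image of the standard tripod $\bigcup_{i=0}^{2}[0,e^{2\pi i\sqrt{-1}/3}]$ under a weakly $H$-quasisymmetric homeomorphism $\phi$, i.e. one for which $|z_2-z_1|\le|z_3-z_1|$ implies $|\phi(z_2)-\phi(z_1)|\le H|\phi(z_3)-\phi(z_1)|$; * for all $z_0\in\mathbb C$ and $r>0$, at most $N$ elements $p\in\mathcal C_N(\Omega)$ with $\operatorname{diam}(p)\ge r$ meet $\mathbb D(z_0,r)$. Assume moreover that $\mathcal C_N(\Omega)=\{p_0,p_1,\dots\}$ is infinite (the $p_\ell$ being distinct) and that $\Omega=\hat{\mathbb C}\setminus\overline{\bigcup_\ell p_\ell}$. Let $k_1<k_2<\cdots$ be natural numbers, $\Omega_j=\hat{\mathbb C}\setminus(p_0\cup\dots\cup p_{k_j})$,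 and let $f_j\colon\Omega_j\to D_j$ be conformal homeomorphisms onto domains $D_j\subset\hat{\mathbb C}$ such that $\hat f_j(p_0)=\hat{\mathbb C}\setminus\mathbb D(0,1)$ and $\hat f_j(p_\ell)$ is a closed disk of positive radius for $1\le\ell\le k_j$. Assume that for every $\ell\geq 1$ the sets $\hat f_j(p_\ell)$ converge in the Hausdorff sense to a closed disk or a point as $j\to\infty$, and that $f_j$ converges locally uniformly in $\Omega$ to a nonconstant map $f$. Let $D=f(\Omega)$; then $f\colon\Omega\to D$ is a conformal homeomorphism. Fix $\bar p\in\mathcal C(\Omega)$ and a Jordan curve $J\subset\Omega$, and let $R=\operatorname{dist}(\bar p,J)$. For $b\in\Omega\cap\mathbb C$ with $\operatorname{dist}(b,\bar p)<R$ and a point $a\in\partial\bar p$ closest to $b$, let $I$ be the segment with endpoints $a$ and $b$, and let $$\Gamma_j=\{\text{paths in }\hat\Omega_j\setminus\pi_{\Omega_j}(\bar p)\text{ that join }\pi_{\Omega_j}(J)\text{ and }\pi_{\Omega_j}(I)\},$$ $$\Lambda_j=\{\text{paths in }\hat\Omega_j\setminus\pi_{\Omega_j}(\bar p)\text{ that separate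 }\pi_{\Omega_j}(J)\text{ and }\pi_{\Omega_j}(\bar p)\}.$$ A path separates two sets if it is disjoint from both and no component of the complement of its image meets both. Put $\hat f_j(\Gamma_j)=\{\hat f_j\circ\gamma:\gamma\in\Gamma_j\}$, and similarly $\hat f_j(\Lambda_j)$. **Proposition 3.2.** 1. For every $a$ there is a homeomorphism $\varphi_a\colon[0,\infty)\to[0,\infty)$, not depending on $b$, such that for all $b$ as above for which $a$ is a closest point of $\partial\bar p$, $$\limsup_{j\to\infty}\operatorname{Mod}\hat f_j(\Gamma_j)\ \ge\ \limsup_{j\to\infty}\varphi_a\big(\operatorname{dist}(f_j(b),\hat f_j(\bar p))\big).$$ 2. If $\hat f(\bar p)$ is a point, then $\lim_{j\to\infty}\operatorname{Mod}\hat f_j(\Lambda_j)=\infty$. -/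

import Mathlib

open Set Filter Topology MeasureTheory
open scoped ENNReal NNReal unitInterval

noncomputable section

namespace Transboundary

/-! The Riemann sphere, holomorphic maps, complementary components. -/

/-- The Riemann sphere. -/
abbrev Sphere : Type := OnePoint ℂ

/-- The finite part `A ∩ ℂ` of a subset of the sphere. -/
def finitePart (A : Set Sphere) : Set ℂ := {z | (z : Sphere) ∈ A}

/-- A subset of the plane, seen as a subset of the sphere. -/
def inSphere (A : Set ℂ) : Set Sphere := (fun z : ℂ => (z : Sphere)) '' A

/-- The coordinate of a finite point of the sphere (and `0` at the point at infinity). -/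
def toComplex (x : Sphere) : ℂ := x.elim 0 id

open Classical in
/-- A holomorphic coordinate of the sphere near `x`: the identity if `x` is finite, and `z ↦ 1 / z`
(with `∞ ↦ 0`) if `x = ∞`. -/
def coordAt (x : Sphere) : Sphere → ℂ :=
  if x = OnePoint.infty then fun y => (toComplex y)⁻¹ else toComplex

open Classical in
/-- The inverse of the coordinate `coordAt x`. -/
def paramAt (x : Sphere) : ℂ → Sphere :=
  if x = OnePoint.infty then fun z => if z = 0 then OnePoint.infty else ((z⁻¹ : ℂ) : Sphere)
  else fun z => (z : Sphere)

/-- A nonempty connected open subset of the sphere. -/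
def IsSphereDomain (G : Set Sphere) : Prop := IsOpen G ∧ IsConnected G

/-- Holomorphic maps from an open subset `G` of the sphere to the sphere: continuous, and complex
differentiable in the coordinates at each point of `G`. -/
def IsHolomorphicOn (f : Sphere → Sphere) (G : Set Sphere) : Prop :=
  ContinuousOn f G ∧
    ∀ x ∈ G, DifferentiableAt ℂ (coordAt (f x) ∘ f ∘ paramAt x) (coordAt x x)

/-- `f` restricts to a conformal homeomorphism of the domain `G` onto the domain `G'`. -/
def IsConformalHomeo (f : Sphere → Sphere) (G G' : Set Sphere) : Prop :=
  IsHolomorphicOn f G ∧ BijOn f G G'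

/-- The set of connected components of the complement of `G`. -/
def complComps (G : Set Sphere) : Set (Set Sphere) :=
  {p | ∃ x ∈ Gᶜ, p = connectedComponentIn Gᶜ x}

/-- The complementary components of `G` whose finite part has positive Euclidean diameter. -/
def nontrivialComps (G : Set Sphere) : Set (Set Sphere) :=
  {p | p ∈ complComps G ∧ 0 < Metric.ediam (finitePart p)}

/-! The space obtained by collapsing each complementary component to a point. -/

/-- The equivalence relation which collapses each complementary component of `G` to a point. -/
def hatSetoid (G : Set Sphere) : Setoid Sphere where
  r z w := (z = w ∧ z ∈ G) ∨ ∃ p ∈ complComps G, z ∈ p ∧ w ∈ p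
  iseqv := by
    refine ⟨fun z => ?_, ?_, ?_⟩
    · by_cases hz : z ∈ G
      · exact Or.inl ⟨rfl, hz⟩
      · exact Or.inr ⟨_, ⟨z, hz, rfl⟩, mem_connectedComponentIn hz, mem_connectedComponentIn hz⟩
    · rintro z w (⟨rfl, hz⟩ | ⟨p, hp, hz, hw⟩)
      · exact Or.inl ⟨rfl, hz⟩
      · exact Or.inr ⟨p, hp, hw, hz⟩
    · rintro z w v (⟨rfl, hz⟩ | ⟨p, hp, hz, hw⟩) (⟨rfl, hw'⟩ | ⟨q, hq, hw', hv⟩)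
      · exact Or.inl ⟨rfl, hz⟩
      · exact Or.inr ⟨q, hq, hw', hv⟩
      · exact Or.inr ⟨p, hp, hz, hw⟩
      · obtain ⟨x, -, rfl⟩ := hp
        obtain ⟨y, -, rfl⟩ := hq
        rw [connectedComponentIn_eq hw'] at hv
        rw [connectedComponentIn_eq hw] at hz
        exact Or.inr ⟨connectedComponentIn Gᶜ w,
          ⟨w, connectedComponentIn_subset _ _ hw, rfl⟩, hz, hv⟩

/-- The quotient space `Ĝ`, with the quotient topology. -/
def Hat (G : Set Sphere) : Type := Quotient (hatSetoid G)

instance (G : Set Sphere) : TopologicalSpace (Hat G) :=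
  inferInstanceAs (TopologicalSpace (Quotient (hatSetoid G)))

/-- The quotient map onto `Ĝ`. -/
def proj (G : Set Sphere) (z : Sphere) : Hat G := Quotient.mk (hatSetoid G) z

/-- The complementary components of `G`, as points of `Ĝ`. -/
def compPoints (G : Set Sphere) : Set (Hat G) := proj G '' Gᶜ

/-- `F` is the homeomorphic extension of `f : G → G'` to the quotient spaces. -/
def IsHatExtension (f : Sphere → Sphere) (G G' : Set Sphere) (F : Hat G ≃ₜ Hat G') : Prop :=
  ∀ z ∈ G, F (proj G z) = proj G' (f z)

/-- The image of `A` under the homeomorphic extension of `f`, as a subset of the sphere: all points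
whose class in `Ĝ'` is the image of the class of a point of `A`. In particular, if `A` is a
complementary component of `G`, this is the corresponding complementary component of `G'`. A
homeomorphism between domains has exactly one homeomorphic extension to the quotient spaces. -/
def hatImage (f : Sphere → Sphere) (G G' : Set Sphere) (A : Set Sphere) : Set Sphere :=
  {w | ∃ F : Hat G ≃ₜ Hat G', IsHatExtension f G G' F ∧ ∃ z ∈ A, F (proj G z) = proj G' w}

/-! Paths and transboundary modulus. -/

/-- The family of the compositions of the homeomorphic extension of `f` with the paths of `Γ`. -/
def hatFamily (f : Sphere → Sphere) (G G' : Set Sphere) (Γ : Set C(I, Hat G)) :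
    Set C(I, Hat G') :=
  {η | ∃ F : Hat G ≃ₜ Hat G', IsHatExtension f G G' F ∧ ∃ γ ∈ Γ, ∀ t, η t = F (γ t)}

/-- The integral of `h` with respect to arclength along the restriction of `c` to `[u, v]`, defined
through the arclength parametrization; it is `∞` when the restriction is not rectifiable. -/
def arcIntegral (h : ℂ → ℝ≥0∞) (c : I → ℂ) (u v : I) : ℝ≥0∞ :=
  open Classical in
  if eVariationOn c (Icc u v) = ⊤ then ⊤
  else ∫⁻ s in Icc 0 (variationOnFromTo c (Icc u v) u v),
    h (naturalParameterization c (Icc u v) u s)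

/-- The parameters at which the path runs in `G ∩ ℂ`. -/
def finiteTimes {G : Set Sphere} (γ : C(I, Hat G)) : Set I :=
  {t | γ t ∈ proj G '' (G ∩ inSphere univ)}

/-- The planar coordinate of the path; it is meaningful at the parameters in `finiteTimes γ`, where
the class `γ t` consists of a single point of `G ∩ ℂ`. -/
def planarPath {G : Set Sphere} (γ : C(I, Hat G)) (t : I) : ℂ :=
  toComplex (Quotient.out (s := hatSetoid G) (γ t))

/-- The path integral of `ρ` over the part of `γ` in `G`: the sum, over the components of the set
of parameters at which `γ` runs in `G ∩ ℂ`, of the integrals over these pieces of `γ`; the integral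
over a piece is the supremum of the integrals over its compact subpaths. -/
def pathIntegral {G : Set Sphere} (ρ : Hat G → ℝ≥0∞) (γ : C(I, Hat G)) : ℝ≥0∞ :=
  ∑' S : {S : Set I // ∃ t ∈ finiteTimes γ, S = connectedComponentIn (finiteTimes γ) t},
    ⨆ (u : I) (v : I) (_ : u ≤ v) (_ : Icc u v ⊆ S.1),
      arcIntegral (fun z => ρ (proj G (z : Sphere))) (planarPath γ) u v

/-- Admissible functions: Borel functions on `Ĝ` for which the path integral plus the sum of the
values at the complementary components met by the path is at least `1` for each path. -/
def admissible {G : Set Sphere} (Γ : Set C(I, Hat G)) : Set (Hat G → ℝ≥0∞) :=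
  {ρ | Measurable[borel (Hat G)] ρ ∧
    ∀ γ ∈ Γ, 1 ≤ pathIntegral ρ γ + ∑' x : {x : Hat G // x ∈ compPoints G ∩ range γ}, ρ x.1}

/-- The transboundary modulus of a family of paths in `Ĝ`. -/
def modulus {G : Set Sphere} (Γ : Set C(I, Hat G)) : ℝ≥0∞ :=
  ⨅ ρ ∈ admissible Γ,
    (∫⁻ z in finitePart G, ρ (proj G (z : Sphere)) ^ 2) + ∑' x : compPoints G, ρ x.1 ^ 2

/-- The paths in `Ĝ \ π(P)` that join `π(A)` and `π(B)`. -/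
def joiningPaths (G : Set Sphere) (P A B : Set Sphere) : Set C(I, Hat G) :=
  {γ | (∀ t, γ t ∉ proj G '' P) ∧ γ 0 ∈ proj G '' A ∧ γ 1 ∈ proj G '' B}

/-- The paths in `Ĝ \ π(P)` that separate `π(A)` and `π(P)`: the path meets neither set, and no
component of the complement of the path meets both. -/
def separatingPaths (G : Set Sphere) (P A : Set Sphere) : Set C(I, Hat G) :=
  {γ | (∀ t, γ t ∉ proj G '' P) ∧ (∀ t, γ t ∉ proj G '' A) ∧
    ∀ x ∈ proj G '' A, ∀ y ∈ proj G '' P,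
      connectedComponentIn (range γ)ᶜ x ≠ connectedComponentIn (range γ)ᶜ y}

/-! Quasitripods, and the two conditions on the domain. -/

/-- The standard tripod: the union of the segments from `0` to the third roots of unity. -/
def standardTripod : Set ℂ :=
  ⋃ j : Fin 3, segment ℝ 0 (Complex.exp (2 * Real.pi * (j : ℕ) / 3 * Complex.I))

/-- Weakly `H`-quasisymmetric images of the standard tripod. -/
def IsQuasitripod (H : ℝ) (T : Set ℂ) : Prop :=
  ∃ φ : standardTripod ≃ₜ T, ∀ z₁ z₂ z₃ : standardTripod,
    dist (z₂ : ℂ) z₁ ≤ dist (z₃ : ℂ) z₁ →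
      dist (φ z₂ : ℂ) (φ z₁) ≤ H * dist (φ z₃ : ℂ) (φ z₁)

/-- Each nontrivial complementary component contains a large `H`-quasitripod. -/
def QuasitripodCondition (Ω : Set Sphere) (H : ℝ) : Prop :=
  ∀ p ∈ nontrivialComps Ω, ∃ T ⊆ finitePart p,
    IsQuasitripod H T ∧ Metric.diam (finitePart p) / H ≤ Metric.diam T

/-- At most `N` complementary components of diameter at least `r` meet a given disk of
radius `r`. -/
def PackingCondition (Ω : Set Sphere) (N : ℕ) : Prop :=
  ∀ (z₀ : ℂ) (r : ℝ), 0 < r →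
    {p | p ∈ nontrivialComps Ω ∧ r ≤ Metric.diam (finitePart p) ∧
      (finitePart p ∩ Metric.ball z₀ r).Nonempty}.encard ≤ N

/-! The approximating domains, and some elementary notions. -/

/-- The sphere without the first sets `p 0, …, p n` of a sequence. -/
def approxDomain (p : ℕ → Set Sphere) (n : ℕ) : Set Sphere := (⋃ l ∈ Finset.range (n + 1), p l)ᶜ

/-- Jordan curves in the sphere: the images of injective continuous maps of the circle. -/
def IsJordanCurve (J : Set Sphere) : Prop :=
  ∃ c : Circle → Sphere, Continuous c ∧ Function.Injective c ∧ range c = J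

/-- The Euclidean distance of two subsets of the plane. -/
def setEDist (A B : Set ℂ) : ℝ≥0∞ := ⨅ z ∈ A, Metric.infEDist z B

end Transboundary

end

open Transboundary

/-! Both parts are length-area estimates in the image domain, which is the unit disk minus finitely
many closed disks. A path in the quotient may run through a removed disk at the price of a single
value of `ρ`, so straight segments in the plane induce paths with controlled cost. The geometric
input is that a round disk whose values under a `1`-Lipschitz function fill a long interval has area
at least comparable to the square of that length (`sq_volume_image_le`). With a weighted AM-GM
inequality, the total cost of a family of level sets is at most `ε` times an area plus `ε⁻¹` times
the mass of `ρ`.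

Part 1. By the identity theorem the limit map is nonconstant on `J` (`exists_ne_of_nonconst`), so
the images of `J` have diameter bounded below. The image of the half-open segment from `a` to `b`
accumulates at the image of `pbar`, so its diameter is at least the distance of `f j b` to that
image. A connected set of diameter at least `d` crosses all axis-parallel lines, in one of the two
directions, over an interval of length `d / 2`. If the mass of `ρ` were below a fixed multiple of `d
^ 2`, some of these lines would cost less than `1 / 6` (`exists_lineCost_lt`). Two such lines can be
linked without touching the image of `pbar`. If that image is the exterior of the unit disk, the
link uses cheap lines near the center. Otherwise the image is convex, so one of the two directions
along a line leaves the unit disk without meeting it, and the whole exterior is one point of the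
quotient with value below `1 / 6`. The total is below `1`, against admissibility
(`mass_ge_of_joining`). This gives `φ t = κ * t ^ 2`, with the same `κ` for all `a`.

Part 2. If the image of `pbar` is a point `w`, then `{w}` is a complementary component of the limit
domain and has arbitrarily small neighborhoods with boundary in that domain. These boundaries
correspond to compact subsets of `Ω`, where the maps converge uniformly. Hence, for large `j`, all
removed disks that come close to `w` are small (`exists_small_classes`). This allows any number `m`
of square annuli around `w`, no two of which meet a common disk. The squares in each annulus are
separating loops (`mem_separatingPaths`), so each annulus carries mass at least `1 / 5000`
(`mass_ge_of_annulus`), and these masses add up. -/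

noncomputable section

namespace Transboundary

/-! ### Complementary components and saturated sets -/

section Saturated

variable {G G' : Set Sphere}

/-- `interior V` and the complement of `closure V` are disjoint open sets that omit only the
frontier. The main use is saturation: a set with frontier in `G` contains every complementary
component of `G` that it meets. -/
theorem _root_.IsPreconnected.subset_of_disjoint_frontier {X : Type*} [TopologicalSpace X]
    {C V : Set X} (hC : IsPreconnected C) (hd : Disjoint C (frontier V))
    (hne : (C ∩ V).Nonempty) : C ⊆ V := by
  refine Subset.trans (hC.subset_left_of_subset_union isOpen_interior
    (isClosed_closure (s := V)).isOpen_compl ?_ ?_ ?_) interior_subset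
  · exact disjoint_compl_right.mono_left (interior_subset.trans subset_closure)
  · intro x hx
    by_cases h : x ∈ closure V
    · left
      by_contra h'
      exact disjoint_left.1 hd hx ⟨h, h'⟩
    · exact Or.inr h
  · obtain ⟨x, hxC, hxV⟩ := hne
    refine ⟨x, hxC, ?_⟩
    by_contra h'
    exact disjoint_left.1 hd hxC ⟨subset_closure hxV, h'⟩

theorem proj_eq_iff {z w : Sphere} : proj G z = proj G w ↔
    (z = w ∧ z ∈ G) ∨ ∃ p ∈ complComps G, z ∈ p ∧ w ∈ p :=
  Quotient.eq (r := hatSetoid G)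

theorem proj_surjective : Function.Surjective (proj G) := fun x => Quotient.exists_rep x

theorem isQuotientMap_proj : IsQuotientMap (proj G) :=
  isQuotientMap_quotient_mk' (s := hatSetoid G)

theorem continuous_proj : Continuous (proj G) := isQuotientMap_proj.continuous

theorem complComps_subset {p : Set Sphere} (hp : p ∈ complComps G) : p ⊆ Gᶜ := by
  obtain ⟨x, -, rfl⟩ := hp
  exact connectedComponentIn_subset _ _

theorem isPreconnected_of_mem_complComps {p : Set Sphere} (hp : p ∈ complComps G) :
    IsPreconnected p := by
  obtain ⟨x, -, rfl⟩ := hp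
  exact isPreconnected_connectedComponentIn

theorem eq_connectedComponentIn {p : Set Sphere} (hp : p ∈ complComps G) {x : Sphere}
    (hx : x ∈ p) : p = connectedComponentIn Gᶜ x := by
  obtain ⟨y, -, rfl⟩ := hp
  exact connectedComponentIn_eq hx

theorem complComps_nonempty {p : Set Sphere} (hp : p ∈ complComps G) : p.Nonempty := by
  obtain ⟨x, hx, rfl⟩ := hp
  exact ⟨x, mem_connectedComponentIn hx⟩

theorem proj_eq_iff_of_mem {z w : Sphere} (hz : z ∈ G) : proj G z = proj G w ↔ z = w := by
  refine ⟨fun h => ?_, fun h => h ▸ rfl⟩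
  rcases proj_eq_iff.1 h with h | ⟨p, hp, hzp, -⟩
  · exact h.1
  · exact absurd hz (complComps_subset hp hzp)

theorem proj_eq_iff_of_mem_comp {p : Set Sphere} (hp : p ∈ complComps G) {z w : Sphere}
    (hz : z ∈ p) : proj G w = proj G z ↔ w ∈ p := by
  rw [proj_eq_iff]
  constructor
  · rintro (⟨h, -⟩ | ⟨q, hq, hw, hz'⟩)
    · exact h ▸ hz
    · rw [eq_connectedComponentIn hp hz, ← eq_connectedComponentIn hq hz']
      exact hw
  · exact fun hw => Or.inr ⟨p, hp, hw, hz⟩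

theorem mem_of_proj_eq {z w : Sphere} (h : proj G z = proj G w) (hz : z ∈ G) : w ∈ G :=
  (proj_eq_iff_of_mem hz).1 h ▸ hz

theorem proj_mem_compPoints {z : Sphere} : proj G z ∈ compPoints G ↔ z ∉ G :=
  ⟨fun ⟨_, hw, h⟩ hz => hw (mem_of_proj_eq h.symm hz), fun h => ⟨z, h, rfl⟩⟩

/-- Points of a set with frontier in `G` form a union of classes. -/
theorem mem_of_proj_eq_of_frontier {V : Set Sphere} (hV : frontier V ⊆ G) {z w : Sphere}
    (h : proj G z = proj G w) (hz : z ∈ V) : w ∈ V := by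
  rcases proj_eq_iff.1 h with h | ⟨p, hp, hzp, hwp⟩
  · exact h.1 ▸ hz
  · refine (isPreconnected_of_mem_complComps hp).subset_of_disjoint_frontier ?_ ⟨z, hzp, hz⟩ hwp
    exact (disjoint_compl_left.mono (complComps_subset hp) hV)

theorem isOpen_proj_image {V : Set Sphere} (hVo : IsOpen V) (hV : frontier V ⊆ G) :
    IsOpen (proj G '' V) := by
  rw [← isQuotientMap_proj.isOpen_preimage]
  convert hVo using 1
  ext z
  exact ⟨fun ⟨w, hw, h⟩ => mem_of_proj_eq_of_frontier hV h hw, fun h => ⟨z, h, rfl⟩⟩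

/-- A neighborhood of a complementary component contains one whose boundary lies in `G`. -/
theorem exists_nhd_comp (hG : IsOpen G) {p O : Set Sphere} (hp : p ∈ complComps G)
    (hO : IsOpen O) (hpO : p ⊆ O) :
    ∃ V, IsOpen V ∧ p ⊆ V ∧ V ⊆ O ∧ frontier V ⊆ G := by
  obtain ⟨x, hx, rfl⟩ := hp
  have hK : IsCompact Gᶜ := hG.isClosed_compl.isCompact
  have : CompactSpace (Gᶜ : Set Sphere) := isCompact_iff_compactSpace.1 hK
  set X : (Gᶜ : Set Sphere) := ⟨x, hx⟩
  have hcc : connectedComponentIn Gᶜ x = (↑) '' connectedComponent X :=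
    connectedComponentIn_eq_image hx
  have hO' : IsOpen (Subtype.val ⁻¹' O : Set (Gᶜ : Set Sphere)) :=
    hO.preimage continuous_subtype_val
  -- In the compact Hausdorff space `Gᶜ` a component is the intersection of the clopen sets around
  -- it, so compactness provides a clopen set `Z` between the component and `O`.
  have hsub : (⋂ s : { s : Set (Gᶜ : Set Sphere) // IsClopen s ∧ X ∈ s }, s.1) ⊆
      Subtype.val ⁻¹' O := by
    rw [← connectedComponent_eq_iInter_isClopen]
    intro y hy
    exact hpO (hcc ▸ ⟨y, hy, rfl⟩)
  obtain ⟨Z, hZ, hXZ, hZO⟩ : ∃ Z : Set (Gᶜ : Set Sphere), IsClopen Z ∧ X ∈ Z ∧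
      Z ⊆ Subtype.val ⁻¹' O := by
    have : Nonempty { s : Set (Gᶜ : Set Sphere) // IsClopen s ∧ X ∈ s } :=
      ⟨⟨univ, isClopen_univ, mem_univ _⟩⟩
    obtain ⟨⟨s, hs⟩, h⟩ := exists_subset_nhds_of_compactSpace
      (V := fun s : { s : Set (Gᶜ : Set Sphere) // IsClopen s ∧ X ∈ s } => s.1)
      (fun a b => ⟨⟨a.1 ∩ b.1, a.2.1.inter b.2.1, a.2.2, b.2.2⟩, inter_subset_left,
        inter_subset_right⟩) (fun s => s.2.1.isClosed) (U := Subtype.val ⁻¹' O)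
      (fun y hy => hO'.mem_nhds (hsub hy))
    exact ⟨s, hs.1, hs.2, h⟩
  set Z1 : Set Sphere := (↑) '' Z
  set Z2 : Set Sphere := (↑) '' Zᶜ
  have hZ1 : IsClosed Z1 := (hZ.isClosed.isCompact.image continuous_subtype_val).isClosed
  have hZ2 : IsClosed Z2 :=
    (hZ.compl.isClosed.isCompact.image continuous_subtype_val).isClosed
  have hdis : Disjoint Z1 (Z2 ∪ Oᶜ) := by
    rw [disjoint_union_right]
    constructor
    · exact (disjoint_image_iff Subtype.val_injective).2 disjoint_compl_right
    · rw [disjoint_left]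
      rintro _ ⟨y, hy, rfl⟩ h
      exact h (hZO hy)
  have hW : Z1 ⊆ (Z2 ∪ Oᶜ)ᶜ := fun y hy h => disjoint_left.1 hdis hy h
  -- `closure V` avoids the other clopen piece `Z2`, and `V` itself contains `Z1`, so no frontier
  -- point of `V` is left in `Gᶜ`.
  obtain ⟨V, hVo, hZV, hVW⟩ := normal_exists_closure_subset hZ1
    (hZ2.union hO.isClosed_compl).isOpen_compl hW
  refine ⟨V, hVo, ?_, ?_, ?_⟩
  · rw [hcc]
    exact (image_mono (hZ.connectedComponent_subset hXZ)).trans hZV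
  · intro y hy
    by_contra h
    exact hVW (subset_closure hy) (Or.inr h)
  · intro y hy
    by_contra hyG
    rw [hVo.frontier_eq] at hy
    by_cases h : (⟨y, hyG⟩ : (Gᶜ : Set Sphere)) ∈ Z
    · exact hy.2 (hZV ⟨_, h, rfl⟩)
    · exact hVW hy.1 (Or.inl ⟨_, h, rfl⟩)

/-- The decomposition is upper semicontinuous: a component that misses a closed set has, by
`exists_nhd_comp`, a saturated neighborhood that misses it too. -/
theorem isClosedMap_proj (hG : IsOpen G) : IsClosedMap (proj G) := by
  intro Z hZ
  rw [← isQuotientMap_proj.isClosed_preimage, ← isOpen_compl_iff, isOpen_iff_mem_nhds]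
  intro x hx
  have hx' : ∀ z ∈ Z, proj G z ≠ proj G x := fun z hz h => hx ⟨z, hz, h⟩
  by_cases hxG : x ∈ G
  · filter_upwards [(hG.inter hZ.isOpen_compl).mem_nhds ⟨hxG, fun h => hx' x h rfl⟩]
      with y hy ⟨z, hz, h⟩
    exact hy.2 ((proj_eq_iff_of_mem hy.1).1 h.symm ▸ hz)
  · have hp : connectedComponentIn Gᶜ x ∈ complComps G := ⟨x, hxG, rfl⟩
    have hxp := mem_connectedComponentIn (show x ∈ Gᶜ from hxG)
    obtain ⟨V, hVo, hpV, hVZ, hfV⟩ := exists_nhd_comp hG hp hZ.isOpen_compl fun y hy hyZ =>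
      hx' y hyZ ((proj_eq_iff_of_mem_comp hp hxp).2 hy)
    filter_upwards [hVo.mem_nhds (hpV hxp)] with y hy ⟨z, hz, h⟩
    exact hVZ (mem_of_proj_eq_of_frontier hfV h.symm hy) hz

/-- A connected subset of the quotient cannot meet the images of two disjoint open sets whose
union has a complement that it avoids. -/
theorem separation (hG : IsOpen G) {A B Z : Set Sphere} (hA : IsOpen A) (hB : IsOpen B)
    (hAB : Disjoint A B) (hZ : (A ∪ B)ᶜ ⊆ Z) (hZc : IsClosed Z) {K : Set (Hat G)}
    (hK : IsPreconnected K)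
    (hKZ : ∀ z ∈ Z, proj G z ∉ K) {a b : Sphere} (ha : a ∈ A) (hb : b ∈ B) (haK : proj G a ∈ K)
    (hbK : proj G b ∈ K) : False := by
  have hS : IsClosed (proj G ⁻¹' (proj G '' Z)) :=
    (isClosedMap_proj hG _ hZc).preimage continuous_proj
  set S := proj G ⁻¹' (proj G '' Z)
  have hZS : Z ⊆ S := fun z hz => ⟨z, hz, rfl⟩
  -- A class that avoids the saturation `S` of `Z` avoids the frontier of `A`, which lies in `Z`, so
  -- it cannot leave `A`. Hence `A \ S` is saturated and its image in the quotient is open.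
  have key : ∀ A B : Set Sphere, IsOpen A → IsOpen B → Disjoint A B → (A ∪ B)ᶜ ⊆ Z →
      proj G ⁻¹' (proj G '' (A \ S)) = A \ S := by
    intro A B hA hB hAB hZ
    ext z
    refine ⟨?_, fun h => ⟨z, h, rfl⟩⟩
    rintro ⟨w, ⟨hwA, hwS⟩, h⟩
    have hzS : z ∉ S := fun ⟨y, hy, hyz⟩ => hwS ⟨y, hy, hyz.trans h.symm⟩
    refine ⟨?_, hzS⟩
    rcases proj_eq_iff.1 h with h | ⟨p, hp, hwp, hzp⟩
    · exact h.1 ▸ hwA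
    · have hpS : Disjoint p S := by
        rw [disjoint_left]
        rintro y hy ⟨z', hz', hz'y⟩
        exact hwS ⟨z', hz', hz'y.trans ((proj_eq_iff_of_mem_comp hp hwp).2 hy)⟩
      refine (isPreconnected_of_mem_complComps hp).subset_of_disjoint_frontier ?_ ⟨w, hwp, hwA⟩ hzp
      refine hpS.mono_right (Subset.trans ?_ hZS)
      refine Subset.trans ?_ hZ
      rw [hA.frontier_eq]
      rintro y ⟨hy, hyA⟩ (h | h)
      · exact hyA h
      · exact disjoint_left.1 (hAB.symm.closure_right hB) h hy
  have oA : IsOpen (proj G '' (A \ S)) := by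
    rw [← isQuotientMap_proj.isOpen_preimage, key A B hA hB hAB hZ]
    exact hA.sdiff hS
  have oB : IsOpen (proj G '' (B \ S)) := by
    rw [← isQuotientMap_proj.isOpen_preimage, key B A hB hA hAB.symm (by rwa [union_comm])]
    exact hB.sdiff hS
  have hnS : ∀ z, proj G z ∈ K → z ∉ S := fun z hz ⟨y, hy, hyz⟩ => hKZ y hy (hyz ▸ hz)
  obtain ⟨x, -, ⟨z, hz, rfl⟩, ⟨w, hw, hwz⟩⟩ := hK _ _ oA oB (by
      intro x hx
      obtain ⟨z, rfl⟩ := proj_surjective x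
      have hzS := hnS z hx
      by_cases h : z ∈ A ∪ B
      · rcases h with h | h
        · exact Or.inl ⟨z, ⟨h, hzS⟩, rfl⟩
        · exact Or.inr ⟨z, ⟨h, hzS⟩, rfl⟩
      · exact absurd (hZS (hZ h)) hzS)
    ⟨_, haK, a, ⟨ha, hnS a haK⟩, rfl⟩ ⟨_, hbK, b, ⟨hb, hnS b hbK⟩, rfl⟩
  have h2 : w ∈ proj G ⁻¹' (proj G '' (A \ S)) := ⟨z, hz, hwz.symm⟩
  rw [key A B hA hB hAB hZ] at h2
  exact disjoint_left.1 hAB h2.1 hw.1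

/-! ### Transport of sets by a homeomorphism of the quotients -/

/-- The subset of the sphere that corresponds to `A` under a homeomorphism of the quotients. -/
def transport (F : Hat G ≃ₜ Hat G') (A : Set Sphere) : Set Sphere :=
  {w | ∃ z ∈ A, F (proj G z) = proj G' w}

theorem transport_eq_preimage (F : Hat G ≃ₜ Hat G') (A : Set Sphere) :
    transport F A = proj G' ⁻¹' (F '' (proj G '' A)) := by
  ext w
  simp [transport]

theorem transport_mono (F : Hat G ≃ₜ Hat G') {A B : Set Sphere} (h : A ⊆ B) :
    transport F A ⊆ transport F B := fun _ ⟨z, hz, e⟩ => ⟨z, h hz, e⟩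

theorem transport_nonempty (F : Hat G ≃ₜ Hat G') {A : Set Sphere} (h : A.Nonempty) :
    (transport F A).Nonempty := by
  obtain ⟨z, hz⟩ := h
  obtain ⟨w, hw⟩ := proj_surjective (F (proj G z))
  exact ⟨w, z, hz, hw.symm⟩

theorem isOpen_transport (F : Hat G ≃ₜ Hat G') {U : Set Sphere} (hU : IsOpen U)
    (hfU : frontier U ⊆ G) : IsOpen (transport F U) := by
  rw [transport_eq_preimage]
  exact ((F.isOpenMap _ (isOpen_proj_image hU hfU))).preimage continuous_proj

theorem mem_of_mem_transport (F : Hat G ≃ₜ Hat G') {U : Set Sphere} (hfU : frontier U ⊆ G)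
    {z w : Sphere} (h : F (proj G z) = proj G' w) (hw : w ∈ transport F U) : z ∈ U := by
  obtain ⟨y, hy, hyw⟩ := hw
  exact mem_of_proj_eq_of_frontier hfU (F.injective (hyw.trans h.symm)) hy

/-- `U` and the complement of `closure U` are transported to disjoint open sets, so a frontier point
of the first set comes from neither of them. -/
theorem frontier_transport (F : Hat G ≃ₜ Hat G') {U : Set Sphere} (hU : IsOpen U)
    (hfU : frontier U ⊆ G) : frontier (transport F U) ⊆ transport F (frontier U) := by
  intro w hw
  have hfU' : frontier (closure U)ᶜ ⊆ G := by
    rw [frontier_compl]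
    exact frontier_closure_subset.trans hfU
  have o1 := isOpen_transport F hU hfU
  have o2 := isOpen_transport F isClosed_closure.isOpen_compl hfU'
  rw [o1.frontier_eq] at hw
  obtain ⟨x, hx⟩ := proj_surjective (F.symm (proj G' w))
  have hx' : F (proj G x) = proj G' w := by rw [hx, F.apply_symm_apply]
  refine ⟨x, ?_, hx'⟩
  rw [hU.frontier_eq]
  refine ⟨?_, fun h => hw.2 ⟨x, h, hx'⟩⟩
  by_contra h
  have hd : Disjoint (transport F U) (transport F (closure U)ᶜ) := by
    rw [disjoint_left]
    rintro y hy ⟨z, hz, hzy⟩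
    exact hz (subset_closure (mem_of_mem_transport F hfU hzy hy))
  exact disjoint_left.1 (hd.closure_left o2) hw.1 ⟨x, h, hx'⟩

theorem transport_of_subset {f : Sphere → Sphere} {F : Hat G ≃ₜ Hat G'}
    (hF : IsHatExtension f G G' F) (hf : MapsTo f G G') {A : Set Sphere} (hA : A ⊆ G) :
    transport F A = f '' A := by
  ext w
  constructor
  · rintro ⟨z, hz, h⟩
    rw [hF z (hA hz)] at h
    exact ⟨z, hz, (proj_eq_iff_of_mem (hf (hA hz))).1 h⟩
  · rintro ⟨z, hz, rfl⟩
    exact ⟨z, hz, hF z (hA hz)⟩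

end Saturated

/-! ### Subsets of the plane in the sphere -/

theorem isOpen_inSphere {A : Set ℂ} (hA : IsOpen A) : IsOpen (inSphere A) :=
  OnePoint.isOpenEmbedding_coe.isOpenMap A hA

theorem coe_mem_inSphere {A : Set ℂ} {z : ℂ} : (z : Sphere) ∈ inSphere A ↔ z ∈ A :=
  ⟨fun ⟨_, hw, h⟩ => OnePoint.coe_injective h ▸ hw, fun h => ⟨z, h, rfl⟩⟩

theorem infty_notMem_inSphere {A : Set ℂ} : (OnePoint.infty : Sphere) ∉ inSphere A :=
  fun ⟨z, _, h⟩ => OnePoint.coe_ne_infty z h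

theorem isClosed_finitePart {A : Set Sphere} (h : IsClosed A) : IsClosed (finitePart A) :=
  h.preimage OnePoint.continuous_coe

theorem isOpen_finitePart {A : Set Sphere} (h : IsOpen A) : IsOpen (finitePart A) :=
  h.preimage OnePoint.continuous_coe

theorem isPreconnected_inSphere {A : Set ℂ} (h : IsPreconnected A) :
    IsPreconnected (inSphere A) := h.image _ OnePoint.continuous_coe.continuousOn

theorem isCompact_inSphere {A : Set ℂ} (h : IsCompact A) : IsCompact (inSphere A) :=
  h.image OnePoint.continuous_coe

theorem toComplex_coe (z : ℂ) : toComplex (z : Sphere) = z := rfl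

theorem coe_toComplex {x : Sphere} (h : x ≠ OnePoint.infty) : (toComplex x : Sphere) = x := by
  obtain ⟨z, rfl⟩ := OnePoint.ne_infty_iff_exists.1 h
  rfl

theorem ne_infty_of_mem_inSphere {A : Set ℂ} {x : Sphere} (h : x ∈ inSphere A) :
    x ≠ OnePoint.infty := fun e => infty_notMem_inSphere (e ▸ h)

theorem toComplex_mem {A : Set ℂ} {x : Sphere} (h : x ∈ inSphere A) : toComplex x ∈ A := by
  obtain ⟨z, hz, rfl⟩ := h
  exact hz

/-- The exterior of a disk in the sphere is connected. -/
theorem isPreconnected_compl_inSphere_ball (w : ℂ) {R : ℝ} (hR : 0 < R) :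
    IsPreconnected (inSphere (Metric.ball w R))ᶜ := by
  have h1 : IsPreconnected (Metric.ball w R)ᶜ := by
    have : (Metric.ball w R)ᶜ = (fun z : ℂ => w + R * Complex.exp z) '' {z | 0 ≤ z.re} := by
      ext z
      simp only [mem_compl_iff, Metric.mem_ball, not_lt, mem_image, mem_ofPred_eq, dist_eq_norm]
      constructor
      · intro h
        have hne : (z - w) / R ≠ 0 := by
          apply div_ne_zero
          · exact norm_pos_iff.1 (hR.trans_le h)
          · exact_mod_cast hR.ne'
        refine ⟨Complex.log ((z - w) / R), ?_, ?_⟩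
        · rw [Complex.log_re]
          apply Real.log_nonneg
          rw [norm_div, Complex.norm_real, Real.norm_of_nonneg hR.le, le_div_iff₀ hR]
          simpa using h
        · rw [Complex.exp_log hne]
          have : (R : ℂ) ≠ 0 := by exact_mod_cast hR.ne'
          field_simp
          ring
      · rintro ⟨y, hy, rfl⟩
        rw [add_sub_cancel_left, norm_mul, Complex.norm_real, Real.norm_of_nonneg hR.le,
          Complex.norm_exp]
        exact le_mul_of_one_le_right hR.le (Real.one_le_exp hy)
    rw [this]
    apply IsPreconnected.image
    · exact (convex_halfSpace_ge Complex.reCLM.isLinear 0).isPreconnected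
    · fun_prop
  refine (isPreconnected_inSphere h1).subset_closure ?_ ?_
  · rintro _ ⟨z, hz, rfl⟩
    exact fun h => hz (coe_mem_inSphere.1 h)
  · intro x hx
    induction x using OnePoint.rec with
    | coe z => exact subset_closure ⟨z, fun h => hx ⟨z, h, rfl⟩, rfl⟩
    | infty =>
      rw [mem_closure_iff_nhds]
      intro t ht
      rw [OnePoint.nhds_infty_eq] at ht
      have ht' : {z : ℂ | (z : Sphere) ∈ t} ∈ coclosedCompact ℂ := ht.1
      rw [Filter.coclosedCompact_eq_cocompact, ← Metric.cobounded_eq_cocompact] at ht'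
      have h3 : (Metric.ball w R)ᶜ ∈ Bornology.cobounded ℂ :=
        Bornology.IsBounded.compl Metric.isBounded_ball
      obtain ⟨z, hz1, hz2⟩ := (Filter.nonempty_of_mem (inter_mem ht' h3))
      exact ⟨z, hz1, z, hz2, rfl⟩

/-! ### Path integrals along Lipschitz paths -/

/-- Length is one-dimensional Hausdorff measure, which a `K`-Lipschitz map multiplies by at most
`K`, whether or not the map is injective. -/
theorem volume_image_le_of_lipschitzOn {V : I → ℝ} {K : ℝ≥0} {A : Set I}
    (hV : LipschitzOnWith K V A) : volume (V '' A) ≤ K * volume A := by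
  have h1 : volume A = Measure.hausdorffMeasure 1 A := by
    rw [unitInterval.volume_apply, ← hausdorffMeasure_real,
      isometry_subtype_coe.hausdorffMeasure_image (Or.inl zero_le_one)]
  rw [h1, ← hausdorffMeasure_real]
  simpa using hV.hausdorffMeasure_image_le zero_le_one

theorem eVariationOn_le_of_lipschitzOn {c : I → ℂ} {K : ℝ≥0} {s : Set I}
    (hc : LipschitzOnWith K c s) {t t' : I} :
    eVariationOn c (s ∩ Icc t t') ≤ ENNReal.ofReal (K * (t' - t)) := by
  refine iSup_le ?_
  rintro ⟨n, u, hu, hus⟩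
  calc ∑ i ∈ Finset.range n, edist (c (u (i + 1))) (c (u i))
      ≤ ∑ i ∈ Finset.range n, ENNReal.ofReal (K * ((u (i + 1) : ℝ) - u i)) := by
        refine Finset.sum_le_sum fun i _ => ?_
        refine (hc (hus _).1 (hus _).1).trans ?_
        rw [ENNReal.ofReal_mul K.coe_nonneg, ENNReal.ofReal_coe_nnreal, Subtype.edist_eq,
          edist_dist,
          Real.dist_eq, abs_of_nonneg]
        exact sub_nonneg.2 (hu (Nat.le_succ i))
    _ = ENNReal.ofReal (∑ i ∈ Finset.range n, K * ((u (i + 1) : ℝ) - u i)) := by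
        rw [ENNReal.ofReal_sum_of_nonneg]
        intro i _
        exact mul_nonneg K.coe_nonneg (sub_nonneg.2 (hu (Nat.le_succ i)))
    _ ≤ _ := by
        apply ENNReal.ofReal_le_ofReal
        rw [← Finset.mul_sum, Finset.sum_range_sub (fun i => (u i : ℝ))]
        have h1 : (u n : ℝ) ≤ t' := (hus n).2.2
        have h2 : (t : ℝ) ≤ u 0 := (hus 0).2.1
        exact mul_le_mul_of_nonneg_left (by linarith) K.coe_nonneg

/-- The variation function `V` is `K`-Lipschitz and covers the arclength interval, so Lebesgue
measure there is at most `K` times the image under `V` of the parameter measure. An upper bound is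
all that is needed, because densities are only tested on explicitly constructed paths. -/
theorem arcIntegral_le {h : ℂ → ℝ≥0∞} {c : I → ℂ} {K : ℝ≥0} {u v : I} (huv : u ≤ v)
    (hc : LipschitzOnWith K c (Icc u v)) :
    arcIntegral h c u v ≤ K * ∫⁻ t in Icc u v, h (c t) := by
  set s := Icc u v
  have hfin : ∀ t t' : I, t ≤ t' → eVariationOn c (s ∩ Icc t t') ≠ ⊤ := fun t t' _ =>
    ((eVariationOn_le_of_lipschitzOn hc).trans_lt ENNReal.ofReal_lt_top).ne
  have hbv : eVariationOn c s ≠ ⊤ := by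
    have := hfin u v huv
    rwa [inter_self] at this
  have hl : LocallyBoundedVariationOn c s :=
    BoundedVariationOn.locallyBoundedVariationOn hbv
  rw [arcIntegral, if_neg hbv]
  set V := variationOnFromTo c s u
  have hus : u ∈ s := left_mem_Icc.2 huv
  have hvs : v ∈ s := right_mem_Icc.2 huv
  have key : ∀ t ∈ s, ∀ t' ∈ s, t ≤ t' → dist (V t') (V t) ≤ K * dist t' t := by
    intro t ht t' ht' htt
    have h1 : V t' - V t = (eVariationOn c (s ∩ Icc t t')).toReal := by
      rw [variationOnFromTo.sub_right hl hus ht' ht, variationOnFromTo.eq_of_le _ _ htt]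
    rw [Real.dist_eq, h1, abs_of_nonneg ENNReal.toReal_nonneg, Subtype.dist_eq, Real.dist_eq,
      abs_of_nonneg (sub_nonneg.2 (show (t : ℝ) ≤ t' from htt))]
    refine ENNReal.toReal_le_of_le_ofReal ?_ (eVariationOn_le_of_lipschitzOn hc)
    exact mul_nonneg K.coe_nonneg (sub_nonneg.2 htt)
  have hV : LipschitzOnWith K V s := by
    refine LipschitzOnWith.of_dist_le_mul fun t ht t' ht' => ?_
    rcases le_total t t' with htt | htt
    · rw [dist_comm, dist_comm t]
      exact key t ht t' ht' htt
    · exact key t' ht' t ht htt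
  have hV0 : V u = 0 := variationOnFromTo.self _ _ _
  have hIVT : Icc 0 (V v) ⊆ V '' s := by
    have := intermediate_value_Icc huv hV.continuousOn
    rwa [hV0] at this
  have hVm : AEMeasurable V (volume.restrict s) := hV.continuousOn.aemeasurable measurableSet_Icc
  have hle : volume.restrict (Icc 0 (V v)) ≤ (K : ℝ≥0∞) • (volume.restrict s).map V := by
    refine Measure.le_iff.2 fun B hB => ?_
    rw [Measure.restrict_apply hB, Measure.smul_apply, smul_eq_mul,
      Measure.map_apply_of_aemeasurable hVm hB]
    calc volume (B ∩ Icc 0 (V v)) ≤ volume (V '' (V ⁻¹' B ∩ s)) := by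
          refine measure_mono ?_
          rintro x ⟨hxB, hx⟩
          obtain ⟨t, ht, rfl⟩ := hIVT hx
          exact ⟨t, ⟨hxB, ht⟩, rfl⟩
      _ ≤ K * volume (V ⁻¹' B ∩ s) :=
          volume_image_le_of_lipschitzOn (hV.mono inter_subset_right)
      _ ≤ _ := by
          exact mul_le_mul_right (Measure.le_restrict_apply _ _) _
  calc ∫⁻ x in Icc 0 (V v), h (naturalParameterization c s u x)
      ≤ ∫⁻ x, h (naturalParameterization c s u x) ∂((K : ℝ≥0∞) • (volume.restrict s).map V) :=
        lintegral_mono' hle le_rfl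
    _ = K * ∫⁻ x, h (naturalParameterization c s u x) ∂((volume.restrict s).map V) := by
        rw [lintegral_smul_measure, smul_eq_mul]
    _ ≤ K * ∫⁻ t in s, h (naturalParameterization c s u (V t)) := by
        gcongr
        exact lintegral_map_le _ _
    _ = _ := by
        congr 1
        refine setLIntegral_congr_fun measurableSet_Icc fun t ht => ?_
        congr 1
        exact edist_eq_zero.1 (edist_naturalParameterization_eq_zero hl hus ht)

theorem lintegral_unitInterval_mul {g : ℝ → ℝ≥0∞} {Λ : ℝ≥0} :
    (Λ : ℝ≥0∞) * ∫⁻ t : I, g (Λ * t) = ∫⁻ τ in Icc 0 (Λ : ℝ), g τ := by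
  rcases eq_or_ne Λ 0 with rfl | hΛ
  · simp
  have hΛ0 : (0 : ℝ) < Λ := by positivity
  have h1 : ∫⁻ t : I, g (Λ * t) = ∫⁻ t in Icc (0 : ℝ) 1, g (Λ * t) :=
    lintegral_subtype_comap measurableSet_Icc (fun t : ℝ => g (Λ * t))
  rw [h1, ← lintegral_indicator measurableSet_Icc, ← lintegral_indicator measurableSet_Icc]
  conv_rhs => rw [← Real.smul_map_volume_mul_left hΛ0.ne']
  have hme : MeasurableEmbedding (fun t : ℝ => (Λ : ℝ) * t) :=
    (Homeomorph.mulLeft₀ (Λ : ℝ) hΛ0.ne').measurableEmbedding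
  rw [lintegral_smul_measure, hme.lintegral_map, abs_of_pos hΛ0, ENNReal.ofReal_coe_nnreal,
    smul_eq_mul]
  congr 1
  refine lintegral_congr fun t => ?_
  have : ((Λ : ℝ) * t ∈ Icc 0 (Λ : ℝ)) ↔ t ∈ Icc (0 : ℝ) 1 := by
    simp only [mem_Icc, mul_nonneg_iff_of_pos_left hΛ0]
    rw [mul_le_iff_le_one_right hΛ0]
  by_cases h : t ∈ Icc (0 : ℝ) 1
  · rw [indicator_of_mem h, indicator_of_mem (this.2 h)]
  · rw [indicator_of_notMem h, indicator_of_notMem (fun h' => h (this.1 h'))]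

/-- The restriction of a density on the quotient to the finite part of the domain. -/
def planarDensity {G : Set Sphere} (ρ : Hat G → ℝ≥0∞) : ℂ → ℝ≥0∞ :=
  (finitePart G).indicator fun z => ρ (proj G (z : Sphere))

theorem measurable_planarDensity {G : Set Sphere} (hG : IsOpen G) {ρ : Hat G → ℝ≥0∞}
    (hρ : Measurable[borel (Hat G)] ρ) : Measurable (planarDensity ρ) := by
  refine Measurable.indicator ?_ (isOpen_finitePart hG).measurableSet
  let _ : MeasurableSpace (Hat G) := borel (Hat G)
  have : BorelSpace (Hat G) := ⟨rfl⟩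
  exact hρ.comp (continuous_proj.comp OnePoint.continuous_coe).measurable

theorem toComplex_out {G : Set Sphere} {x : Hat G} {z : ℂ} (hz : (z : Sphere) ∈ G)
    (h : proj G z = x) : toComplex (Quotient.out (s := hatSetoid G) x) = z := by
  have : proj G (Quotient.out (s := hatSetoid G) x) = x := Quotient.out_eq x
  rw [← h] at this
  rw [← h, ← (proj_eq_iff_of_mem hz).1 this.symm, toComplex_coe]

/-- The pieces of the path are disjoint intervals of parameters, so their bounds from
`arcIntegral_le` add up to at most one integral over the whole parameter interval. -/
theorem pathIntegral_le {G : Set Sphere} {ρ : Hat G → ℝ≥0∞} {γ : C(I, Hat G)} {Λ : ℝ≥0}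
    {c : ℝ → ℂ} (hc : LipschitzWith 1 c) (hγ : ∀ t : I, γ t = proj G (c (Λ * t) : ℂ)) :
    pathIntegral ρ γ ≤ ∫⁻ τ in Icc 0 (Λ : ℝ), planarDensity ρ (c τ) := by
  have hfin : ∀ t ∈ finiteTimes γ, ((c (Λ * t) : ℂ) : Sphere) ∈ G := by
    rintro t ⟨w, ⟨hw, -⟩, hwt⟩
    rw [hγ] at hwt
    exact mem_of_proj_eq hwt hw
  have hpl : ∀ t ∈ finiteTimes γ, planarPath γ t = c (Λ * t) := fun t ht =>
    toComplex_out (hfin t ht) (hγ t).symm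
  have hlip : LipschitzOnWith Λ (planarPath γ) (finiteTimes γ) := by
    refine LipschitzOnWith.of_dist_le_mul fun t ht t' ht' => ?_
    rw [hpl t ht, hpl t' ht']
    refine (hc.dist_le_mul _ _).trans ?_
    rw [NNReal.coe_one, one_mul, Subtype.dist_eq, Real.dist_eq, Real.dist_eq, ← mul_sub, abs_mul,
      abs_of_nonneg Λ.coe_nonneg]
  set g : I → ℝ≥0∞ := fun t => planarDensity ρ (c (Λ * t))
  have hpiece : ∀ S : {S : Set I // ∃ t ∈ finiteTimes γ,
      S = connectedComponentIn (finiteTimes γ) t},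
      (⨆ (u : I) (v : I) (_ : u ≤ v) (_ : Icc u v ⊆ S.1),
      arcIntegral (fun z => ρ (proj G (z : Sphere))) (planarPath γ) u v) ≤
      Λ * ∫⁻ t in S.1, g t := by
    rintro ⟨S, t, ht, rfl⟩
    refine iSup₂_le fun u v => iSup₂_le fun huv hS => ?_
    have hS' := hS.trans (connectedComponentIn_subset _ _)
    refine (arcIntegral_le huv (hlip.mono hS')).trans ?_
    refine mul_le_mul_right ((setLIntegral_congr_fun measurableSet_Icc fun t ht => ?_).trans_le
      (lintegral_mono_set hS)) _
    simp only [g, planarDensity]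
    rw [indicator_of_mem (show c (Λ * t) ∈ finitePart G from hfin t (hS' ht)), hpl t (hS' ht)]
  refine (ENNReal.tsum_le_tsum hpiece).trans ?_
  rw [ENNReal.tsum_mul_left, ← lintegral_unitInterval_mul]
  gcongr
  -- Finite subsums suffice, so countability of the set of pieces plays no role.
  rw [ENNReal.tsum_eq_iSup_sum]
  refine iSup_le fun T => ?_
  have hmeas : ∀ S ∈ T, MeasurableSet S.1 := by
    rintro ⟨S, t, ht, rfl⟩ -
    exact isPreconnected_connectedComponentIn.ordConnected.measurableSet
  have hdis : (T : Set _).PairwiseDisjoint fun S : {S : Set I // ∃ t ∈ finiteTimes γ,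
      S = connectedComponentIn (finiteTimes γ) t} => S.1 := by
    rintro ⟨S, t, ht, rfl⟩ - ⟨S', t', ht', rfl⟩ - hne
    rw [Function.onFun, disjoint_left]
    intro x hx hx'
    exact hne (Subtype.ext ((connectedComponentIn_eq hx).trans (connectedComponentIn_eq hx').symm))
  rw [← lintegral_biUnion_finset hdis hmeas]
  exact setLIntegral_le_lintegral _ _

/-! ### Linking points of the plane by Lipschitz paths -/

/-- There is a Lipschitz path with image `R` from `x` to `y` along which the integral of `h` is at
most `C`. -/
def LipLink (h : ℂ → ℝ≥0∞) (x y : ℂ) (R : Set ℂ) (C : ℝ≥0∞) : Prop :=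
  ∃ (Λ : ℝ≥0) (c : ℝ → ℂ), LipschitzWith 1 c ∧ c 0 = x ∧ c Λ = y ∧ c '' Icc 0 (Λ : ℝ) = R ∧
    ∫⁻ τ in Icc 0 (Λ : ℝ), h (c τ) ≤ C

theorem LipLink.trans {h : ℂ → ℝ≥0∞} {x y z : ℂ} {R R' : Set ℂ} {C C' : ℝ≥0∞}
    (h1 : LipLink h x y R C) (h2 : LipLink h y z R' C') :
    LipLink h x z (R ∪ R') (C + C') := by
  obtain ⟨Λ, c, hc, hx, hy, hR, hC⟩ := h1
  obtain ⟨Λ', c', hc', hy', hz, hR', hC'⟩ := h2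
  set d : ℝ → ℂ := fun t => if t ≤ Λ then c t else c' (t - Λ)
  have hd1 : ∀ t : ℝ, t ≤ Λ → d t = c t := fun t ht => if_pos ht
  have hd2 : ∀ t : ℝ, (Λ : ℝ) ≤ t → d t = c' (t - Λ) := by
    intro t ht
    rcases ht.eq_or_lt with rfl | h
    · rw [hd1 _ le_rfl, hy, sub_self, hy']
    · exact if_neg h.not_ge
  have e1 : d '' Icc 0 (Λ : ℝ) = c '' Icc 0 (Λ : ℝ) := image_congr fun t ht => hd1 t ht.2
  have e2 : d '' Icc (Λ : ℝ) (Λ + Λ') = c' '' Icc 0 (Λ' : ℝ) := by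
    rw [image_congr fun t ht => hd2 t ht.1]
    ext w
    constructor
    · rintro ⟨t, ht, rfl⟩
      exact ⟨t - Λ, ⟨by linarith [ht.1], by linarith [ht.2]⟩, rfl⟩
    · rintro ⟨t, ht, rfl⟩
      refine ⟨t + Λ, ⟨by linarith [ht.1], by linarith [ht.2]⟩, ?_⟩
      simp
  have hU : Icc 0 ((Λ + Λ' : ℝ≥0) : ℝ) = Icc 0 (Λ : ℝ) ∪ Icc (Λ : ℝ) (Λ + Λ') := by
    rw [NNReal.coe_add]
    exact (Icc_union_Icc_eq_Icc Λ.coe_nonneg (by linarith [Λ'.coe_nonneg])).symm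
  have hlip : ∀ t t' : ℝ, t ≤ t' → dist (d t) (d t') ≤ t' - t := by
    intro t t' htt
    have a1 : ∀ s s' : ℝ, s ≤ s' → dist (c s) (c s') ≤ s' - s := fun s s' h => by
      refine (hc.dist_le_mul s s').trans ?_
      rw [NNReal.coe_one, one_mul, dist_comm, Real.dist_eq, abs_of_nonneg (sub_nonneg.2 h)]
    have a2 : ∀ s s' : ℝ, s ≤ s' → dist (c' s) (c' s') ≤ s' - s := fun s s' h => by
      refine (hc'.dist_le_mul s s').trans ?_
      rw [NNReal.coe_one, one_mul, dist_comm, Real.dist_eq, abs_of_nonneg (sub_nonneg.2 h)]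
    rcases le_total t' Λ with h | h
    · rw [hd1 t (htt.trans h), hd1 t' h]
      exact a1 t t' htt
    rcases le_total t Λ with h' | h'
    · have b1 := a1 t Λ h'
      have b2 := a2 0 (t' - Λ) (by linarith)
      rw [hd1 t h', hd2 t' h]
      rw [hy] at b1
      rw [hy'] at b2
      linarith [dist_triangle (c t) y (c' (t' - Λ))]
    · rw [hd2 t h', hd2 t' h]
      have := a2 (t - Λ) (t' - Λ) (by linarith)
      linarith
  refine ⟨Λ + Λ', d, ?_, ?_, ?_, ?_, ?_⟩
  · refine LipschitzWith.of_dist_le_mul fun t t' => ?_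
    rw [NNReal.coe_one, one_mul]
    rcases le_total t t' with htt | htt
    · rw [dist_comm t, Real.dist_eq, abs_of_nonneg (sub_nonneg.2 htt)]
      exact hlip t t' htt
    · rw [Real.dist_eq, abs_of_nonneg (sub_nonneg.2 htt), dist_comm]
      exact hlip t' t htt
  · rw [hd1 0 Λ.coe_nonneg, hx]
  · rw [hd2 _ (by rw [NNReal.coe_add]; linarith [Λ'.coe_nonneg]), NNReal.coe_add,
      add_sub_cancel_left, hz]
  · rw [hU, image_union, e1, e2, hR, hR']
  · rw [hU]
    refine (lintegral_union_le _ _ _).trans (add_le_add ?_ ?_)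
    · rw [setLIntegral_congr_fun measurableSet_Icc fun t ht => congrArg h (hd1 t ht.2)]
      exact hC
    · rw [setLIntegral_congr_fun measurableSet_Icc fun t ht => congrArg h (hd2 t ht.1)]
      refine le_trans (le_of_eq ?_) hC'
      have hmp := measurePreserving_sub_right (volume : Measure ℝ) (Λ : ℝ)
      have hme : MeasurableEmbedding (fun t : ℝ => t - (Λ : ℝ)) :=
        (Homeomorph.subRight (Λ : ℝ)).measurableEmbedding
      have e3 : (fun t : ℝ => t - Λ) ⁻¹' Icc 0 (Λ' : ℝ) = Icc (Λ : ℝ) (Λ + Λ') := by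
        ext t
        simp only [mem_Icc, mem_preimage, sub_nonneg]
        constructor <;> rintro ⟨h1, h2⟩ <;> exact ⟨h1, by linarith⟩
      rw [← e3]
      exact hmp.setLIntegral_comp_preimage_emb hme (fun τ => h (c' τ)) (Icc 0 (Λ' : ℝ))

theorem LipLink.symm {h : ℂ → ℝ≥0∞} {x y : ℂ} {R : Set ℂ} {C : ℝ≥0∞}
    (h1 : LipLink h x y R C) : LipLink h y x R C := by
  obtain ⟨Λ, c, hc, hx, hy, hR, hC⟩ := h1
  have e : (fun t : ℝ => (Λ : ℝ) - t) ⁻¹' Icc 0 (Λ : ℝ) = Icc 0 (Λ : ℝ) := by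
    ext t
    simp only [mem_Icc, mem_preimage]
    constructor <;> rintro ⟨h1, h2⟩ <;> constructor <;> linarith
  refine ⟨Λ, fun t => c (Λ - t), ?_, by simp [hy], by simp [hx], ?_, ?_⟩
  · refine LipschitzWith.of_dist_le_mul fun t t' => ?_
    refine (hc.dist_le_mul _ _).trans ?_
    rw [dist_sub_left]
  · rw [← hR]
    ext w
    constructor
    · rintro ⟨t, ht, rfl⟩
      exact ⟨Λ - t, by rw [← e] at ht; exact ht, rfl⟩
    · rintro ⟨t, ht, rfl⟩
      refine ⟨Λ - t, by rw [← e] at ht; exact ht, ?_⟩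
      simp
  · refine le_trans (le_of_eq ?_) hC
    have hmp := Measure.measurePreserving_sub_left (volume : Measure ℝ) (Λ : ℝ)
    have hme : MeasurableEmbedding (fun t : ℝ => (Λ : ℝ) - t) :=
      (Homeomorph.subLeft (Λ : ℝ)).measurableEmbedding
    have h3 := hmp.setLIntegral_comp_preimage_emb hme (fun τ => h (c τ)) (Icc 0 (Λ : ℝ))
    rwa [e] at h3

/-- The path with the given planar representation. -/
theorem LipLink.exists_path {G : Set Sphere} {ρ : Hat G → ℝ≥0∞} {x y : ℂ} {R : Set ℂ} {C : ℝ≥0∞}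
    (h : LipLink (planarDensity ρ) x y R C) :
    ∃ γ : C(I, Hat G), γ 0 = proj G x ∧ γ 1 = proj G y ∧ range γ = proj G '' inSphere R ∧
      pathIntegral ρ γ ≤ C := by
  obtain ⟨Λ, c, hc, hx, hy, hR, hC⟩ := h
  refine ⟨⟨fun t => proj G (c (Λ * t) : ℂ), ?_⟩, ?_, ?_, ?_, ?_⟩
  · refine continuous_proj.comp (OnePoint.continuous_coe.comp (hc.continuous.comp ?_))
    fun_prop
  · simp [hx]
  · simp [hy]
  · ext w
    constructor
    · rintro ⟨t, rfl⟩
      refine ⟨_, ⟨c (Λ * t), ?_, rfl⟩, rfl⟩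
      rw [← hR]
      exact ⟨_, ⟨mul_nonneg Λ.coe_nonneg t.2.1, mul_le_of_le_one_right Λ.coe_nonneg t.2.2⟩, rfl⟩
    · rintro ⟨_, ⟨z, hz, rfl⟩, rfl⟩
      rw [← hR] at hz
      obtain ⟨τ, hτ, rfl⟩ := hz
      refine ⟨⟨τ / Λ, div_nonneg hτ.1 Λ.coe_nonneg, div_le_one_of_le₀ hτ.2 Λ.coe_nonneg⟩, ?_⟩
      simp only [ContinuousMap.coe_mk]
      rcases eq_or_ne Λ 0 with rfl | h0
      · have : τ = 0 := le_antisymm hτ.2 hτ.1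
        simp [this]
      · have h0' : (Λ : ℝ) ≠ 0 := by exact_mod_cast h0
        rw [mul_div_cancel₀ _ h0']
  · exact (pathIntegral_le hc fun t => rfl).trans hC

/-! ### Axis-parallel segments -/

/-- The point with coordinates `s` and `y`, in this order or interchanged. -/
def axPt (v : Bool) (s y : ℝ) : ℂ := cond v ⟨s, y⟩ ⟨y, s⟩

/-- One of the two coordinates. -/
def axCo (v : Bool) (z : ℂ) : ℝ := cond v z.re z.im

theorem axCo_axPt (v : Bool) (s y : ℝ) : axCo v (axPt v s y) = s := by cases v <;> rfl

theorem axCo_not_axPt (v : Bool) (s y : ℝ) : axCo (!v) (axPt v s y) = y := by cases v <;> rfl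

theorem axPt_not (v : Bool) (s y : ℝ) : axPt (!v) s y = axPt v y s := by cases v <;> rfl

theorem axPt_axCo (v : Bool) (z : ℂ) : axPt v (axCo v z) (axCo (!v) z) = z := by cases v <;> rfl

theorem axCo_sub (v : Bool) (z w : ℂ) : axCo v (z - w) = axCo v z - axCo v w := by
  cases v <;> rfl

theorem continuous_axCo (v : Bool) : Continuous (axCo v) := by
  cases v
  · exact Complex.continuous_im
  · exact Complex.continuous_re

theorem abs_axCo_le (v : Bool) (z : ℂ) : |axCo v z| ≤ ‖z‖ := by
  cases v
  · exact Complex.abs_im_le_norm z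
  · exact Complex.abs_re_le_norm z

theorem normSq_axPt (v : Bool) (s y : ℝ) : ‖axPt v s y‖ ^ 2 = s ^ 2 + y ^ 2 := by
  rw [← Complex.normSq_eq_norm_sq]
  cases v <;> simp [axPt, Complex.normSq_apply] <;> ring

theorem dist_axPt (v : Bool) (s y y' : ℝ) : dist (axPt v s y) (axPt v s y') = |y - y'| := by
  have : axPt v s y - axPt v s y' = axPt v 0 (y - y') := by
    cases v <;> apply Complex.ext <;> simp [axPt]
  rw [dist_eq_norm, this, ← abs_of_nonneg (norm_nonneg _), ← sq_eq_sq_iff_abs_eq_abs, normSq_axPt]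
  ring

theorem LipLink.segment (h : ℂ → ℝ≥0∞) (v : Bool) (s y y' : ℝ) :
    LipLink h (axPt v s y) (axPt v s y') (axPt v s '' uIcc y y')
      (∫⁻ τ in uIcc y y', h (axPt v s τ)) := by
  wlog hyy : y ≤ y'
  · rw [uIcc_comm]
    exact (this h v s y' y (le_of_not_ge hyy)).symm
  rw [uIcc_of_le hyy]
  have e : (fun t : ℝ => y + t) '' Icc 0 (y' - y) = Icc y y' := by
    rw [image_const_add_Icc]
    simp
  have e' : (fun t : ℝ => y + t) ⁻¹' Icc y y' = Icc 0 (y' - y) := by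
    ext t
    simp only [mem_Icc, mem_preimage]
    constructor <;> rintro ⟨h1, h2⟩ <;> constructor <;> linarith
  have hΛ : ((y' - y).toNNReal : ℝ) = y' - y := Real.coe_toNNReal _ (sub_nonneg.2 hyy)
  refine ⟨(y' - y).toNNReal, fun t => axPt v s (y + t), ?_, by simp, by simp [hΛ], ?_, ?_⟩
  · refine LipschitzWith.of_dist_le_mul fun t t' => ?_
    rw [dist_axPt, Real.dist_eq]
    simp
  · rw [hΛ, ← e, image_image]
  · rw [hΛ]
    have hmp := measurePreserving_add_left (volume : Measure ℝ) y
    have hme : MeasurableEmbedding (fun t : ℝ => y + t) :=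
      (Homeomorph.addLeft y).measurableEmbedding
    have h3 := hmp.setLIntegral_comp_preimage_emb hme (fun τ => h (axPt v s τ)) (Icc y y')
    rw [e'] at h3
    exact h3.le

theorem LipLink.mono {h : ℂ → ℝ≥0∞} {x y : ℂ} {R : Set ℂ} {C C' : ℝ≥0∞}
    (h1 : LipLink h x y R C) (hC : C ≤ C') : LipLink h x y R C' := by
  obtain ⟨Λ, c, hc, hx, hy, hR, hC1⟩ := h1
  exact ⟨Λ, c, hc, hx, hy, hR, hC1.trans hC⟩

/-! ### Area estimates -/

/-- The weighted AM-GM inequality without the factor `1 / 2`. The parameter `ε` later balances area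
against mass. -/
theorem mul_le_weighted_sq (a b : ℝ≥0∞) {ε : ℝ≥0∞} (h0 : ε ≠ 0) (h1 : ε ≠ ⊤) :
    a * b ≤ ε * b ^ 2 + ε⁻¹ * a ^ 2 := by
  rcases le_total a (ε * b) with h | h
  · calc a * b ≤ ε * b * b := by gcongr
      _ = ε * b ^ 2 := by ring
      _ ≤ _ := le_self_add
  · have hb : b ≤ ε⁻¹ * a := by
      calc b = ε⁻¹ * (ε * b) := by rw [← mul_assoc, ENNReal.inv_mul_cancel h0 h1, one_mul]
        _ ≤ _ := by gcongr
    calc a * b ≤ a * (ε⁻¹ * a) := by gcongr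
      _ = ε⁻¹ * a ^ 2 := by ring
      _ ≤ _ := le_add_self

/-- A disk that is met by the level sets of a `1`-Lipschitz function over a long interval of levels
has large area. -/
theorem sq_volume_image_le {h : ℂ → ℝ} (hh : LipschitzWith 1 h) (c : ℂ) {r : ℝ} (hr : 0 < r)
    (α β : ℝ) :
    volume (h '' Metric.closedBall c r ∩ Ioo α β) ^ 2 ≤
      2 * volume (Metric.closedBall c r ∩ {z | h z < β}) := by
  set A := volume (Metric.closedBall c r ∩ {z | h z < β})
  have hhd : ∀ z w, |h z - h w| ≤ ‖z - w‖ := fun z w => by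
    have := hh.dist_le_mul z w
    rwa [NNReal.coe_one, one_mul, Real.dist_eq, dist_eq_norm] at this
  have key : ∀ t₁ ∈ h '' Metric.closedBall c r ∩ Ioo α β,
      ∀ t₂ ∈ h '' Metric.closedBall c r ∩ Ioo α β, t₁ ≤ t₂ → edist t₁ t₂ ^ 2 ≤ 2 * A := by
    rintro _ ⟨⟨x, hx, rfl⟩, -⟩ _ ⟨⟨y, hy, rfl⟩, -, hyβ⟩ hxy
    set m := h y - h x
    have hm : 0 ≤ m := sub_nonneg.2 hxy
    rw [Metric.mem_closedBall, dist_eq_norm] at hx hy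
    have hm2 : m ≤ 2 * r := by
      calc m ≤ |h y - h x| := le_abs_self _
        _ ≤ ‖y - x‖ := hhd y x
        _ = ‖(y - c) - (x - c)‖ := by congr 1; ring
        _ ≤ ‖y - c‖ + ‖x - c‖ := norm_sub_le _ _
        _ ≤ 2 * r := by linarith
    -- The disk of radius `l * r = m / 2` around `x + l * (c - x)` is internally tangent where the
    -- ray from `c` through `x` would put it if `x` were on the boundary. It stays in the given disk
    -- and within distance `m` of `x`, hence below the level `h y < β`. Twice its area is `π * m ^ 2
    -- / 2`, which exceeds `m ^ 2`.
    set l := m / (2 * r)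
    have hl0 : 0 ≤ l := by positivity
    have hl1 : l ≤ 1 := div_le_one_of_le₀ hm2 (by positivity)
    have hlr : l * r = m / 2 := by simp only [l]; field_simp
    have hsub : Metric.closedBall (x + l * (c - x)) (m / 2) ⊆
        Metric.closedBall c r ∩ {z | h z < β} := by
      intro z hz
      rw [Metric.mem_closedBall, dist_eq_norm] at hz
      constructor
      · rw [Metric.mem_closedBall, dist_eq_norm]
        calc ‖z - c‖ = ‖(z - (x + l * (c - x))) + ((1 - l : ℝ) : ℂ) * (x - c)‖ := by
              congr 1; push_cast; ring
          _ ≤ m / 2 + (1 - l) * r := by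
              refine (norm_add_le _ _).trans (add_le_add hz ?_)
              rw [norm_mul, Complex.norm_real, Real.norm_of_nonneg (by linarith)]
              exact mul_le_mul_of_nonneg_left hx (by linarith)
          _ = r := by linarith
      · have h1 : ‖z - x‖ ≤ m := by
          calc ‖z - x‖ = ‖(z - (x + l * (c - x))) + (l : ℂ) * (c - x)‖ := by congr 1; ring
            _ ≤ m / 2 + l * r := by
                refine (norm_add_le _ _).trans (add_le_add hz ?_)
                rw [norm_mul, Complex.norm_real, Real.norm_of_nonneg hl0, norm_sub_rev]
                exact mul_le_mul_of_nonneg_left hx hl0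
            _ = m := by linarith
        have h2 := (le_abs_self _).trans (hhd z x)
        change h z < β
        simp only [m] at h1
        linarith
    calc edist (h x) (h y) ^ 2 = ENNReal.ofReal (m ^ 2) := by
          rw [edist_comm, edist_dist, Real.dist_eq, abs_of_nonneg hm, ENNReal.ofReal_pow hm]
      _ ≤ ENNReal.ofReal (2 * ((m / 2) ^ 2 * Real.pi)) := by
          apply ENNReal.ofReal_le_ofReal
          nlinarith [Real.pi_gt_three, sq_nonneg m]
      _ = 2 * volume (Metric.closedBall (x + l * (c - x)) (m / 2)) := by
          rw [Complex.volume_closedBall, ENNReal.ofReal_mul (by norm_num),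
            ENNReal.ofReal_mul (by positivity), ENNReal.ofReal_pow (by positivity)]
          congr 1
          · simp
          · congr 1
            rw [← NNReal.coe_real_pi, ENNReal.ofReal_coe_nnreal]
      _ ≤ 2 * A := by
          gcongr
          exact measure_mono hsub
  -- The length of a subset of the line is at most its diameter, so a bound on pairs of levels is
  -- enough.
  have hd : volume (h '' Metric.closedBall c r ∩ Ioo α β) ≤ (2 * A) ^ ((2 : ℝ)⁻¹) := by
    refine (Real.volume_le_diam _).trans (Metric.ediam_le fun t₁ h₁ t₂ h₂ => ?_)
    rw [ENNReal.le_rpow_inv_iff (by norm_num), ENNReal.rpow_ofNat]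
    rcases le_total t₁ t₂ with h | h
    · exact key t₁ h₁ t₂ h₂ h
    · rw [edist_comm]
      exact key t₂ h₂ t₁ h₁ h
  calc _ ≤ ((2 * A) ^ ((2 : ℝ)⁻¹)) ^ 2 := by gcongr
    _ = 2 * A := by
      rw [← ENNReal.rpow_ofNat, ← ENNReal.rpow_mul]
      norm_num

theorem lintegral_axPt (v : Bool) {p : ℂ → ℝ≥0∞} (hp : Measurable p) :
    ∫⁻ s, ∫⁻ y, p (axPt v s y) = ∫⁻ z, p z := by
  have h1 : ∫⁻ z, p z = ∫⁻ q : ℝ × ℝ, p ⟨q.1, q.2⟩ :=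
    (Complex.volume_preserving_equiv_real_prod.symm.lintegral_comp_emb
      Complex.measurableEquivRealProd.symm.measurableEmbedding p).symm
  have hm : Measurable fun q : ℝ × ℝ => p ⟨q.1, q.2⟩ :=
    hp.comp Complex.measurableEquivRealProd.symm.measurable
  rw [h1]
  cases v
  · exact (lintegral_prod_symm' _ hm).symm
  · exact (lintegral_prod _ hm.aemeasurable).symm

theorem continuous_axPt (v : Bool) : Continuous fun q : ℝ × ℝ => axPt v q.1 q.2 := by
  cases v
  · exact Complex.equivRealProdCLM.symm.continuous.comp continuous_swap
  · exact Complex.equivRealProdCLM.symm.continuous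

theorem measurable_lintegral_axPt (v : Bool) {p : ℂ → ℝ≥0∞} (hp : Measurable p) :
    Measurable fun s => ∫⁻ y, p (axPt v s y) :=
  (hp.comp (continuous_axPt v).measurable).lintegral_prod_right'

theorem lipschitzWith_axCo (v : Bool) : LipschitzWith 1 (axCo v) := by
  refine LipschitzWith.of_dist_le_mul fun z w => ?_
  rw [NNReal.coe_one, one_mul, Real.dist_eq, dist_eq_norm, ← axCo_sub]
  exact abs_axCo_le _ _

/-! ### Finitely connected circle domains -/

/-- `G` is the complement of finitely many disjoint disks, one of which is the exterior of the unit
disk; the points `x 0, …, x n` of the quotient are the classes of these disks. -/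
structure IsCircleConfig (G : Set Sphere) (n : ℕ) (x : ℕ → Hat G) : Prop where
  isOpen : IsOpen G
  fiber_zero : ∀ w, proj G w = x 0 ↔ w ∈ (inSphere (Metric.ball 0 1))ᶜ
  fiber : ∀ l, 1 ≤ l → l ≤ n →
    ∃ (c : ℂ) (r : ℝ), 0 < r ∧ ∀ w, proj G w = x l ↔ w ∈ inSphere (Metric.closedBall c r)
  inj : ∀ l ≤ n, ∀ m ≤ n, x l = x m → l = m
  comp : compPoints G = x '' Iic n

/-- The mass of a density on the quotient. -/
def mass {G : Set Sphere} (ρ : Hat G → ℝ≥0∞) : ℝ≥0∞ :=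
  (∫⁻ z in finitePart G, ρ (proj G (z : Sphere)) ^ 2) + ∑' x : compPoints G, ρ x.1 ^ 2

open Classical in
/-- The sum of the values of `ρ` at the bounded disks that meet `R`. -/
def weight {G : Set Sphere} (n : ℕ) (x : ℕ → Hat G) (ρ : Hat G → ℝ≥0∞) (R : Set ℂ) : ℝ≥0∞ :=
  ∑ l ∈ Finset.Icc 1 n, if ∃ z ∈ R, proj G (z : ℂ) = x l then ρ (x l) else 0

/-- The total density along an axis-parallel line. -/
def lineCost {G : Set Sphere} (n : ℕ) (x : ℕ → Hat G) (ρ : Hat G → ℝ≥0∞) (v : Bool) (s : ℝ) :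
    ℝ≥0∞ :=
  (∫⁻ y, planarDensity ρ (axPt v s y)) + weight n x ρ {z | axCo v z = s}

section Config

variable {G : Set Sphere} {n : ℕ} {x : ℕ → Hat G} {ρ : Hat G → ℝ≥0∞}

theorem weight_union_le (R R' : Set ℂ) :
    weight n x ρ (R ∪ R') ≤ weight n x ρ R + weight n x ρ R' := by
  rw [weight, weight, weight, ← Finset.sum_add_distrib]
  refine Finset.sum_le_sum fun l _ => ?_
  split_ifs with h h1 h2 h3 <;> try simp
  obtain ⟨z, hz | hz, e⟩ := h
  · exact absurd ⟨z, hz, e⟩ h1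
  · exact absurd ⟨z, hz, e⟩ h3

theorem weight_le_of_forall {R R' : Set ℂ}
    (h : ∀ l, 1 ≤ l → l ≤ n → (∃ z ∈ R, proj G (z : ℂ) = x l) → ∃ z ∈ R', proj G (z : ℂ) = x l) :
    weight n x ρ R ≤ weight n x ρ R' := by
  refine Finset.sum_le_sum fun l hl => ?_
  rw [Finset.mem_Icc] at hl
  split_ifs with h1 h2
  · exact le_rfl
  · exact absurd (h l hl.1 hl.2 h1) h2
  · simp
  · simp

theorem weight_mono {R R' : Set ℂ} (h : R ⊆ R') : weight n x ρ R ≤ weight n x ρ R' :=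
  weight_le_of_forall fun _ _ _ ⟨z, hz, e⟩ => ⟨z, h hz, e⟩

theorem tsum_le_sum_of_subset {S : Set (Hat G)} {T : Finset ℕ} (hS : ∀ y ∈ S, ∃ l ∈ T, x l = y) :
    ∑' y : S, ρ y.1 ≤ ∑ l ∈ T, ρ (x l) := by
  choose! e he using hS
  rw [← Finset.tsum_subtype T (fun l => ρ (x l))]
  let φ : S → T := fun y => ⟨e y.1, (he y.1 y.2).1⟩
  have hφ : Function.Injective φ := by
    intro y y' h
    have h' : e y.1 = e y'.1 := congrArg Subtype.val h
    apply Subtype.ext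
    rw [← (he y.1 y.2).2, h', (he y'.1 y'.2).2]
  refine le_trans (le_of_eq ?_) (ENNReal.tsum_comp_le_tsum_of_injective hφ fun l : T => ρ (x l))
  refine tsum_congr fun y => ?_
  rw [← (he y.1 y.2).2]

namespace IsCircleConfig

variable (hG : IsCircleConfig G n x)

include hG

/-- The classes `x 0, …, x n` are distinct points of `compPoints G`, so the finite sum is part of
the infinite one. Only this direction matters for lower bounds of the modulus. -/
theorem le_mass : (∫⁻ z, planarDensity ρ z ^ 2) + ∑ l ∈ Finset.range (n + 1), ρ (x l) ^ 2 ≤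
    mass ρ := by
  refine add_le_add (le_of_eq ?_) ?_
  · rw [← lintegral_indicator (isOpen_finitePart hG.isOpen).measurableSet]
    refine lintegral_congr fun z => ?_
    by_cases h : z ∈ finitePart G
    · rw [planarDensity, indicator_of_mem h, indicator_of_mem h]
    · rw [planarDensity, indicator_of_notMem h, indicator_of_notMem h, zero_pow two_ne_zero]
  · rw [Finset.sum_range, ← tsum_fintype (L := .unconditional _)]
    let φ : Fin (n + 1) → compPoints G := fun l =>
      ⟨x l, hG.comp ▸ ⟨l, Nat.lt_succ_iff.1 l.2, rfl⟩⟩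
    have hφ : Function.Injective φ := fun l m h =>
      Fin.ext (hG.inj _ (Nat.lt_succ_iff.1 l.2) _ (Nat.lt_succ_iff.1 m.2)
        (congrArg Subtype.val h))
    exact ENNReal.tsum_comp_le_tsum_of_injective hφ fun y : compPoints G => ρ y.1 ^ 2

theorem sq_le_mass {l : ℕ} (hl : l ≤ n) : ρ (x l) ^ 2 ≤ mass ρ :=
  ((Finset.single_le_sum (f := fun l => ρ (x l) ^ 2) (fun _ _ => zero_le)
    (Finset.mem_range.2 (Nat.lt_succ_iff.2 hl))).trans le_add_self).trans hG.le_mass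

theorem mem_ball_of_mem {z : ℂ} (h : (z : Sphere) ∈ G) : z ∈ Metric.ball (0 : ℂ) 1 := by
  by_contra h'
  have := (hG.fiber_zero z).2 fun h1 => h' (coe_mem_inSphere.1 h1)
  have h2 : proj G (z : Sphere) ∈ compPoints G := by
    rw [hG.comp]
    exact ⟨0, Nat.zero_le _, this.symm⟩
  exact proj_mem_compPoints.1 h2 h

theorem mem_ball_of_proj_eq {l : ℕ} (h1 : 1 ≤ l) (h2 : l ≤ n) {w : Sphere}
    (h : proj G w = x l) : w ∈ inSphere (Metric.ball 0 1) := by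
  by_contra h'
  have := hG.inj 0 (Nat.zero_le _) l h2 (((hG.fiber_zero w).2 h').symm.trans h)
  omega

theorem exists_disk {l : ℕ} (hl : l ∈ Finset.Icc 1 n) :
    ∃ (c : ℂ) (r : ℝ), 0 < r ∧ {z : ℂ | proj G (z : ℂ) = x l} = Metric.closedBall c r := by
  rw [Finset.mem_Icc] at hl
  obtain ⟨c, r, hr, e⟩ := hG.fiber l hl.1 hl.2
  refine ⟨c, r, hr, ?_⟩
  ext z
  exact (e z).trans coe_mem_inSphere

theorem measurableSet_image_disk {h : ℂ → ℝ} (hh : Continuous h) {l : ℕ}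
    (hl : l ∈ Finset.Icc 1 n) : MeasurableSet (h '' {z : ℂ | proj G (z : ℂ) = x l}) := by
  obtain ⟨c, r, hr, e⟩ := hG.exists_disk hl
  rw [e]
  exact ((isCompact_closedBall c r).image hh).measurableSet

-- A disk counts at level `t` exactly when `t` lies in its shadow under `h`. Integration over `t`
-- thus turns weights into lengths of shadows.
omit hG in
theorem weight_level (h : ℂ → ℝ) (t : ℝ) : weight n x ρ {z | h z = t} =
    ∑ l ∈ Finset.Icc 1 n,
      (h '' {z : ℂ | proj G (z : ℂ) = x l}).indicator (fun _ => ρ (x l)) t := by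
  classical
  refine Finset.sum_congr rfl fun l _ => ?_
  rw [indicator_apply]
  refine if_congr ⟨?_, ?_⟩ rfl rfl
  · rintro ⟨z, hz, e⟩
    exact ⟨z, e, hz⟩
  · rintro ⟨z, e, hz⟩
    exact ⟨z, hz, e⟩

theorem measurable_weight_level {h : ℂ → ℝ} (hh : Continuous h) :
    Measurable fun t => weight n x ρ {z | h z = t} := by
  simp_rw [weight_level h]
  exact Finset.measurable_sum _ fun l hl =>
    measurable_const.indicator (hG.measurableSet_image_disk hh hl)

/-- The discrete cost of the level sets of a `1`-Lipschitz function. -/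
theorem weight_integral_le {h : ℂ → ℝ} (hh : LipschitzWith 1 h) (α β : ℝ) {S : Set ℂ}
    (hS : ∀ l, 1 ≤ l → l ≤ n → ∀ z : ℂ, proj G (z : ℂ) = x l → h z < β → z ∈ S) {ε : ℝ≥0∞}
    (h0 : ε ≠ 0) (h1 : ε ≠ ⊤) {T : Finset ℕ} (hT : T ⊆ Finset.Icc 1 n)
    (hT' : ∀ l, 1 ≤ l → l ≤ n → ∀ z : ℂ, proj G (z : ℂ) = x l → h z ∈ Ioo α β → l ∈ T) :
    ∫⁻ t in Ioo α β, weight n x ρ {z | h z = t} ≤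
      ε * (2 * volume S) + ε⁻¹ * ∑ l ∈ T, ρ (x l) ^ 2 := by
  classical
  let B : ℕ → Set ℂ := fun l => {z | proj G (z : ℂ) = x l}
  have hB : ∀ l ∈ Finset.Icc 1 n, ∃ (c : ℂ) (r : ℝ), 0 < r ∧ B l = Metric.closedBall c r :=
    fun l hl => hG.exists_disk hl
  have hBm : ∀ l ∈ Finset.Icc 1 n, MeasurableSet (h '' B l) := fun l hl =>
    hG.measurableSet_image_disk hh.continuous hl
  have e2 : ∫⁻ t in Ioo α β, weight n x ρ {z | h z = t} =
      ∑ l ∈ Finset.Icc 1 n, ρ (x l) * volume (h '' B l ∩ Ioo α β) := by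
    simp_rw [weight_level h]
    rw [lintegral_finsetSum' _ fun l hl => (measurable_const.indicator (hBm l hl)).aemeasurable]
    refine Finset.sum_congr rfl fun l hl => ?_
    rw [lintegral_indicator_const (hBm l hl), Measure.restrict_apply (hBm l hl)]
  -- Disks outside `T` have no shadow on the interval of levels.
  have e3 : ∑ l ∈ Finset.Icc 1 n, ρ (x l) * volume (h '' B l ∩ Ioo α β) =
      ∑ l ∈ T, ρ (x l) * volume (h '' B l ∩ Ioo α β) := by
    refine (Finset.sum_subset hT fun l hl hlT => ?_).symm
    rw [Finset.mem_Icc] at hl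
    have : h '' B l ∩ Ioo α β = ∅ := by
      rw [eq_empty_iff_forall_notMem]
      rintro _ ⟨⟨z, hz, rfl⟩, ht⟩
      exact hlT (hT' l hl.1 hl.2 z hz ht)
    rw [this, measure_empty, mul_zero]
  have hlt : MeasurableSet {z | h z < β} := measurableSet_lt hh.continuous.measurable
    measurable_const
  rw [e2, e3]
  calc ∑ l ∈ T, ρ (x l) * volume (h '' B l ∩ Ioo α β)
      ≤ ∑ l ∈ T, (ε * (2 * volume (B l ∩ {z | h z < β})) + ε⁻¹ * ρ (x l) ^ 2) := by
        refine Finset.sum_le_sum fun l hl => ?_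
        refine (mul_le_weighted_sq _ _ h0 h1).trans ?_
        gcongr
        obtain ⟨c, r, hr, e⟩ := hB l (hT hl)
        rw [e]
        exact sq_volume_image_le hh c hr α β
    _ = ε * (2 * ∑ l ∈ T, volume (B l ∩ {z | h z < β})) + ε⁻¹ * ∑ l ∈ T, ρ (x l) ^ 2 := by
        rw [Finset.sum_add_distrib, Finset.mul_sum, Finset.mul_sum, Finset.mul_sum]
    _ ≤ _ := by
        gcongr
        -- Distinct disks are disjoint, so the areas of their parts below level `β` add up to at
        -- most the area of `S`.
        rw [← measure_biUnion_finset]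
        · refine measure_mono ?_
          simp only [iUnion_subset_iff]
          rintro l hl z ⟨hz, hzβ⟩
          have := Finset.mem_Icc.1 (hT hl)
          exact hS l this.1 this.2 z hz hzβ
        · intro l hl m hm hlm
          rw [Function.onFun, disjoint_left]
          rintro z ⟨hz, -⟩ ⟨hz', -⟩
          exact hlm (hG.inj l (Finset.mem_Icc.1 (hT hl)).2 m (Finset.mem_Icc.1 (hT hm)).2
            (Eq.trans (Eq.symm hz) hz'))
        · intro l hl
          obtain ⟨c, r, hr, e⟩ := hB l (hT hl)
          rw [e]
          exact Metric.isClosed_closedBall.measurableSet.inter hlt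

/-- The continuous counterpart of `weight_integral_le`: AM-GM is applied pointwise to the density
and the constant `1`. -/
theorem lintegral_planarDensity_le (hρ : Measurable[borel (Hat G)] ρ) (S : Set ℂ)
    {ε : ℝ≥0∞} (h0 : ε ≠ 0) (h1 : ε ≠ ⊤) :
    ∫⁻ z in S, planarDensity ρ z ≤
      ε * volume S + ε⁻¹ * ∫⁻ z in S, planarDensity ρ z ^ 2 := by
  have hm := (measurable_planarDensity hG.isOpen hρ)
  calc ∫⁻ z in S, planarDensity ρ z ≤ ∫⁻ z in S, (ε + ε⁻¹ * planarDensity ρ z ^ 2) := by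
        refine lintegral_mono fun z => ?_
        simpa using mul_le_weighted_sq (planarDensity ρ z) 1 h0 h1
    _ = _ := by
        rw [lintegral_add_left measurable_const, lintegral_const, Measure.restrict_apply_univ,
          lintegral_const_mul _ (hm.pow_const 2)]

/-- Every long interval contains the coordinate of an axis-parallel line of small cost. -/
theorem exists_lineCost_lt (hρ : Measurable[borel (Hat G)] ρ) {ω : ℝ} (hω : 0 < ω)
    (hM : mass ρ < ENNReal.ofReal (ω ^ 2 / 1440)) (v : Bool) {α β : ℝ} (hαβ : ω ≤ β - α) :
    ∃ s ∈ Ioo α β, lineCost n x ρ v s < 6⁻¹ := by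
  by_contra! hcon
  have hm := (measurable_planarDensity hG.isOpen hρ)
  -- This choice makes `ε * 10 = ω / 12`, and the bound on the mass makes `ε⁻¹ * mass ρ < ω / 12`.
  -- The sum is below `ω / 6`, the least possible total if every line over an interval of length `ω`
  -- costs at least `1 / 6`.
  set ε : ℝ≥0∞ := ENNReal.ofReal (ω / 120)
  have h0 : ε ≠ 0 := (ENNReal.ofReal_pos.2 (by positivity)).ne'
  have h1 : ε ≠ ⊤ := ENNReal.ofReal_ne_top
  -- With `π ≤ 10 / 3`, the area enters once for the density and twice for the disks, which gives
  -- the factor `10`.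
  have hball : volume (Metric.ball (0 : ℂ) 1) ≤ 10 / 3 := by
    rw [Complex.volume_ball]
    simp only [ENNReal.ofReal_one, one_pow, one_mul]
    have : (NNReal.pi : ℝ≥0∞) = ENNReal.ofReal Real.pi := by
      rw [← NNReal.coe_real_pi, ENNReal.ofReal_coe_nnreal]
    rw [this, show (10 / 3 : ℝ≥0∞) = ENNReal.ofReal (10 / 3) by
      rw [ENNReal.ofReal_div_of_pos (by norm_num)]; norm_num]
    exact ENNReal.ofReal_le_ofReal (by linarith [Real.pi_lt_d2])
  have hX : ∫⁻ s in Ioo α β, lineCost n x ρ v s ≤ ε * 10 + ε⁻¹ * mass ρ := by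
    have a1 : ∫⁻ s in Ioo α β, ∫⁻ y, planarDensity ρ (axPt v s y) ≤
        ε * (10 / 3) + ε⁻¹ * ∫⁻ z, planarDensity ρ z ^ 2 := by
      calc ∫⁻ s in Ioo α β, ∫⁻ y, planarDensity ρ (axPt v s y)
          ≤ ∫⁻ s, ∫⁻ y, planarDensity ρ (axPt v s y) := setLIntegral_le_lintegral _ _
        _ = ∫⁻ z, planarDensity ρ z := lintegral_axPt v hm
        _ = ∫⁻ z in Metric.ball (0 : ℂ) 1, planarDensity ρ z := by
            rw [setLIntegral_eq_of_support_subset]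
            intro z hz
            by_contra hz'
            refine hz ?_
            exact indicator_of_notMem (fun h : z ∈ finitePart G => hz' (hG.mem_ball_of_mem h)) _
        _ ≤ ε * volume (Metric.ball (0 : ℂ) 1) +
            ε⁻¹ * ∫⁻ z in Metric.ball (0 : ℂ) 1, planarDensity ρ z ^ 2 :=
          hG.lintegral_planarDensity_le hρ _ h0 h1
        _ ≤ _ := by
          gcongr
          exact Measure.restrict_le_self
    have a2 := hG.weight_integral_le (ρ := ρ) (lipschitzWith_axCo v) α β
      (S := Metric.ball 0 1) (fun l hl1 hl2 z hz _ =>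
        coe_mem_inSphere.1 (hG.mem_ball_of_proj_eq hl1 hl2 hz)) h0 h1 subset_rfl
        (fun l hl1 hl2 _ _ _ => Finset.mem_Icc.2 ⟨hl1, hl2⟩)
    have a3 : ∑ l ∈ Finset.Icc 1 n, ρ (x l) ^ 2 ≤ ∑ l ∈ Finset.range (n + 1), ρ (x l) ^ 2 :=
      Finset.sum_le_sum_of_subset fun l hl => by
        rw [Finset.mem_Icc] at hl
        rw [Finset.mem_range]
        omega
    calc ∫⁻ s in Ioo α β, lineCost n x ρ v s
        = (∫⁻ s in Ioo α β, ∫⁻ y, planarDensity ρ (axPt v s y)) +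
          ∫⁻ s in Ioo α β, weight n x ρ {z | axCo v z = s} := by
          simp only [lineCost]
          rw [lintegral_add_left (measurable_lintegral_axPt v hm)]
      _ ≤ (ε * (10 / 3) + ε⁻¹ * ∫⁻ z, planarDensity ρ z ^ 2) +
          (ε * (2 * (10 / 3)) + ε⁻¹ * ∑ l ∈ Finset.range (n + 1), ρ (x l) ^ 2) := by
          refine add_le_add a1 (a2.trans ?_)
          gcongr
      _ = ε * (10 / 3 + 2 * (10 / 3)) + ε⁻¹ * ((∫⁻ z, planarDensity ρ z ^ 2) +
          ∑ l ∈ Finset.range (n + 1), ρ (x l) ^ 2) := by ring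
      _ ≤ _ := by
          gcongr
          · rw [show (10 / 3 + 2 * (10 / 3) : ℝ≥0∞) = 3 * (10 / 3) by ring,
              ENNReal.mul_div_cancel (by norm_num) (by norm_num)]
          · exact hG.le_mass
  have hlow : ENNReal.ofReal (ω / 6) ≤ ∫⁻ s in Ioo α β, lineCost n x ρ v s := by
    calc ENNReal.ofReal (ω / 6) ≤ 6⁻¹ * volume (Ioo α β) := by
          rw [Real.volume_Ioo, div_eq_inv_mul, ENNReal.ofReal_mul (by norm_num),
            ENNReal.ofReal_inv_of_pos (by norm_num)]
          norm_num
          gcongr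
      _ = ∫⁻ s in Ioo α β, 6⁻¹ := by rw [setLIntegral_const]
      _ ≤ _ := setLIntegral_mono' measurableSet_Ioo fun s hs => hcon s hs
  have hlt : ε * 10 + ε⁻¹ * mass ρ < ENNReal.ofReal (ω / 6) := by
    have b1 : ε * 10 = ENNReal.ofReal (ω / 12) := by
      rw [show (10 : ℝ≥0∞) = ENNReal.ofReal 10 by norm_num, ← ENNReal.ofReal_mul (by positivity)]
      congr 1
      ring
    have b2 : ε⁻¹ * mass ρ < ENNReal.ofReal (ω / 12) := by
      calc ε⁻¹ * mass ρ < ε⁻¹ * ENNReal.ofReal (ω ^ 2 / 1440) :=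
            ENNReal.mul_lt_mul_right (ENNReal.inv_ne_zero.2 h1) (ENNReal.inv_ne_top.2 h0) hM
        _ = ENNReal.ofReal (ω / 12) := by
            rw [← ENNReal.ofReal_inv_of_pos (by positivity), ← ENNReal.ofReal_mul (by positivity)]
            congr 1
            field_simp
            ring
    rw [b1, show ω / 6 = ω / 12 + ω / 12 by ring,
      ENNReal.ofReal_add (by positivity) (by positivity)]
    exact ENNReal.add_lt_add_left ENNReal.ofReal_ne_top b2
  exact absurd (hlow.trans hX) (not_le.2 hlt)

/-- A path in the quotient over a planar path. -/
theorem exists_path_cost_le {a b : ℂ} {R : Set ℂ} {C : ℝ≥0∞}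
    (h : LipLink (planarDensity ρ) a b R C) :
    ∃ γ : C(I, Hat G), γ 0 = proj G a ∧ γ 1 = proj G b ∧ range γ = proj G '' inSphere R ∧
      pathIntegral ρ γ + ∑' y : {y : Hat G // y ∈ compPoints G ∩ range γ}, ρ y.1 ≤
        C + (ρ (x 0) + weight n x ρ R) ∧
      (R ⊆ Metric.ball 0 1 →
        pathIntegral ρ γ + ∑' y : {y : Hat G // y ∈ compPoints G ∩ range γ}, ρ y.1 ≤
        C + weight n x ρ R) := by
  classical
  obtain ⟨γ, hγ0, hγ1, hγR, hγ⟩ := h.exists_path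
  have hw : weight n x ρ R =
      ∑ l ∈ (Finset.Icc 1 n).filter (fun l => ∃ z ∈ R, proj G (z : ℂ) = x l), ρ (x l) := by
    rw [Finset.sum_filter]
    rfl
  set T := (Finset.Icc 1 n).filter (fun l => ∃ z ∈ R, proj G (z : ℂ) = x l)
  have hmem : ∀ y ∈ compPoints G ∩ range γ, (∃ z ∈ R, proj G (z : ℂ) = x 0 ∧ x 0 = y) ∨
      ∃ l ∈ T, x l = y := by
    rintro y ⟨hy, hyγ⟩
    rw [hG.comp] at hy
    rw [hγR] at hyγ
    obtain ⟨l, hl, rfl⟩ := hy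
    obtain ⟨_, ⟨z, hz, rfl⟩, hzl⟩ := hyγ
    rcases Nat.eq_zero_or_pos l with rfl | h0
    · exact Or.inl ⟨z, hz, hzl, rfl⟩
    · exact Or.inr ⟨l, Finset.mem_filter.2 ⟨Finset.mem_Icc.2 ⟨h0, hl⟩, z, hz, hzl⟩, rfl⟩
  refine ⟨γ, hγ0, hγ1, hγR, add_le_add hγ ?_, fun hR => add_le_add hγ ?_⟩
  -- `weight` starts at index `1`, so the exterior class `x 0` is paid for separately. It can be
  -- omitted when the path stays in the unit disk.
  · have h0 : (0 : ℕ) ∉ T := by simp [T]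
    rw [hw, ← Finset.sum_insert h0 (f := fun l => ρ (x l))]
    refine tsum_le_sum_of_subset fun y hy => ?_
    rcases hmem y hy with ⟨_, _, _, h⟩ | ⟨l, hl, h⟩
    · exact ⟨0, Finset.mem_insert_self _ _, h⟩
    · exact ⟨l, Finset.mem_insert_of_mem hl, h⟩
  · rw [hw]
    refine tsum_le_sum_of_subset fun y hy => ?_
    rcases hmem y hy with ⟨z, hz, h, _⟩ | h
    · exact absurd (coe_mem_inSphere.2 (hR hz)) ((hG.fiber_zero z).1 h)
    · exact h

end IsCircleConfig

end Config

/-! ### Linking connected sets in circle domains -/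

section Linking

variable {G : Set Sphere} {n : ℕ} {x : ℕ → Hat G} {ρ : Hat G → ℝ≥0∞}

theorem norm_axPt_lt_one {v : Bool} {s y : ℝ} (h : s ^ 2 + y ^ 2 < 1) :
    axPt v s y ∈ Metric.ball (0 : ℂ) 1 := by
  rw [mem_ball_zero_iff]
  have := normSq_axPt v s y
  nlinarith [norm_nonneg (axPt v s y)]

theorem sq_add_sq_lt_one {v : Bool} {e : ℂ} (h : e ∈ Metric.ball (0 : ℂ) 1) :
    axCo v e ^ 2 + axCo (!v) e ^ 2 < 1 := by
  rw [mem_ball_zero_iff] at h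
  rw [← normSq_axPt v, axPt_axCo]
  nlinarith [norm_nonneg e]

theorem axPt_notMem_ball {v : Bool} {s y : ℝ} (h : 1 ≤ |s| ∨ 1 ≤ |y|) :
    axPt v s y ∉ Metric.ball (0 : ℂ) 1 := by
  intro h'
  have := sq_add_sq_lt_one (v := v) h'
  rw [axCo_axPt, axCo_not_axPt] at this
  rcases h with h | h
  · have := (one_le_sq_iff_one_le_abs s).2 h
    nlinarith [sq_nonneg y]
  · have := (one_le_sq_iff_one_le_abs y).2 h
    nlinarith [sq_nonneg s]

theorem segment_subset_of_convex {B : Set ℂ} (hB : Convex ℝ B) {v : Bool} {s y y' : ℝ}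
    (h : axPt v s y ∈ B) (h' : axPt v s y' ∈ B) : axPt v s '' uIcc y y' ⊆ B := by
  rintro _ ⟨t, ht, rfl⟩
  rw [← segment_eq_uIcc] at ht
  obtain ⟨p, q, hp, hq, hpq, rfl⟩ := ht
  convert hB h h' hp hq hpq using 1
  have : s = p * s + q * s := by rw [← add_mul, hpq, one_mul]
  cases v <;> apply Complex.ext <;> simp [axPt] <;> exact this

namespace IsCircleConfig

variable (hG : IsCircleConfig G n x)

include hG

theorem planarDensity_eq_zero {z : ℂ} (hz : z ∉ Metric.ball (0 : ℂ) 1) :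
    planarDensity ρ z = 0 :=
  indicator_of_notMem (fun h : z ∈ finitePart G => hz (hG.mem_ball_of_mem h)) _

/-- From a point outside a convex set `Q`, an axis-parallel ray that avoids `Q` leads out of the
unit disk. -/
theorem link_outside {Q : Set ℂ} (hQ : Convex ℝ Q) (hQb : Q ⊆ Metric.ball 0 1) {e : ℂ}
    (he : e ∉ Q) (v : Bool) (he1 : |axCo v e| ≤ 4) (he2 : |axCo (!v) e| ≤ 4) :
    ∃ R C, LipLink (planarDensity ρ) e ⟨4, 4⟩ R C ∧ Disjoint R Q ∧
      C + weight n x ρ R ≤ lineCost n x ρ v (axCo v e) := by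
  set s := axCo v e
  set t := axCo (!v) e
  have hest : axPt v s t = e := axPt_axCo v e
  -- If both directions from `e` along the line met the convex set `Q`, then `e` would lie between
  -- two points of `Q`.
  obtain ⟨κ, hκ, hκQ⟩ : ∃ κ : ℝ, |κ| = 4 ∧ Disjoint (axPt v s '' uIcc t κ) Q := by
    by_contra! hcon
    have h1 := hcon 4 (by norm_num)
    have h2 := hcon (-4) (by norm_num)
    rw [not_disjoint_iff] at h1 h2
    obtain ⟨_, ⟨y1, hy1, rfl⟩, hQ1⟩ := h1
    obtain ⟨_, ⟨y2, hy2, rfl⟩, hQ2⟩ := h2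
    rw [abs_le] at he2
    rw [uIcc_of_le he2.2] at hy1
    rw [uIcc_of_ge he2.1] at hy2
    refine he (segment_subset_of_convex hQ hQ2 hQ1 ⟨t, ?_, hest⟩)
    rw [uIcc_of_le (hy2.2.trans hy1.1)]
    exact ⟨hy2.2, hy1.1⟩
  have hκ1 : 1 ≤ |κ| := by rw [hκ]; norm_num
  -- After the first segment the path stays outside the unit disk, where the density vanishes and no
  -- bounded disk is met. The common endpoint `⟨4, 4⟩` allows two such paths to be concatenated.
  have l1 := LipLink.segment (planarDensity ρ) v s t κ
  have l2 := LipLink.segment (planarDensity ρ) (!v) κ s 4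
  have l3 := LipLink.segment (planarDensity ρ) v 4 κ 4
  rw [hest] at l1
  rw [axPt_not, axPt_not] at l2
  have h44 : axPt v 4 4 = ⟨4, 4⟩ := by cases v <;> rfl
  rw [h44] at l3
  have o2 : ∀ z ∈ axPt (!v) κ '' uIcc s 4, z ∉ Metric.ball (0 : ℂ) 1 := by
    rintro _ ⟨y, -, rfl⟩
    exact axPt_notMem_ball (Or.inl hκ1)
  have o3 : ∀ z ∈ axPt v 4 '' uIcc κ 4, z ∉ Metric.ball (0 : ℂ) 1 := by
    rintro _ ⟨y, -, rfl⟩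
    exact axPt_notMem_ball (Or.inl (by norm_num))
  have c2 : ∫⁻ τ in uIcc s 4, planarDensity ρ (axPt (!v) κ τ) = 0 := by
    rw [setLIntegral_congr_fun measurableSet_uIcc fun τ hτ =>
      hG.planarDensity_eq_zero (o2 _ ⟨τ, hτ, rfl⟩)]
    simp
  have c3 : ∫⁻ τ in uIcc κ 4, planarDensity ρ (axPt v 4 τ) = 0 := by
    rw [setLIntegral_congr_fun measurableSet_uIcc fun τ hτ =>
      hG.planarDensity_eq_zero (o3 _ ⟨τ, hτ, rfl⟩)]
    simp
  refine ⟨_, _, l1.trans (l2.trans l3), ?_, ?_⟩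
  · rw [disjoint_union_left, disjoint_union_left]
    exact ⟨hκQ, disjoint_left.2 fun z hz hzQ => o2 z hz (hQb hzQ),
      disjoint_left.2 fun z hz hzQ => o3 z hz (hQb hzQ)⟩
  · rw [c2, c3, add_zero, add_zero, lineCost]
    refine add_le_add (setLIntegral_le_lintegral _ _) (weight_le_of_forall ?_)
    rintro l hl1 hl2 ⟨z, hz, hzl⟩
    have hzb := coe_mem_inSphere.1 (hG.mem_ball_of_proj_eq hl1 hl2 hzl)
    rcases hz with ⟨y, -, rfl⟩ | hz | hz
    · exact ⟨_, axCo_axPt _ _ _, hzl⟩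
    · exact absurd hzb (o2 z hz)
    · exact absurd hzb (o3 z hz)

omit hG in
/-- Two axis-parallel segments in the unit disk lead to a point near the center. -/
theorem link_center {e o : ℂ} (he : e ∈ Metric.ball (0 : ℂ) 1) (ho : o ∈ Metric.ball (0 : ℂ) 1)
    (v : Bool) (h : axCo v e ^ 2 + axCo (!v) o ^ 2 < 1) :
    ∃ R C, LipLink (planarDensity ρ) e o R C ∧ R ⊆ Metric.ball 0 1 ∧
      C + weight n x ρ R ≤ lineCost n x ρ v (axCo v e) + lineCost n x ρ (!v) (axCo (!v) o) := by
  set s := axCo v e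
  set c := axCo (!v) o
  have l1 := LipLink.segment (planarDensity ρ) v s (axCo (!v) e) c
  have l2 := LipLink.segment (planarDensity ρ) (!v) c s (axCo v o)
  have heq : axPt v s (axCo (!v) e) = e := axPt_axCo v e
  have hoq : axPt v (axCo v o) c = o := axPt_axCo v o
  -- The corner of the two segments; once it is in the unit disk, convexity keeps both segments
  -- there.
  have hm : axPt v s c ∈ Metric.ball (0 : ℂ) 1 := norm_axPt_lt_one h
  have r1 : axPt v s '' uIcc (axCo (!v) e) c ⊆ Metric.ball 0 1 :=
    segment_subset_of_convex (convex_ball _ _) (by rwa [heq]) hm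
  have r2 : axPt (!v) c '' uIcc s (axCo v o) ⊆ Metric.ball 0 1 :=
    segment_subset_of_convex (convex_ball _ _) (by rwa [axPt_not]) (by rwa [axPt_not, hoq])
  rw [heq] at l1
  rw [axPt_not, axPt_not, hoq] at l2
  refine ⟨_, _, l1.trans l2, union_subset r1 r2, ?_⟩
  calc _ ≤ ((∫⁻ τ, planarDensity ρ (axPt v s τ)) + ∫⁻ τ, planarDensity ρ (axPt (!v) c τ)) +
        (weight n x ρ {z | axCo v z = s} + weight n x ρ {z | axCo (!v) z = c}) := by
        refine add_le_add (add_le_add (setLIntegral_le_lintegral _ _)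
          (setLIntegral_le_lintegral _ _)) ((weight_union_le _ _).trans
          (add_le_add (weight_mono ?_) (weight_mono ?_)))
        · rintro _ ⟨y, -, rfl⟩
          exact axCo_axPt _ _ _
        · rintro _ ⟨y, -, rfl⟩
          exact axCo_axPt _ _ _
    _ = _ := by rw [lineCost, lineCost]; ring

/-- A connected set in the quotient meets the lines between two of its points. -/
theorem exists_mem_line {K : Set (Hat G)} (hK : IsPreconnected K) {u w : ℂ}
    (hu : proj G (u : ℂ) ∈ K) (hw : w ∈ closure {z : ℂ | proj G (z : ℂ) ∈ K}) (v : Bool) {s : ℝ}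
    (hs : s ∈ Ioo (min (axCo v u) (axCo v w)) (max (axCo v u) (axCo v w))) :
    ∃ e : ℂ, proj G (e : ℂ) ∈ K ∧ axCo v e = s ∧ (e ∈ Metric.ball (0 : ℂ) 1 ∨ e = axPt v s 4) := by
  by_contra! hcon
  have oA : IsOpen {z | axCo v z < s} := isOpen_lt (continuous_axCo v) continuous_const
  have oB : IsOpen {z | s < axCo v z} := isOpen_lt continuous_const (continuous_axCo v)
  -- The set left over by the two half-planes is the line together with `∞`.
  have hZ : ∀ z ∈ (inSphere {z | axCo v z < s} ∪ inSphere {z | s < axCo v z})ᶜ, proj G z ∉ K := by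
    intro z hz hzK
    by_cases hb : z ∈ inSphere (Metric.ball 0 1)
    · obtain ⟨e, he, rfl⟩ := hb
      refine (hcon e hzK ?_).1 he
      rcases lt_trichotomy (axCo v e) s with h | h | h
      · exact absurd (Or.inl ⟨e, h, rfl⟩) hz
      · exact h
      · exact absurd (Or.inr ⟨e, h, rfl⟩) hz
    -- All points off the open unit disk, `∞` included, have class `x 0`. If `K` contains this
    -- class, the point of the line with second coordinate `4` represents it.
    · have h1 := (hG.fiber_zero z).2 hb
      have h2 := (hG.fiber_zero (axPt v s 4 : ℂ)).2 fun h =>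
        axPt_notMem_ball (Or.inr (by norm_num)) (coe_mem_inSphere.1 h)
      exact (hcon (axPt v s 4) (by rwa [h2, ← h1]) (axCo_axPt _ _ _)).2 rfl
  have hdis : Disjoint (inSphere {z | axCo v z < s}) (inSphere {z | s < axCo v z}) := by
    rw [disjoint_left]
    rintro _ ⟨z, hz, rfl⟩ h
    exact lt_asymm (show axCo v z < s from hz) (coe_mem_inSphere.1 h)
  rw [mem_closure_iff] at hw
  have hcl := ((isOpen_inSphere oA).union (isOpen_inSphere oB)).isClosed_compl
  rcases le_total (axCo v u) (axCo v w) with h | h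
  · rw [min_eq_left h, max_eq_right h] at hs
    obtain ⟨w', hw', hwK⟩ := hw _ oB hs.2
    exact separation hG.isOpen (isOpen_inSphere oA) (isOpen_inSphere oB) hdis subset_rfl hcl hK hZ
      ⟨u, hs.1, rfl⟩ ⟨w', hw', rfl⟩ hu hwK
  · rw [min_eq_right h, max_eq_left h] at hs
    obtain ⟨w', hw', hwK⟩ := hw _ oA hs.1
    exact separation hG.isOpen (isOpen_inSphere oA) (isOpen_inSphere oB) hdis subset_rfl hcl hK hZ
      ⟨w', hw', rfl⟩ ⟨u, hs.2, rfl⟩ hwK hu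

/-- One of the two coordinates differs by at least `d / 2` between `u` and `w`. The point `w` is
only required to lie in a closure, because the segment of the joining family reaches the forbidden
component only in the limit. -/
theorem exists_crossing {K : Set (Hat G)} (hK : IsPreconnected K) {u w : ℂ}
    (hu : proj G (u : ℂ) ∈ K) (hw : w ∈ closure {z : ℂ | proj G (z : ℂ) ∈ K})
    (hu1 : ‖u‖ ≤ 1) (hw1 : ‖w‖ ≤ 1) {d : ℝ} (hd : d ≤ ‖u - w‖) :
    ∃ v α β, d / 2 ≤ β - α ∧ -1 ≤ α ∧ β ≤ 1 ∧ ∀ s ∈ Ioo α β, ∃ e : ℂ, proj G (e : ℂ) ∈ K ∧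
      axCo v e = s ∧ (e ∈ Metric.ball (0 : ℂ) 1 ∨ e = axPt v s 4) := by
  obtain ⟨v, hv⟩ : ∃ v, d / 2 ≤ |axCo v u - axCo v w| := by
    by_contra! hcon
    have h1 := hcon true
    have h2 := hcon false
    have h3 := Complex.norm_le_abs_re_add_abs_im (u - w)
    rw [Complex.sub_re, Complex.sub_im] at h3
    simp only [axCo, cond_true, cond_false] at h1 h2
    linarith
  refine ⟨v, _, _, ?_, ?_, ?_, fun s hs => hG.exists_mem_line hK hu hw v hs⟩
  · rwa [max_sub_min_eq_abs']
  · exact le_min (abs_le.1 ((abs_axCo_le v u).trans hu1)).1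
      (abs_le.1 ((abs_axCo_le v w).trans hw1)).1
  · exact max_le (abs_le.1 ((abs_axCo_le v u).trans hu1)).2
      (abs_le.1 ((abs_axCo_le v w).trans hw1)).2

/-- A lower bound for the mass of a density that is admissible for the paths that join two connected
sets and avoid a point of the quotient. -/
theorem mass_ge_of_joining {y : Hat G}
    (hy : y = x 0 ∨ (y ≠ x 0 ∧ Convex ℝ {z : ℂ | proj G (z : ℂ) = y}))
    {K₁ K₂ : Set (Hat G)} (hK₁ : IsPreconnected K₁) (hK₂ : IsPreconnected K₂) (hy₁ : y ∉ K₁)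
    (hy₂ : y ∉ K₂) {u₁ w₁ u₂ w₂ : ℂ} (hu₁ : proj G (u₁ : ℂ) ∈ K₁)
    (hw₁ : w₁ ∈ closure {z : ℂ | proj G (z : ℂ) ∈ K₁})
    (hu₂ : proj G (u₂ : ℂ) ∈ K₂) (hw₂ : w₂ ∈ closure {z : ℂ | proj G (z : ℂ) ∈ K₂})
    (nu₁ : ‖u₁‖ ≤ 1) (nw₁ : ‖w₁‖ ≤ 1) (nu₂ : ‖u₂‖ ≤ 1) (nw₂ : ‖w₂‖ ≤ 1)
    {d : ℝ} (hd : 0 < d) (hd₁ : d ≤ ‖u₁ - w₁‖) (hd₂ : d ≤ ‖u₂ - w₂‖)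
    (hρ : Measurable[borel (Hat G)] ρ)
    (hadm : ∀ γ : C(I, Hat G), (∀ t, γ t ≠ y) → γ 0 ∈ K₁ → γ 1 ∈ K₂ →
      1 ≤ pathIntegral ρ γ + ∑' x : {x : Hat G // x ∈ compPoints G ∩ range γ}, ρ x.1) :
    ENNReal.ofReal ((d / 4) ^ 2 / 1440) ≤ mass ρ := by
  by_contra! hM
  have hd2 : d ≤ 2 := by
    have := norm_sub_le u₁ w₁
    linarith
  -- The crossing intervals have length at least `2 * ω`. Removing `ω / 2` at each end leaves length
  -- at least `ω`, as `exists_lineCost_lt` requires, and gives `|s| ≤ 1 - ω / 2`.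
  set ω := d / 4
  have hω : 0 < ω := by positivity
  obtain ⟨v₁, α₁, β₁, hαβ₁, hα₁, hβ₁, hc₁⟩ := hG.exists_crossing hK₁ hu₁ hw₁ nu₁ nw₁ hd₁
  obtain ⟨v₂, α₂, β₂, hαβ₂, hα₂, hβ₂, hc₂⟩ := hG.exists_crossing hK₂ hu₂ hw₂ nu₂ nw₂ hd₂
  obtain ⟨s₁, hs₁, hl₁⟩ := hG.exists_lineCost_lt hρ hω hM v₁ (α := α₁ + ω / 2) (β := β₁ - ω / 2)
    (by simp only [ω] at *; linarith)
  obtain ⟨s₂, hs₂, hl₂⟩ := hG.exists_lineCost_lt hρ hω hM v₂ (α := α₂ + ω / 2) (β := β₂ - ω / 2)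
    (by simp only [ω] at *; linarith)
  obtain ⟨e₁, he₁, hes₁, hb₁⟩ := hc₁ s₁ ⟨by linarith [hs₁.1], by linarith [hs₁.2]⟩
  obtain ⟨e₂, he₂, hes₂, hb₂⟩ := hc₂ s₂ ⟨by linarith [hs₂.1], by linarith [hs₂.2]⟩
  have as₁ : |s₁| ≤ 1 - ω / 2 := abs_le.2 ⟨by linarith [hs₁.1], by linarith [hs₁.2]⟩
  have as₂ : |s₂| ≤ 1 - ω / 2 := abs_le.2 ⟨by linarith [hs₂.1], by linarith [hs₂.2]⟩
  rcases hy with hy | ⟨hy, hyc⟩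
  · have hball : ∀ {K : Set (Hat G)} {e : ℂ}, y ∉ K → proj G (e : ℂ) ∈ K →
        e ∈ Metric.ball (0 : ℂ) 1 := by
      intro K e hK he
      by_contra h
      refine hK ?_
      rw [hy, ← (hG.fiber_zero e).2 fun h' => h (coe_mem_inSphere.1 h')]
      exact he
    -- The forbidden class is the exterior, so the link must stay in the unit disk. Cheap lines with
    -- coordinates in `(-ω / 2, ω / 2)` meet the chosen lines inside it, since `(1 - ω / 2) ^ 2 + (ω
    -- / 2) ^ 2 < 1`.
    obtain ⟨a, ha, hla⟩ := hG.exists_lineCost_lt hρ hω hM true (α := -(ω / 2)) (β := ω / 2)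
      (by linarith)
    obtain ⟨b, hb, hlb⟩ := hG.exists_lineCost_lt hρ hω hM false (α := -(ω / 2)) (β := ω / 2)
      (by linarith)
    have haa : |a| ≤ ω / 2 := abs_le.2 ⟨ha.1.le, ha.2.le⟩
    have hbb : |b| ≤ ω / 2 := abs_le.2 ⟨hb.1.le, hb.2.le⟩
    set o : ℂ := ⟨a, b⟩
    have hoc : ∀ v, |axCo v o| ≤ ω / 2 ∧ lineCost n x ρ v (axCo v o) < 6⁻¹ := by
      rintro (_ | _)
      · exact ⟨hbb, hlb⟩
      · exact ⟨haa, hla⟩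
    have hsq : ∀ {p q : ℝ}, |p| ≤ 1 - ω / 2 → |q| ≤ ω / 2 → p ^ 2 + q ^ 2 < 1 := by
      intro p q hp hq
      rw [← sq_abs p, ← sq_abs q]
      have hω2 : ω ≤ 1 / 2 := by simp only [ω]; linarith
      nlinarith [abs_nonneg p, abs_nonneg q]
    have ho : o ∈ Metric.ball (0 : ℂ) 1 := by
      have : o = axPt true a b := rfl
      rw [this]
      have hω2 : ω ≤ 1 / 2 := by simp only [ω]; linarith
      exact norm_axPt_lt_one (hsq (by linarith) hbb)
    obtain ⟨R₁, C₁, L₁, hR₁, hW₁⟩ := link_center (n := n) (x := x) (ρ := ρ) (hball hy₁ he₁) ho v₁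
      (by rw [hes₁]; exact hsq as₁ (hoc _).1)
    obtain ⟨R₂, C₂, L₂, hR₂, hW₂⟩ := link_center (n := n) (x := x) (ρ := ρ) (hball hy₂ he₂) ho v₂
      (by rw [hes₂]; exact hsq as₂ (hoc _).1)
    obtain ⟨γ, h0, h1, hγR, -, hγ⟩ := hG.exists_path_cost_le (L₁.trans L₂.symm)
    have hone := hadm γ (fun t ht => by
      have : γ t ∈ proj G '' inSphere (R₁ ∪ R₂) := hγR ▸ mem_range_self t
      obtain ⟨_, ⟨z, hz, rfl⟩, hzt⟩ := this
      rw [ht, hy] at hzt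
      exact (hG.fiber_zero z).1 hzt ⟨z, union_subset hR₁ hR₂ hz, rfl⟩)
      (by rw [h0]; exact he₁) (by rw [h1]; exact he₂)
    have hlt : C₁ + C₂ + weight n x ρ (R₁ ∪ R₂) < 1 := by
      calc C₁ + C₂ + weight n x ρ (R₁ ∪ R₂)
          ≤ C₁ + C₂ + (weight n x ρ R₁ + weight n x ρ R₂) := by
            gcongr
            exact weight_union_le _ _
        _ = (C₁ + weight n x ρ R₁) + (C₂ + weight n x ρ R₂) := by ring
        _ ≤ (lineCost n x ρ v₁ s₁ + lineCost n x ρ (!v₁) (axCo (!v₁) o)) +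
            (lineCost n x ρ v₂ s₂ + lineCost n x ρ (!v₂) (axCo (!v₂) o)) := by
            rw [hes₁] at hW₁
            rw [hes₂] at hW₂
            exact add_le_add hW₁ hW₂
        _ < (6⁻¹ + 6⁻¹) + (6⁻¹ + 6⁻¹) :=
            ENNReal.add_lt_add (ENNReal.add_lt_add hl₁ (hoc _).2)
              (ENNReal.add_lt_add hl₂ (hoc _).2)
        _ = 6⁻¹ * 4 := by ring
        _ ≤ 6⁻¹ * 6 := by gcongr; norm_num
        _ = 1 := ENNReal.inv_mul_cancel (by norm_num) (by norm_num)
    exact absurd (hone.trans (hγ (union_subset hR₁ hR₂))) (not_le.2 hlt)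
  · have hQb : {z : ℂ | proj G (z : ℂ) = y} ⊆ Metric.ball 0 1 := by
      intro z hz
      by_contra h
      exact hy (Eq.trans (Eq.symm hz) ((hG.fiber_zero z).2 fun h' => h (coe_mem_inSphere.1 h')))
    have hfour : ∀ {v : Bool} {s : ℝ} {e : ℂ}, |s| ≤ 1 - ω / 2 → axCo v e = s →
        (e ∈ Metric.ball (0 : ℂ) 1 ∨ e = axPt v s 4) → |axCo v e| ≤ 4 ∧ |axCo (!v) e| ≤ 4 := by
      rintro v s e hs rfl h
      refine ⟨by linarith, ?_⟩
      rcases h with h | h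
      · have := abs_axCo_le (!v) e
        rw [mem_ball_zero_iff] at h
        linarith
      · rw [h, axCo_not_axPt]
        norm_num
    obtain ⟨f11, f12⟩ := hfour as₁ hes₁ hb₁
    obtain ⟨f21, f22⟩ := hfour as₂ hes₂ hb₂
    obtain ⟨R₁, C₁, L₁, hR₁, hW₁⟩ := hG.link_outside (ρ := ρ) hyc hQb (e := e₁)
      (fun h => hy₁ (by rw [← show proj G (e₁ : ℂ) = y from h]; exact he₁)) v₁ f11 f12
    obtain ⟨R₂, C₂, L₂, hR₂, hW₂⟩ := hG.link_outside (ρ := ρ) hyc hQb (e := e₂)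
      (fun h => hy₂ (by rw [← show proj G (e₂ : ℂ) = y from h]; exact he₂)) v₂ f21 f22
    obtain ⟨γ, h0, h1, hγR, hγ, -⟩ := hG.exists_path_cost_le (L₁.trans L₂.symm)
    have hone := hadm γ (fun t ht => by
      have : γ t ∈ proj G '' inSphere (R₁ ∪ R₂) := hγR ▸ mem_range_self t
      obtain ⟨_, ⟨z, hz, rfl⟩, hzt⟩ := this
      exact disjoint_left.1 (disjoint_union_left.2 ⟨hR₁, hR₂⟩) hz (hzt.trans ht))
      (by rw [h0]; exact he₁) (by rw [h1]; exact he₂)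
    -- The links now pass through the exterior class, whose value is bounded by the mass alone: `ρ
    -- (x 0) ^ 2 ≤ mass ρ < 1 / 36`.
    have h6 : ρ (x 0) < 6⁻¹ := by
      have h2 : ρ (x 0) ^ 2 < (6⁻¹) ^ 2 := by
        refine (hG.sq_le_mass (Nat.zero_le n)).trans_lt (hM.trans_le ?_)
        rw [show (6⁻¹ : ℝ≥0∞) = ENNReal.ofReal (6⁻¹) by
          rw [ENNReal.ofReal_inv_of_pos (by norm_num)]; norm_num,
          ← ENNReal.ofReal_pow (by norm_num)]
        apply ENNReal.ofReal_le_ofReal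
        have hω2 : ω ≤ 1 / 2 := by simp only [ω]; linarith
        nlinarith
      by_contra! h
      exact absurd h2 (not_lt.2 (by gcongr))
    have hlt : C₁ + C₂ + (ρ (x 0) + weight n x ρ (R₁ ∪ R₂)) < 1 := by
      calc C₁ + C₂ + (ρ (x 0) + weight n x ρ (R₁ ∪ R₂))
          ≤ C₁ + C₂ + (ρ (x 0) + (weight n x ρ R₁ + weight n x ρ R₂)) := by
            gcongr
            exact weight_union_le _ _
        _ = ρ (x 0) + ((C₁ + weight n x ρ R₁) + (C₂ + weight n x ρ R₂)) := by ring
        _ ≤ ρ (x 0) + (lineCost n x ρ v₁ s₁ + lineCost n x ρ v₂ s₂) := by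
            rw [hes₁] at hW₁
            rw [hes₂] at hW₂
            gcongr
        _ < 6⁻¹ + (6⁻¹ + 6⁻¹) := ENNReal.add_lt_add h6 (ENNReal.add_lt_add hl₁ hl₂)
        _ = 6⁻¹ * 3 := by ring
        _ ≤ 6⁻¹ * 6 := by gcongr; norm_num
        _ = 1 := ENNReal.inv_mul_cancel (by norm_num) (by norm_num)
    exact absurd (hone.trans hγ) (not_le.2 hlt)

end IsCircleConfig

end Linking

/-! ### Square annuli -/

/-- The distance from `w` in the supremum norm. -/
def supDist (w z : ℂ) : ℝ := max |z.re - w.re| |z.im - w.im|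

theorem lipschitzWith_supDist (w : ℂ) : LipschitzWith 1 (supDist w) := by
  refine LipschitzWith.of_dist_le_mul fun z z' => ?_
  rw [NNReal.coe_one, one_mul, Real.dist_eq, dist_eq_norm]
  refine (abs_max_sub_max_le_max _ _ _ _).trans (max_le ?_ ?_)
  · refine (abs_abs_sub_abs_le _ _).trans ?_
    rw [sub_sub_sub_cancel_right, ← Complex.sub_re]
    exact Complex.abs_re_le_norm _
  · refine (abs_abs_sub_abs_le _ _).trans ?_
    rw [sub_sub_sub_cancel_right, ← Complex.sub_im]
    exact Complex.abs_im_le_norm _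

theorem continuous_supDist (w : ℂ) : Continuous (supDist w) := (lipschitzWith_supDist w).continuous

theorem supDist_le_norm (w z : ℂ) : supDist w z ≤ ‖z - w‖ :=
  max_le (by rw [← Complex.sub_re]; exact Complex.abs_re_le_norm _)
    (by rw [← Complex.sub_im]; exact Complex.abs_im_le_norm _)

theorem norm_le_two_mul_supDist (w z : ℂ) : ‖z - w‖ ≤ 2 * supDist w z := by
  have := Complex.norm_le_abs_re_add_abs_im (z - w)
  rw [Complex.sub_re, Complex.sub_im] at this
  have h1 : |z.re - w.re| ≤ supDist w z := le_max_left _ _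
  have h2 : |z.im - w.im| ≤ supDist w z := le_max_right _ _
  linarith

/-- The total density of the four sides of a square. -/
def squareCost (p : ℂ → ℝ≥0∞) (w : ℂ) (t : ℝ) : ℝ≥0∞ :=
  (((∫⁻ τ in Icc (w.im - t) (w.im + t), p (axPt true (w.re + t) τ)) +
    ∫⁻ τ in Icc (w.re - t) (w.re + t), p (axPt false (w.im + t) τ)) +
    ∫⁻ τ in Icc (w.im - t) (w.im + t), p (axPt true (w.re - t) τ)) +
    ∫⁻ τ in Icc (w.re - t) (w.re + t), p (axPt false (w.im - t) τ)

theorem supDist_of_mem_side {w : ℂ} {t τ : ℝ} (v : Bool) {σ' : ℝ} (hs : |σ'| = t)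
    (hτ : τ ∈ Icc (axCo (!v) w - t) (axCo (!v) w + t)) :
    supDist w (axPt v (axCo v w + σ') τ) = t := by
  have h2 : |τ - axCo (!v) w| ≤ t := abs_le.2 ⟨by linarith [hτ.1], by linarith [hτ.2]⟩
  cases v
  · simp only [supDist, axPt, axCo, cond_false, add_sub_cancel_left, Bool.not_false,
      cond_true] at *
    rw [hs]
    exact max_eq_right h2
  · simp only [supDist, axPt, axCo, cond_true, add_sub_cancel_left, Bool.not_true,
      cond_false] at *
    rw [hs]
    exact max_eq_left h2

theorem link_square (p : ℂ → ℝ≥0∞) (w : ℂ) {t : ℝ} (ht : 0 ≤ t) :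
    ∃ z, LipLink p z z {z | supDist w z = t} (squareCost p w t) := by
  have l1 := LipLink.segment p true (w.re + t) (w.im - t) (w.im + t)
  have l2 := LipLink.segment p false (w.im + t) (w.re + t) (w.re - t)
  have l3 := LipLink.segment p true (w.re - t) (w.im + t) (w.im - t)
  have l4 := LipLink.segment p false (w.im - t) (w.re - t) (w.re + t)
  rw [uIcc_of_le (by linarith)] at l1 l4
  rw [uIcc_of_ge (by linarith)] at l2 l3
  have l := ((l1.trans l2).trans l3).trans l4
  refine ⟨axPt true (w.re + t) (w.im - t), ?_⟩
  suffices h : {z | supDist w z = t} = axPt true (w.re + t) '' Icc (w.im - t) (w.im + t) ∪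
      axPt false (w.im + t) '' Icc (w.re - t) (w.re + t) ∪
      axPt true (w.re - t) '' Icc (w.im - t) (w.im + t) ∪
      axPt false (w.im - t) '' Icc (w.re - t) (w.re + t) by
    rw [h]
    exact l
  ext z
  constructor
  · intro hz
    have hz' : max |z.re - w.re| |z.im - w.im| = t := hz
    have h1 : |z.re - w.re| ≤ t := hz' ▸ le_max_left _ _
    have h2 : |z.im - w.im| ≤ t := hz' ▸ le_max_right _ _
    have m1 : z.re ∈ Icc (w.re - t) (w.re + t) := by
      rw [abs_le] at h1
      constructor <;> linarith
    have m2 : z.im ∈ Icc (w.im - t) (w.im + t) := by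
      rw [abs_le] at h2
      constructor <;> linarith
    rcases max_choice |z.re - w.re| |z.im - w.im| with h | h <;> rw [h] at hz'
    · rcases (abs_eq ht).1 hz' with h | h
      · refine Or.inl (Or.inl (Or.inl ⟨z.im, m2, ?_⟩))
        apply Complex.ext
        · simp only [axPt, cond_true]; linarith
        · rfl
      · refine Or.inl (Or.inr ⟨z.im, m2, ?_⟩)
        apply Complex.ext
        · simp only [axPt, cond_true]; linarith
        · rfl
    · rcases (abs_eq ht).1 hz' with h | h
      · refine Or.inl (Or.inl (Or.inr ⟨z.re, m1, ?_⟩))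
        apply Complex.ext
        · rfl
        · simp only [axPt, cond_false]; linarith
      · refine Or.inr ⟨z.re, m1, ?_⟩
        apply Complex.ext
        · rfl
        · simp only [axPt, cond_false]; linarith
  · rintro (((⟨τ, hτ, rfl⟩ | ⟨τ, hτ, rfl⟩) | ⟨τ, hτ, rfl⟩) | ⟨τ, hτ, rfl⟩)
    · exact supDist_of_mem_side true (abs_of_nonneg ht) hτ
    · exact supDist_of_mem_side false (abs_of_nonneg ht) hτ
    · exact supDist_of_mem_side true (by rw [abs_neg, abs_of_nonneg ht] : |-t| = t) hτ
    · exact supDist_of_mem_side false (by rw [abs_neg, abs_of_nonneg ht] : |-t| = t) hτ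

/-- As `t` varies, each of the four sides sweeps out part of the annulus, so Fubini bounds its
contribution by the integral over the annulus. Squares need only Cartesian coordinates. -/
theorem lintegral_squareCost_le {p : ℂ → ℝ≥0∞} (hp : Measurable p) (w : ℂ) {r β : ℝ}
    (hr : 0 < r) :
    ∫⁻ t in Ioo r β, squareCost p w t ≤ 4 * ∫⁻ z in {z | supDist w z ∈ Ioo r β}, p z := by
  set S := {z | supDist w z ∈ Ioo r β}
  have hS : MeasurableSet S := (continuous_supDist w).measurable measurableSet_Ioo
  have hq : Measurable (S.indicator p) := hp.indicator hS
  have hside : ∀ (v : Bool) (σ' t : ℝ), t ∈ Ioo r β → |σ'| = t →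
      ∫⁻ τ in Icc (axCo (!v) w - t) (axCo (!v) w + t), p (axPt v (axCo v w + σ') τ) ≤
        ∫⁻ τ, S.indicator p (axPt v (axCo v w + σ') τ) := by
    intro v σ' t ht hs
    refine (le_of_eq ?_).trans (setLIntegral_le_lintegral
      (Icc (axCo (!v) w - t) (axCo (!v) w + t)) _)
    refine setLIntegral_congr_fun measurableSet_Icc fun τ hτ => ?_
    have : axPt v (axCo v w + σ') τ ∈ S := by
      change supDist w _ ∈ Ioo r β
      rwa [supDist_of_mem_side v hs hτ]
    rw [indicator_of_mem this]
  have hadd : ∀ v, ∫⁻ t, ∫⁻ τ, S.indicator p (axPt v (axCo v w + t) τ) = ∫⁻ z in S, p z := by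
    intro v
    rw [lintegral_add_left_eq_self (fun s => ∫⁻ τ, S.indicator p (axPt v s τ)),
      lintegral_axPt v hq, lintegral_indicator hS]
  have hsub : ∀ v, ∫⁻ t, ∫⁻ τ, S.indicator p (axPt v (axCo v w - t) τ) = ∫⁻ z in S, p z := by
    intro v
    rw [lintegral_sub_left_eq_self (fun s => ∫⁻ τ, S.indicator p (axPt v s τ)),
      lintegral_axPt v hq, lintegral_indicator hS]
  have hm := fun v => measurable_lintegral_axPt v hq
  have hma : ∀ v, Measurable fun t => ∫⁻ τ, S.indicator p (axPt v (axCo v w + t) τ) := fun v =>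
    (hm v).comp (measurable_const_add _)
  have hms : ∀ v, Measurable fun t => ∫⁻ τ, S.indicator p (axPt v (axCo v w - t) τ) := fun v =>
    (hm v).comp (measurable_const_sub _)
  calc ∫⁻ t in Ioo r β, squareCost p w t
      ≤ ∫⁻ t in Ioo r β, ((((∫⁻ τ, S.indicator p (axPt true (axCo true w + t) τ)) +
        ∫⁻ τ, S.indicator p (axPt false (axCo false w + t) τ)) +
        ∫⁻ τ, S.indicator p (axPt true (axCo true w - t) τ)) +
        ∫⁻ τ, S.indicator p (axPt false (axCo false w - t) τ)) := by
        refine setLIntegral_mono' measurableSet_Ioo fun t ht => ?_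
        have h0 : |t| = t := abs_of_pos (hr.trans ht.1)
        have h0' : |-t| = t := by rw [abs_neg, h0]
        exact add_le_add (add_le_add (add_le_add (hside true t t ht h0) (hside false t t ht h0))
          (hside true (-t) t ht h0')) (hside false (-t) t ht h0')
    _ ≤ ∫⁻ t, ((((∫⁻ τ, S.indicator p (axPt true (axCo true w + t) τ)) +
        ∫⁻ τ, S.indicator p (axPt false (axCo false w + t) τ)) +
        ∫⁻ τ, S.indicator p (axPt true (axCo true w - t) τ)) +
        ∫⁻ τ, S.indicator p (axPt false (axCo false w - t) τ)) := setLIntegral_le_lintegral _ _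
    _ = _ := by
        rw [lintegral_add_right _ (hms false), lintegral_add_right _ (hms true),
          lintegral_add_right _ (hma false), hadd, hadd, hsub, hsub]
        ring

/-- Every square in the annulus costs at least `1`, hence the squares together cost at least `r`,
while the area in question is of order `r ^ 2`. With `ε` of order `1 / r` the radius cancels, and
the bound is independent of scale. -/
theorem IsCircleConfig.mass_ge_of_annulus {G : Set Sphere} {n : ℕ} {x : ℕ → Hat G}
    {ρ : Hat G → ℝ≥0∞} (hG : IsCircleConfig G n x) (hρ : Measurable[borel (Hat G)] ρ) (w : ℂ)
    {r : ℝ} (hr : 0 < r) (hb : {z | supDist w z ∈ Ioo r (2 * r)} ⊆ Metric.ball 0 1)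
    {T : Finset ℕ} (hT : T ⊆ Finset.Icc 1 n)
    (hT' : ∀ l, 1 ≤ l → l ≤ n → ∀ z : ℂ, proj G (z : ℂ) = x l → supDist w z ∈ Ioo r (2 * r) → l ∈ T)
    (hadm : ∀ t ∈ Ioo r (2 * r), ∀ γ : C(I, Hat G),
      range γ = proj G '' inSphere {z | supDist w z = t} →
      1 ≤ pathIntegral ρ γ + ∑' x : {x : Hat G // x ∈ compPoints G ∩ range γ}, ρ x.1) :
    ENNReal.ofReal (1 / 5000) ≤
      (∫⁻ z in {z | supDist w z ∈ Ioo r (2 * r)}, planarDensity ρ z ^ 2) +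
        ∑ l ∈ T, ρ (x l) ^ 2 := by
  set S := {z | supDist w z ∈ Ioo r (2 * r)}
  have hp := measurable_planarDensity hG.isOpen hρ
  have hcost : ∀ t ∈ Ioo r (2 * r), 1 ≤ squareCost (planarDensity ρ) w t +
      weight n x ρ {z | supDist w z = t} := by
    intro t ht
    obtain ⟨z, L⟩ := link_square (planarDensity ρ) w (hr.trans ht.1).le
    obtain ⟨γ, -, -, hγR, -, hγ⟩ := hG.exists_path_cost_le L
    refine (hadm t ht γ hγR).trans (hγ ?_)
    intro z hz
    refine hb ?_
    change supDist w z ∈ Ioo r (2 * r)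
    rwa [show supDist w z = t from hz]
  -- The area term is `6 * ε * 51 * r ^ 2 = r / 2`, where `51` bounds `16 * π`. Half of the total
  -- cost `r` must therefore come from the mass.
  set ε : ℝ≥0∞ := ENNReal.ofReal (1 / (612 * r))
  have h0 : ε ≠ 0 := (ENNReal.ofReal_pos.2 (by positivity)).ne'
  have h1 : ε ≠ ⊤ := ENNReal.ofReal_ne_top
  set V : Set ℂ := {z | supDist w z < 2 * r}
  have hV : volume V ≤ ENNReal.ofReal (51 * r ^ 2) := by
    calc volume V ≤ volume (Metric.ball w (4 * r)) := by
          refine measure_mono fun z hz => ?_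
          have hz' : supDist w z < 2 * r := hz
          rw [Metric.mem_ball, dist_eq_norm]
          linarith [norm_le_two_mul_supDist w z]
      _ = ENNReal.ofReal ((4 * r) ^ 2 * Real.pi) := by
          rw [Complex.volume_ball, ← ENNReal.ofReal_pow (by positivity),
            ENNReal.ofReal_mul (by positivity), ← NNReal.coe_real_pi, ENNReal.ofReal_coe_nnreal]
      _ ≤ _ := by
          apply ENNReal.ofReal_le_ofReal
          nlinarith [Real.pi_lt_d2, sq_nonneg r]
  have hSV : volume S ≤ ENNReal.ofReal (51 * r ^ 2) :=
    (measure_mono fun z (hz : supDist w z ∈ Ioo r (2 * r)) => hz.2).trans hV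
  set M := (∫⁻ z in S, planarDensity ρ z ^ 2) + ∑ l ∈ T, ρ (x l) ^ 2
  have hup : ENNReal.ofReal r ≤ ENNReal.ofReal (r / 2) + 4 * ε⁻¹ * M := by
    calc ENNReal.ofReal r = ∫⁻ t in Ioo r (2 * r), 1 := by
          rw [setLIntegral_one, Real.volume_Ioo]
          congr 1
          ring
      _ ≤ ∫⁻ t in Ioo r (2 * r), (squareCost (planarDensity ρ) w t +
          weight n x ρ {z | supDist w z = t}) := setLIntegral_mono' measurableSet_Ioo hcost
      _ ≤ (∫⁻ t in Ioo r (2 * r), squareCost (planarDensity ρ) w t) +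
          ∫⁻ t in Ioo r (2 * r), weight n x ρ {z | supDist w z = t} := by
          rw [lintegral_add_right _ (hG.measurable_weight_level (continuous_supDist w))]
      _ ≤ 4 * (ε * ENNReal.ofReal (51 * r ^ 2) + ε⁻¹ * ∫⁻ z in S, planarDensity ρ z ^ 2) +
          (ε * (2 * ENNReal.ofReal (51 * r ^ 2)) + ε⁻¹ * ∑ l ∈ T, ρ (x l) ^ 2) := by
          refine add_le_add ((lintegral_squareCost_le hp w hr).trans ?_)
            ((hG.weight_integral_le (lipschitzWith_supDist w) r (2 * r) (S := V)
            (fun l _ _ z _ hz => hz) h0 h1 hT hT').trans ?_)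
          · gcongr
            refine (hG.lintegral_planarDensity_le hρ S h0 h1).trans ?_
            gcongr
          · gcongr
      _ ≤ 4 * (ε * ENNReal.ofReal (51 * r ^ 2) + ε⁻¹ * ∫⁻ z in S, planarDensity ρ z ^ 2) +
          (ε * (2 * ENNReal.ofReal (51 * r ^ 2)) + 4 * (ε⁻¹ * ∑ l ∈ T, ρ (x l) ^ 2)) := by
          refine add_le_add le_rfl (add_le_add le_rfl ?_)
          exact le_mul_of_one_le_left zero_le (by norm_num)
      _ = ε * (6 * ENNReal.ofReal (51 * r ^ 2)) + 4 * ε⁻¹ * M := by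
          simp only [M]
          ring
      _ = _ := by
          congr 1
          rw [show (6 : ℝ≥0∞) = ENNReal.ofReal 6 by norm_num, ← ENNReal.ofReal_mul (by norm_num),
            ← ENNReal.ofReal_mul (by positivity)]
          congr 1
          field_simp
          norm_num
  by_contra! hM
  have hlt : 4 * ε⁻¹ * M < ENNReal.ofReal (r / 2) := by
    calc 4 * ε⁻¹ * M < 4 * ε⁻¹ * ENNReal.ofReal (1 / 5000) :=
          ENNReal.mul_lt_mul_right (mul_ne_zero (by norm_num) (ENNReal.inv_ne_zero.2 h1))
            (ENNReal.mul_ne_top (by norm_num) (ENNReal.inv_ne_top.2 h0)) hM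
      _ = ENNReal.ofReal (4 * (612 * r) * (1 / 5000)) := by
          rw [← ENNReal.ofReal_inv_of_pos (by positivity),
            show (4 : ℝ≥0∞) = ENNReal.ofReal 4 by norm_num, ← ENNReal.ofReal_mul (by norm_num),
            ← ENNReal.ofReal_mul (by positivity)]
          congr 1
          field_simp
      _ ≤ _ := by
          apply ENNReal.ofReal_le_ofReal
          linarith
  have : ENNReal.ofReal (r / 2) + 4 * ε⁻¹ * M < ENNReal.ofReal r := by
    conv_rhs => rw [show r = r / 2 + r / 2 by ring,
      ENNReal.ofReal_add (by positivity) (by positivity)]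
    exact ENNReal.add_lt_add_left ENNReal.ofReal_ne_top hlt
  exact absurd hup (not_le.2 this)

/-! ### The approximating domains -/

section Approx

variable {Ω : Set Sphere} {p : ℕ → Set Sphere}

theorem isClosed_of_mem_complComps {G q : Set Sphere} (hG : IsOpen G) (hq : q ∈ complComps G) :
    IsClosed q := by
  obtain ⟨y, hy, rfl⟩ := hq
  refine isClosed_of_closure_subset ?_
  refine isPreconnected_connectedComponentIn.closure.subset_connectedComponentIn
    (subset_closure (mem_connectedComponentIn hy)) ?_
  exact closure_minimal (connectedComponentIn_subset _ _) hG.isClosed_compl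

theorem mem_compl_approxDomain {n : ℕ} {z : Sphere} :
    z ∉ approxDomain p n ↔ ∃ l ≤ n, z ∈ p l := by
  simp [approxDomain]

theorem subset_approxDomain (hp : ∀ l, p l ∈ complComps Ω) (n : ℕ) : Ω ⊆ approxDomain p n := by
  intro z hz
  by_contra h
  obtain ⟨l, -, hl⟩ := mem_compl_approxDomain.1 h
  exact complComps_subset (hp l) hl hz

/-- The complement of the approximating domain is contained in that of `Ω`, so its component cannot
be larger than `p l`. -/
theorem mem_complComps_approxDomain (hp : ∀ l, p l ∈ complComps Ω) {n l : ℕ} (hl : l ≤ n) :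
    p l ∈ complComps (approxDomain p n) := by
  obtain ⟨z, hz⟩ := complComps_nonempty (hp l)
  have hzG : z ∈ (approxDomain p n)ᶜ := mem_compl_approxDomain.2 ⟨l, hl, hz⟩
  have hsub : p l ⊆ (approxDomain p n)ᶜ := fun y hy => mem_compl_approxDomain.2 ⟨l, hl, hy⟩
  refine ⟨z, hzG, Subset.antisymm ?_ ?_⟩
  · exact (isPreconnected_of_mem_complComps (hp l)).subset_connectedComponentIn hz hsub
  · rw [eq_connectedComponentIn (hp l) hz]
    exact connectedComponentIn_mono _ (compl_subset_compl.2 (subset_approxDomain hp n))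

theorem eq_of_mem_of_mem (hp : ∀ l, p l ∈ complComps Ω) (hinj : Function.Injective p) {l m : ℕ}
    {z : Sphere} (hl : z ∈ p l) (hm : z ∈ p m) : l = m :=
  hinj ((eq_connectedComponentIn (hp l) hl).trans (eq_connectedComponentIn (hp m) hm).symm)

end Approx

/-! ### Images of complementary components under the extension to the quotients -/

section HatImage

variable {G G' : Set Sphere} {f : Sphere → Sphere}

theorem notMem_of_hat {F : Hat G ≃ₜ Hat G'} (hF : IsHatExtension f G G' F) (hf : BijOn f G G')
    {z w : Sphere} (hz : z ∉ G) (h : F (proj G z) = proj G' w) : w ∉ G' := by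
  intro hw
  obtain ⟨y, hy, rfl⟩ := hf.surjOn hw
  rw [← hF y hy] at h
  exact hz (mem_of_proj_eq (F.injective h).symm hy)

theorem mem_of_hat {F : Hat G ≃ₜ Hat G'} (hF : IsHatExtension f G G' F) (hf : BijOn f G G')
    {z w : Sphere} (hz : z ∈ G) (h : F (proj G z) = proj G' w) : w = f z := by
  rw [hF z hz] at h
  exact ((proj_eq_iff_of_mem (hf.mapsTo hz)).1 h).symm

/-- If the image of a complementary component is connected, then it is the fiber over its
class. -/
theorem proj_eq_iff_mem_hatImage {F : Hat G ≃ₜ Hat G'} (hF : IsHatExtension f G G' F)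
    (hf : BijOn f G G') {q : Set Sphere} (hq : q ∈ complComps G)
    (hc : IsPreconnected (hatImage f G G' q)) {z : Sphere} (hz : z ∈ q) (w : Sphere) :
    proj G' w = F (proj G z) ↔ w ∈ hatImage f G G' q := by
  constructor
  · exact fun h => ⟨F, hF, z, hz, h.symm⟩
  · intro hw
    have hsub : hatImage f G G' q ⊆ G'ᶜ := by
      rintro y ⟨F', hF', z', hz', h⟩
      exact notMem_of_hat hF' hf (complComps_subset hq hz') h
    obtain ⟨y, hy⟩ := proj_surjective (F (proj G z))
    have hyq : y ∈ hatImage f G G' q := ⟨F, hF, z, hz, hy.symm⟩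
    rw [← hy]
    have hyG : connectedComponentIn G'ᶜ y ∈ complComps G' := ⟨y, hsub hyq, rfl⟩
    -- `hatImage` admits every homeomorphic extension of `f`. Its connectedness forces all of it
    -- into a single class, so uniqueness of the extension is not needed.
    exact (proj_eq_iff_of_mem_comp hyG (mem_connectedComponentIn (hsub hyq))).2
      (hc.subset_connectedComponentIn hyq hsub hw)

/-- The homeomorphic extension and the configuration of disks in the image. -/
theorem exists_circleConfig {Ω : Set Sphere} {p : ℕ → Set Sphere}
    (hp : ∀ l, p l ∈ complComps Ω) (hinj : Function.Injective p) {n : ℕ}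
    (hG' : IsOpen G') (hf : BijOn f (approxDomain p n) G')
    (h0 : hatImage f (approxDomain p n) G' (p 0) = (inSphere (Metric.ball 0 1))ᶜ)
    (hd : ∀ l, 1 ≤ l → l ≤ n → ∃ (c : ℂ) (r : ℝ), 0 < r ∧
      hatImage f (approxDomain p n) G' (p l) = inSphere (Metric.closedBall c r)) :
    ∃ (F : Hat (approxDomain p n) ≃ₜ Hat G') (x : ℕ → Hat G'),
      IsHatExtension f (approxDomain p n) G' F ∧ IsCircleConfig G' n x ∧
      (∀ l ≤ n, ∀ z ∈ p l, F (proj _ z) = x l) ∧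
      (∀ l ≤ n, ∀ w, proj G' w = x l ↔ w ∈ hatImage f (approxDomain p n) G' (p l)) := by
  -- Since `hatImage` is defined through an existing extension, any point in it yields one.
  have h1 : (OnePoint.infty : Sphere) ∈ hatImage f (approxDomain p n) G' (p 0) := by
    rw [h0]
    exact infty_notMem_inSphere
  obtain ⟨F, hF, -⟩ := h1
  choose pt hpt using fun l => complComps_nonempty (hp l)
  have hq := fun l (hl : l ≤ n) => mem_complComps_approxDomain hp hl
  have hfib : ∀ l ≤ n, ∀ w, proj G' w = F (proj _ (pt l)) ↔
      w ∈ hatImage f (approxDomain p n) G' (p l) := by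
    intro l hl
    refine proj_eq_iff_mem_hatImage hF hf (hq l hl) ?_ (hpt l)
    rcases Nat.eq_zero_or_pos l with rfl | hl0
    · rw [h0]
      exact isPreconnected_compl_inSphere_ball 0 one_pos
    · obtain ⟨c, r, -, h⟩ := hd l hl0 hl
      rw [h]
      exact isPreconnected_inSphere (convex_closedBall c r).isPreconnected
  have hx : ∀ l ≤ n, ∀ z ∈ p l, F (proj _ z) = F (proj _ (pt l)) := fun l hl z hz =>
    congrArg F ((proj_eq_iff_of_mem_comp (hq l hl) (hpt l)).2 hz)
  refine ⟨F, fun l => F (proj _ (pt l)), hF, ⟨hG', ?_, ?_, ?_, ?_⟩, hx, hfib⟩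
  · rw [← h0]
    exact hfib 0 (Nat.zero_le n)
  · intro l hl1 hl2
    obtain ⟨c, r, hr, h⟩ := hd l hl1 hl2
    refine ⟨c, r, hr, ?_⟩
    rw [← h]
    exact hfib l hl2
  · intro l hl m _ h
    have := (proj_eq_iff_of_mem_comp (hq l hl) (hpt l)).1 (F.injective h).symm
    exact eq_of_mem_of_mem hp hinj this (hpt m)
  · ext y
    obtain ⟨w, rfl⟩ := proj_surjective y
    rw [proj_mem_compPoints]
    obtain ⟨z, hz⟩ := proj_surjective (F.symm (proj G' w))
    have hz' : F (proj _ z) = proj G' w := by rw [hz, F.apply_symm_apply]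
    constructor
    · intro hw
      by_cases hzG : z ∈ approxDomain p n
      · exact absurd (mem_of_hat hF hf hzG hz' ▸ hf.mapsTo hzG) hw
      · obtain ⟨l, hl, hzl⟩ := mem_compl_approxDomain.1 hzG
        exact ⟨l, hl, (hx l hl z hzl).symm.trans hz'⟩
    · rintro ⟨l, hl, h⟩
      exact notMem_of_hat hF hf (mem_compl_approxDomain.2 ⟨l, hl, hpt l⟩) h

theorem mem_hatFamily_iff_symm {F : Hat G ≃ₜ Hat G'} (hF : IsHatExtension f G G' F)
    {Γ : Set C(I, Hat G)} {η : C(I, Hat G')}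
    (h : (⟨fun t => F.symm (η t), F.symm.continuous.comp η.continuous⟩ : C(I, Hat G)) ∈ Γ) :
    η ∈ hatFamily f G G' Γ :=
  ⟨F, hF, _, h, fun t => (F.apply_symm_apply (η t)).symm⟩

theorem le_modulus {Γ : Set C(I, Hat G)} {m : ℝ≥0∞} (h : ∀ ρ ∈ admissible Γ, m ≤ mass ρ) :
    m ≤ modulus Γ := le_iInf₂ h

end HatImage

/-! ### Lower bounds for joining paths -/

theorem IsCircleConfig.mem_ball {G G' : Set Sphere} {f : Sphere → Sphere} {n : ℕ} {x : ℕ → Hat G'}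
    (hx : IsCircleConfig G' n x) (hf : MapsTo f G G') {z : Sphere} (hz : z ∈ G) :
    f z ∈ inSphere (Metric.ball 0 1) := by
  by_contra h
  have h2 := (hx.fiber_zero (f z)).2 h
  have h3 : proj G' (f z) ∈ compPoints G' := by
    rw [hx.comp]
    exact ⟨0, Nat.zero_le _, h2.symm⟩
  exact proj_mem_compPoints.1 h3 (hf hz)

/-- A lower bound for the modulus of the paths that join a set `J` and a segment which ends at a
complementary component, and avoid this component. -/
theorem modulus_joining_ge {G G' : Set Sphere} {f : Sphere → Sphere} {F : Hat G ≃ₜ Hat G'}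
    (hF : IsHatExtension f G G' F) (hf : BijOn f G G') {n : ℕ} {x : ℕ → Hat G'}
    (hx : IsCircleConfig G' n x) {P J : Set Sphere} {a b : ℂ}
    (hPeq : ∀ z, proj G z = proj G (a : Sphere) ↔ z ∈ P)
    (hy : F (proj G (a : Sphere)) = x 0 ∨ (F (proj G (a : Sphere)) ≠ x 0 ∧
      Convex ℝ {z : ℂ | proj G' (z : ℂ) = F (proj G (a : Sphere))}))
    (hab : ∀ t ∈ Ioc (0 : ℝ) 1, ((AffineMap.lineMap a b t : ℂ) : Sphere) ∉ P)
    (hb : (b : Sphere) ∈ G) (hJ : IsPreconnected J) (hJG : J ⊆ G) (hJP : Disjoint J P)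
    {z₁ z₂ : Sphere} (hz₁ : z₁ ∈ J) (hz₂ : z₂ ∈ J) {d : ℝ} (hd : 0 < d)
    (hdJ : d ≤ ‖toComplex (f z₁) - toComplex (f z₂)‖)
    (hdb : d ≤ Metric.infDist (toComplex (f b))
      {z : ℂ | proj G' (z : ℂ) = F (proj G (a : Sphere))}) :
    ENNReal.ofReal ((d / 4) ^ 2 / 1440) ≤
      modulus (hatFamily f G G' (joiningPaths G P J (inSphere (segment ℝ a b)))) := by
  refine le_modulus fun ρ hρ => ?_
  set y := F (proj G (a : Sphere))
  -- The endpoint `a` lies in the forbidden component, so the segment is used without it.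
  set L : Set Sphere := (fun t : ℝ => ((AffineMap.lineMap a b t : ℂ) : Sphere)) '' Ioc 0 1
  have hcont : Continuous fun t : ℝ => ((AffineMap.lineMap a b t : ℂ) : Sphere) :=
    OnePoint.continuous_coe.comp AffineMap.lineMap_continuous
  have hLc : IsPreconnected L := isPreconnected_Ioc.image _ hcont.continuousOn
  have hLseg : L ⊆ inSphere (segment ℝ a b) := by
    rintro _ ⟨t, ht, rfl⟩
    refine ⟨_, ?_, rfl⟩
    rw [segment_eq_image_lineMap]
    exact ⟨t, ⟨ht.1.le, ht.2⟩, rfl⟩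
  set K₁ := F '' (proj G '' J)
  set K₂ := F '' (proj G '' L)
  have hcF : Continuous fun z => F (proj G z) := F.continuous.comp continuous_proj
  have hK₁ : IsPreconnected K₁ :=
    (hJ.image _ continuous_proj.continuousOn).image _ F.continuous.continuousOn
  have hK₂ : IsPreconnected K₂ :=
    (hLc.image _ continuous_proj.continuousOn).image _ F.continuous.continuousOn
  have hyK : ∀ A : Set Sphere, (∀ z ∈ A, z ∉ P) → y ∉ F '' (proj G '' A) := by
    rintro A hA ⟨_, ⟨z, hz, rfl⟩, h⟩
    exact hA z hz ((hPeq z).1 (F.injective h))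
  have hy₁ : y ∉ K₁ := hyK J fun z hz => disjoint_left.1 hJP hz
  have hy₂ : y ∉ K₂ := hyK L (by rintro _ ⟨t, ht, rfl⟩; exact hab t ht)
  have hfb : ∀ z ∈ G, ((toComplex (f z) : ℂ) : Sphere) = f z ∧ ‖toComplex (f z)‖ ≤ 1 := by
    intro z hz
    have h1 := hx.mem_ball hf.mapsTo hz
    exact ⟨coe_toComplex (ne_infty_of_mem_inSphere h1),
      (mem_ball_zero_iff.1 (toComplex_mem h1)).le⟩
  have hJK : ∀ z ∈ J, proj G' ((toComplex (f z) : ℂ) : Sphere) ∈ K₁ := by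
    intro z hz
    rw [(hfb z (hJG hz)).1, ← hF z (hJG hz)]
    exact ⟨_, ⟨z, hz, rfl⟩, rfl⟩
  have hbL : (b : Sphere) ∈ L := ⟨1, ⟨zero_lt_one, le_rfl⟩, by simp⟩
  have hbK : proj G' ((toComplex (f b) : ℂ) : Sphere) ∈ K₂ := by
    rw [(hfb b hb).1, ← hF b hb]
    exact ⟨_, ⟨_, hbL, rfl⟩, rfl⟩
  set E := proj G' ⁻¹' K₂
  -- The class `y` is the limit of the image of the segment at `a`. Since the projection is closed,
  -- this limit is realized by a point of `closure E` in the sphere.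
  have hyE : y ∈ proj G' '' closure E := by
    have hcl : IsClosed (proj G' '' closure E) := isClosedMap_proj hx.isOpen _ isClosed_closure
    have hsub : K₂ ⊆ proj G' '' closure E := fun k hk => by
      obtain ⟨w, rfl⟩ := proj_surjective k
      exact ⟨w, subset_closure hk, rfl⟩
    refine closure_minimal hsub hcl ?_
    have h0 : (0 : ℝ) ∈ closure (Ioc (0 : ℝ) 1) := by
      rw [closure_Ioc zero_ne_one]
      exact ⟨le_rfl, zero_le_one⟩
    have h1 := image_closure_subset_closure_image (hcF.comp hcont) ⟨_, h0, rfl⟩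
    simp only [Function.comp_apply, AffineMap.lineMap_apply_zero] at h1
    refine closure_mono ?_ h1
    rintro _ ⟨t, ht, rfl⟩
    exact ⟨_, ⟨_, ⟨t, ht, rfl⟩, rfl⟩, rfl⟩
  obtain ⟨v', hv'E, hv'y⟩ := hyE
  have hv'b : v' ∈ inSphere (Metric.closedBall 0 1) := by
    rcases hy with hy | ⟨hy, -⟩
    · have hEb : E ⊆ inSphere (Metric.closedBall 0 1) := by
        intro w hw
        by_contra h
        refine hy₂ ?_
        rw [hy, ← (hx.fiber_zero w).2 fun h' => h (image_mono Metric.ball_subset_closedBall h')]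
        exact hw
      exact closure_minimal hEb (isCompact_inSphere (isCompact_closedBall 0 1)).isClosed hv'E
    · by_contra h
      exact hy (hv'y.symm.trans
        ((hx.fiber_zero v').2 fun h' => h (image_mono Metric.ball_subset_closedBall h')))
  obtain ⟨v, hv, rfl⟩ := hv'b
  have hvcl : v ∈ closure {z : ℂ | proj G' (z : ℂ) ∈ K₂} := by
    rw [mem_closure_iff] at hv'E ⊢
    intro O hO hvO
    obtain ⟨_, ⟨z, hz, rfl⟩, hzE⟩ := hv'E _ (isOpen_inSphere hO) ⟨v, hvO, rfl⟩
    exact ⟨z, hz, hzE⟩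
  -- The accumulation point `v` lies in the fiber over `y`, so its distance to `f b` is at least the
  -- distance to the whole fiber.
  have hdv : d ≤ ‖toComplex (f b) - v‖ := by
    rw [← dist_eq_norm]
    exact hdb.trans (Metric.infDist_le_dist_of_mem hv'y)
  refine hx.mass_ge_of_joining hy hK₁ hK₂ hy₁ hy₂ (hJK z₁ hz₁) (subset_closure (hJK z₂ hz₂)) hbK
    hvcl (hfb z₁ (hJG hz₁)).2 (hfb z₂ (hJG hz₂)).2 (hfb b hb).2
    (mem_closedBall_zero_iff.1 hv) hd hdJ hdv hρ.1 ?_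
  intro η hηy hη0 hη1
  refine hρ.2 η (mem_hatFamily_iff_symm hF ⟨?_, ?_, ?_⟩)
  · rintro t ⟨z, hz, h⟩
    refine hηy t ?_
    rw [← F.apply_symm_apply (η t)]
    exact congrArg F (h.symm.trans ((hPeq z).2 hz))
  · obtain ⟨k, hk, h⟩ := hη0
    change F.symm (η 0) ∈ _
    rw [← h, F.symm_apply_apply]
    exact hk
  · obtain ⟨k, hk, h⟩ := hη1
    change F.symm (η 1) ∈ _
    rw [← h, F.symm_apply_apply]
    exact image_mono hLseg hk

/-! ### The identity theorem on the sphere -/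

theorem paramAt_coe (x z : ℂ) : paramAt (x : Sphere) z = z := by
  simp [paramAt]

theorem coordAt_coe (x : ℂ) : coordAt (x : Sphere) = toComplex := by
  simp [coordAt]

theorem paramAt_infty (z : ℂ) :
    paramAt OnePoint.infty z = if z = 0 then OnePoint.infty else ((z⁻¹ : ℂ) : Sphere) := by
  simp [paramAt]

theorem paramAt_infty_zero : paramAt OnePoint.infty 0 = OnePoint.infty := by
  simp [paramAt_infty]

theorem coordAt_infty (y : Sphere) : coordAt OnePoint.infty y = (toComplex y)⁻¹ := by
  simp [coordAt]

theorem toComplex_infty : toComplex OnePoint.infty = 0 := rfl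

theorem nhds_infty_iff {t : Set Sphere} : t ∈ 𝓝 (OnePoint.infty : Sphere) ↔
    OnePoint.infty ∈ t ∧ {z : ℂ | (z : Sphere) ∈ t} ∈ Bornology.cobounded ℂ := by
  rw [OnePoint.nhds_infty_eq, Metric.cobounded_eq_cocompact, ← Filter.coclosedCompact_eq_cocompact,
    mem_sup, mem_map, and_comm]
  rfl

theorem continuous_paramAt_infty : Continuous (paramAt OnePoint.infty) := by
  rw [continuous_iff_continuousAt]
  intro z
  by_cases hz : z = 0
  · subst hz
    rw [ContinuousAt, paramAt_infty_zero]
    intro t ht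
    obtain ⟨h1, h2⟩ := nhds_infty_iff.1 ht
    have h3 : ∀ᶠ z in 𝓝[≠] (0 : ℂ), ((z⁻¹ : ℂ) : Sphere) ∈ t := tendsto_inv₀_nhdsNE_zero h2
    rw [eventually_nhdsWithin_iff] at h3
    rw [mem_map]
    filter_upwards [h3] with z hz
    rw [mem_preimage, paramAt_infty]
    split_ifs with h
    · exact h1
    · exact hz h
  · have h1 : ContinuousAt (fun z : ℂ => ((z⁻¹ : ℂ) : Sphere)) z :=
      OnePoint.continuous_coe.continuousAt.comp (continuousAt_inv₀ hz)
    refine h1.congr ?_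
    filter_upwards [isOpen_ne.mem_nhds hz] with y hy
    rw [paramAt_infty, if_neg hy]

theorem tendsto_coordAt_infty :
    Tendsto (coordAt OnePoint.infty) (𝓝 OnePoint.infty) (𝓝 0) := by
  intro t ht
  rw [mem_map, nhds_infty_iff]
  constructor
  · rw [mem_preimage, coordAt_infty, toComplex_infty, inv_zero]
    exact mem_of_mem_nhds ht
  · have h := (tendsto_inv₀_cobounded (α := ℂ)) ht
    filter_upwards [h] with z hz
    change coordAt OnePoint.infty (z : Sphere) ∈ t
    rw [coordAt_infty]
    exact hz

theorem eventually_paramAt_coordAt_infty :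
    ∀ᶠ y in 𝓝 (OnePoint.infty : Sphere),
      paramAt OnePoint.infty (coordAt OnePoint.infty y) = y := by
  -- The coordinate at `∞` sends the finite point `0` to `0` as well, so this point has to be
  -- excluded.
  have h0 : {((0 : ℂ) : Sphere)}ᶜ ∈ 𝓝 (OnePoint.infty : Sphere) :=
    isOpen_compl_singleton.mem_nhds (OnePoint.infty_ne_coe 0)
  filter_upwards [h0] with y hy
  rw [coordAt_infty, paramAt_infty]
  induction y using OnePoint.rec with
  | infty => simp [toComplex_infty]
  | coe z =>
    rw [toComplex_coe, inv_inv, if_neg]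
    intro h
    rw [inv_eq_zero] at h
    exact hy (by rw [h]; rfl)

section Identity

variable {Ω : Set Sphere} {f : ℕ → Sphere → Sphere} {g : Sphere → ℂ}

theorem differentiableAt_of_isHolomorphicOn {f : Sphere → Sphere} {G : Set Sphere}
    (hf : IsHolomorphicOn f G) (hfin : ∀ z ∈ G, f z ≠ OnePoint.infty) {z : ℂ}
    (hz : (z : Sphere) ∈ G) : DifferentiableAt ℂ (fun z : ℂ => toComplex (f z)) z := by
  have h := hf.2 _ hz
  obtain ⟨w, hw⟩ := OnePoint.ne_infty_iff_exists.1 (hfin _ hz)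
  rw [← hw, coordAt_coe, coordAt_coe, toComplex_coe] at h
  refine h.congr_of_eventuallyEq (Eventually.of_forall fun y => ?_)
  simp [paramAt_coe]

theorem differentiableAt_of_isHolomorphicOn_infty {f : Sphere → Sphere} {G : Set Sphere}
    (hf : IsHolomorphicOn f G) (hfin : ∀ z ∈ G, f z ≠ OnePoint.infty) {z : ℂ}
    (hz : paramAt OnePoint.infty z ∈ G) :
    DifferentiableAt ℂ (fun z : ℂ => toComplex (f (paramAt OnePoint.infty z))) z := by
  by_cases h0 : z = 0
  · subst h0
    rw [paramAt_infty_zero] at hz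
    have h := hf.2 _ hz
    obtain ⟨w, hw⟩ := OnePoint.ne_infty_iff_exists.1 (hfin _ hz)
    rw [← hw, coordAt_coe, coordAt_infty, toComplex_infty, inv_zero] at h
    exact h
  · rw [paramAt_infty, if_neg h0] at hz
    have h := (differentiableAt_of_isHolomorphicOn hf hfin hz).comp z (differentiableAt_inv h0)
    refine h.congr_of_eventuallyEq ?_
    filter_upwards [isOpen_ne.mem_nhds h0] with y hy
    rw [paramAt_infty, if_neg hy]
    rfl

/-- If a locally uniform limit of holomorphic maps takes a value frequently near a point, then it is
constant near this point. -/
theorem eventually_eq_of_frequently_eq (hΩ : IsOpen Ω)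
    (hlim : TendstoLocallyUniformlyOn (fun j z => toComplex (f j z)) g atTop Ω)
    {ψ : ℂ → Sphere} {ξ : Sphere → ℂ} {x : Sphere} (hψ : Continuous ψ)
    (hξ : Tendsto ξ (𝓝 x) (𝓝 (ξ x))) (hψξ : ∀ᶠ y in 𝓝 x, ψ (ξ y) = y)
    (hd : ∀ j z, ψ z ∈ Ω → DifferentiableAt ℂ (fun z => toComplex (f j (ψ z))) z)
    (hx : x ∈ Ω) {c : ℂ} (hfr : ∃ᶠ y in 𝓝[≠] x, g y = c) : ∀ᶠ y in 𝓝 x, g y = c := by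
  have hxx : ψ (ξ x) = x := hψξ.self_of_nhds
  have ho : IsOpen (ψ ⁻¹' Ω) := hΩ.preimage hψ
  have hl : TendstoLocallyUniformlyOn (fun j z => toComplex (f j (ψ z))) (fun z => g (ψ z)) atTop
      (ψ ⁻¹' Ω) := hlim.comp ψ (mapsTo_preimage ψ Ω) hψ.continuousOn
  have hgd : DifferentiableOn ℂ (fun z => g (ψ z)) (ψ ⁻¹' Ω) :=
    hl.differentiableOn (Eventually.of_forall fun j z hz => (hd j z hz).differentiableWithinAt) ho
  have hmem : ψ ⁻¹' Ω ∈ 𝓝 (ξ x) := ho.mem_nhds (by rwa [mem_preimage, hxx])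
  have han : AnalyticAt ℂ (fun z => g (ψ z)) (ξ x) := hgd.analyticAt hmem
  have hne : Tendsto ξ (𝓝[≠] x) (𝓝[≠] (ξ x)) := by
    refine tendsto_nhdsWithin_of_tendsto_nhds_of_eventually_within _
      (hξ.mono_left nhdsWithin_le_nhds) ?_
    rw [eventually_nhdsWithin_iff]
    filter_upwards [hψξ] with y hy hyx h
    rw [mem_singleton_iff] at h
    exact hyx (by rw [mem_singleton_iff, ← hy, h, hxx])
  have hfr' : ∃ᶠ z in 𝓝[≠] (ξ x), g (ψ z) = c := by
    refine hne.frequently ?_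
    refine (hfr.and_eventually (hψξ.filter_mono nhdsWithin_le_nhds)).mono ?_
    rintro y ⟨h1, h2⟩
    rwa [h2]
  have hev := (han.frequently_eq_iff_eventually_eq analyticAt_const).1 hfr'
  filter_upwards [hξ hev, hψξ] with y h1 h2
  have h1' : g (ψ (ξ y)) = c := h1
  rwa [h2] at h1'

/-- A nonconstant locally uniform limit of holomorphic maps is nonconstant on sets with an
accumulation point. -/
theorem exists_ne_of_nonconst (hΩ : IsSphereDomain Ω) {G : ℕ → Set Sphere} (hG : ∀ j, Ω ⊆ G j)
    (hf : ∀ j, IsHolomorphicOn (f j) (G j)) (hfin : ∀ j, ∀ z ∈ G j, f j z ≠ OnePoint.infty)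
    (hlim : TendstoLocallyUniformlyOn (fun j z => toComplex (f j z)) g atTop Ω)
    (hg : ∃ z ∈ Ω, ∃ w ∈ Ω, g z ≠ g w) {J : Set Sphere} (hJ : IsCompact J) (hJi : J.Infinite)
    (hJΩ : J ⊆ Ω) : ∃ z ∈ J, ∃ w ∈ J, g z ≠ g w := by
  by_contra! hcon
  obtain ⟨x, hxJ, hx⟩ := hJi.exists_accPt_of_subset_isCompact hJ subset_rfl
  have key : ∀ y ∈ Ω, (∃ᶠ z in 𝓝[≠] y, g z = g x) → ∀ᶠ z in 𝓝 y, g z = g x := by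
    intro y hy hfr
    induction y using OnePoint.rec with
    | coe z =>
      refine eventually_eq_of_frequently_eq (ψ := fun z : ℂ => (z : Sphere)) (ξ := toComplex)
        hΩ.1 hlim OnePoint.continuous_coe ?_ ?_
        (fun j z hz => differentiableAt_of_isHolomorphicOn (hf j) (hfin j) (hG j hz)) hy hfr
      · rw [toComplex_coe, OnePoint.nhds_coe_eq, tendsto_map'_iff]
        exact tendsto_id
      · rw [OnePoint.nhds_coe_eq, eventually_map]
        exact Eventually.of_forall fun z => rfl
    | infty =>
      refine eventually_eq_of_frequently_eq (ψ := paramAt OnePoint.infty)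
        (ξ := coordAt OnePoint.infty) hΩ.1 hlim continuous_paramAt_infty ?_
        eventually_paramAt_coordAt_infty
        (fun j z hz => differentiableAt_of_isHolomorphicOn_infty (hf j) (hfin j) (hG j hz)) hy hfr
      rw [coordAt_infty, toComplex_infty, inv_zero]
      exact tendsto_coordAt_infty
  have hfx : ∃ᶠ z in 𝓝[≠] x, g z = g x := by
    rw [accPt_iff_frequently_nhdsNE] at hx
    exact hx.mono fun z hz => hcon z hz x hxJ
  set S : Set Sphere := {y | ∀ᶠ z in 𝓝 y, g z = g x}
  have hSo : IsOpen S := isOpen_setOfPred_eventually_nhds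
  have hsub : Ω ⊆ S := by
    -- The open set where the limit is locally equal to the constant is also closed relative to `Ω`:
    -- at a limit point the value is taken frequently in punctured neighborhoods.
    refine hΩ.2.isPreconnected.subset_of_closure_inter_subset hSo
      ⟨x, hJΩ hxJ, key x (hJΩ hxJ) hfx⟩ ?_
    rintro y ⟨hyS, hy⟩
    by_contra hyn
    refine hyn (key y hy ?_)
    rw [frequently_nhdsWithin_iff]
    refine (mem_closure_iff_frequently.1 hyS).mono fun z hz => ⟨hz.self_of_nhds, ?_⟩
    rintro rfl
    exact hyn hz
  obtain ⟨z, hz, w, hw, hne⟩ := hg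
  have h1 : g z = g x := (show ∀ᶠ z in 𝓝 z, g z = g x from hsub hz).self_of_nhds
  have h2 : g w = g x := (show ∀ᶠ z in 𝓝 w, g z = g x from hsub hw).self_of_nhds
  exact hne (h1.trans h2.symm)

end Identity

/-! ### Elementary properties of Jordan curves -/

theorem isPreconnected_of_isJordanCurve {J : Set Sphere} (h : IsJordanCurve J) :
    IsPreconnected J := by
  obtain ⟨c, hc, -, rfl⟩ := h
  have : IsPreconnected (univ : Set Circle) := by
    have h1 : range Circle.exp = univ := by
      rw [range_eq_univ]
      exact fun z => ⟨_, Circle.exp_arg z⟩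
    rw [← h1]
    exact isPreconnected_range Circle.exp.continuous
  rw [← image_univ]
  exact this.image _ hc.continuousOn

theorem isCompact_of_isJordanCurve {J : Set Sphere} (h : IsJordanCurve J) : IsCompact J := by
  obtain ⟨c, hc, -, rfl⟩ := h
  exact isCompact_range hc

theorem infinite_of_isJordanCurve {J : Set Sphere} (h : IsJordanCurve J) : J.Infinite := by
  refine (isPreconnected_of_isJordanCurve h).infinite_of_nontrivial ?_
  obtain ⟨c, hc, hinj, rfl⟩ := h
  refine ⟨c 1, mem_range_self _, c (-1), mem_range_self _, fun e => ?_⟩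
  have h1 := congrArg (fun z : Circle => (z : ℂ)) (hinj e)
  norm_num at h1

/-! ### Disks near a point component -/

section Limit

variable {Ω : Set Sphere} {g : Sphere → ℂ}

/-- `G` is open and consists of one-point classes, so its image in the quotient is open; the
homeomorphism carries this to `G'`. -/
theorem isOpen_of_hat {G G' : Set Sphere} {f : Sphere → Sphere} (hG : IsOpen G)
    {F : Hat G ≃ₜ Hat G'} (hF : IsHatExtension f G G' F) (hf : SurjOn f G G')
    (hm : MapsTo f G G') : IsOpen G' := by
  have h1 : IsOpen (proj G '' G) := by
    rw [← isQuotientMap_proj.isOpen_preimage]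
    convert hG using 1
    ext z
    exact ⟨fun ⟨w, hw, h⟩ => mem_of_proj_eq h hw, fun h => ⟨z, h, rfl⟩⟩
  convert (F.isOpenMap _ h1).preimage (continuous_proj (G := G')) using 1
  ext w
  constructor
  · intro hw
    obtain ⟨z, hz, rfl⟩ := hf hw
    exact ⟨_, ⟨z, hz, rfl⟩, hF z hz⟩
  · rintro ⟨_, ⟨z, hz, rfl⟩, h⟩
    rw [hF z hz] at h
    exact mem_of_proj_eq h (hm hz)

/-- Neighborhoods of a complementary component whose images in the approximating domains are
small. -/
theorem exists_small_transport (hΩ : IsSphereDomain Ω) {F : Hat Ω ≃ₜ Hat (inSphere (g '' Ω))}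
    (hF : IsHatExtension (fun z => (g z : Sphere)) Ω (inSphere (g '' Ω)) F)
    {w : ℂ} (hwD : (w : Sphere) ∉ inSphere (g '' Ω))
    (hwc : connectedComponentIn (inSphere (g '' Ω))ᶜ (w : Sphere) = {(w : Sphere)})
    {q : Set Sphere} (hq : ∀ z ∈ q, F (proj Ω z) = proj (inSphere (g '' Ω)) (w : Sphere))
    {G D : ℕ → Set Sphere} {f : ℕ → Sphere → Sphere} (hG : ∀ j, Ω ⊆ G j)
    (F' : ∀ j, Hat (G j) ≃ₜ Hat (D j)) (hF' : ∀ j, IsHatExtension (f j) (G j) (D j) (F' j))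
    (hm : ∀ j, MapsTo (f j) (G j) (D j)) (hfin : ∀ j, ∀ z ∈ G j, f j z ≠ OnePoint.infty)
    (hlim : TendstoLocallyUniformlyOn (fun j z => toComplex (f j z)) g atTop Ω)
    {ε : ℝ} (hε : 0 < ε) :
    ∃ U : Set Sphere, q ⊆ U ∧ ∃ δ > 0, ∀ᶠ j in atTop,
      transport (F' j) U ⊆ inSphere (Metric.ball w ε) ∧
      Disjoint (inSphere (Metric.ball w δ)) (frontier (transport (F' j) U)) := by
  have hmaps : MapsTo (fun z => (g z : Sphere)) Ω (inSphere (g '' Ω)) :=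
    fun z hz => ⟨g z, ⟨z, hz, rfl⟩, rfl⟩
  have hsurj : SurjOn (fun z => (g z : Sphere)) Ω (inSphere (g '' Ω)) := by
    rintro _ ⟨_, ⟨z, hz, rfl⟩, rfl⟩
    exact ⟨z, hz, rfl⟩
  have hD' : IsOpen (inSphere (g '' Ω)) := isOpen_of_hat hΩ.1 hF hsurj hmaps
  obtain ⟨z₀, hz₀⟩ := hΩ.2.nonempty
  have hz₀w : 0 < ‖g z₀ - w‖ := by
    rw [norm_pos_iff, sub_ne_zero]
    rintro h
    exact hwD (h ▸ hmaps hz₀)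
  -- The factor `2` leaves room for the approximation error. The factor `3` keeps `f j z₀` outside
  -- the ball of radius `2 * ε'` for large `j`.
  obtain ⟨ε', hε', h1, h2⟩ : ∃ ε' > 0, 2 * ε' ≤ ε ∧ 3 * ε' ≤ ‖g z₀ - w‖ :=
    ⟨min (ε / 2) (‖g z₀ - w‖ / 3), by positivity,
      by linarith [min_le_left (ε / 2) (‖g z₀ - w‖ / 3)],
      by linarith [min_le_right (ε / 2) (‖g z₀ - w‖ / 3)]⟩
  have hp : {(w : Sphere)} ∈ complComps (inSphere (g '' Ω)) := ⟨w, hwD, hwc.symm⟩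
  obtain ⟨V, hVo, hwV, hVε, hfV⟩ := exists_nhd_comp hD' hp
    (isOpen_inSphere (Metric.isOpen_ball (x := w) (ε := ε')))
    (singleton_subset_iff.2 ⟨w, Metric.mem_ball_self hε', rfl⟩)
  rw [singleton_subset_iff] at hwV
  have hVcl : closure V ⊆ inSphere (Metric.closedBall w ε') :=
    closure_minimal (hVε.trans (image_mono Metric.ball_subset_closedBall))
      (isCompact_inSphere (isCompact_closedBall w ε')).isClosed
  obtain ⟨δ₀, hδ₀, hδV⟩ := Metric.isOpen_iff.1 (isOpen_finitePart hVo) w hwV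
  obtain ⟨δ, hδ, hδδ⟩ : ∃ δ > 0, 2 * δ ≤ δ₀ := ⟨δ₀ / 2, by positivity, by linarith⟩
  -- The frontier of `U` is a compact subset of `Ω`, so the maps converge uniformly on it. Its image
  -- under `g` lies between distances `2 * δ` and `ε'` from `w`.
  set U := transport F.symm V
  have hUo : IsOpen U := isOpen_transport F.symm hVo hfV
  have hfr : ∀ z ∈ frontier U, z ∈ Ω ∧ ((g z : ℂ) : Sphere) ∈ frontier V := by
    intro z hz
    obtain ⟨v, hv, h⟩ := frontier_transport F.symm hVo hfV hz
    obtain ⟨y, hy, rfl⟩ := hsurj (hfV hv)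
    rw [F.symm_apply_eq, ← hF y hy] at h
    have := (proj_eq_iff_of_mem hy).1 (F.injective h)
    subst this
    exact ⟨hy, hv⟩
  have hfU : frontier U ⊆ Ω := fun z hz => (hfr z hz).1
  have hz₀U : z₀ ∉ U := by
    rintro ⟨v, hv, h⟩
    rw [F.symm_apply_eq, hF z₀ hz₀] at h
    have h3 : (g z₀ : Sphere) = v := (proj_eq_iff_of_mem (hmaps hz₀)).1 h.symm
    rw [← h3] at hv
    have := coe_mem_inSphere.1 (hVε hv)
    rw [Metric.mem_ball, dist_eq_norm] at this
    linarith
  have hbd : ∀ z ∈ frontier U, 2 * δ ≤ ‖g z - w‖ ∧ ‖g z - w‖ ≤ ε' := by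
    intro z hz
    have hgz := (hfr z hz).2
    constructor
    · by_contra! h
      rw [hVo.frontier_eq] at hgz
      refine hgz.2 (hδV ?_)
      rw [Metric.mem_ball, dist_eq_norm]
      linarith
    · have := coe_mem_inSphere.1 (hVcl (frontier_subset_closure hgz))
      rwa [Metric.mem_closedBall, dist_eq_norm] at this
  have hunif : TendstoUniformlyOn (fun j z => toComplex (f j z)) g atTop (frontier U) :=
    (tendstoLocallyUniformlyOn_iff_forall_isCompact hΩ.1).1 hlim _ hfU isClosed_frontier.isCompact
  have hη : 0 < min δ ε' := lt_min hδ hε'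
  have hpt := Metric.tendsto_nhds.1 (hlim.tendsto_at hz₀) ε' hε'
  refine ⟨U, fun z hz => ⟨w, hwV, (F.symm_apply_eq.2 (hq z hz).symm)⟩, δ, hδ, ?_⟩
  filter_upwards [Metric.tendstoUniformlyOn_iff.1 hunif _ hη, hpt] with j hj hj₀
  have hfG : frontier U ⊆ G j := hfU.trans (hG j)
  have hfr' : ∀ y ∈ frontier (transport (F' j) U), ∃ v : ℂ, (v : Sphere) = y ∧ δ < ‖v - w‖ ∧
      ‖v - w‖ < 2 * ε' := by
    intro y hy
    have := frontier_transport (F' j) hUo hfG hy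
    rw [transport_of_subset (hF' j) (hm j) hfG] at this
    obtain ⟨z, hz, rfl⟩ := this
    refine ⟨toComplex (f j z), coe_toComplex (hfin j z (hfG hz)), ?_⟩
    have h3 := hj z hz
    rw [dist_eq_norm] at h3
    obtain ⟨h4, h5⟩ := hbd z hz
    have h6 := norm_sub_norm_le (g z - w) (toComplex (f j z) - w)
    have h7 := norm_sub_norm_le (toComplex (f j z) - w) (g z - w)
    rw [sub_sub_sub_cancel_right] at h6 h7
    rw [norm_sub_rev (toComplex (f j z)) (g z)] at h7
    have := min_le_left δ ε'
    have := min_le_right δ ε'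
    constructor <;> linarith
  constructor
  · have hC : Disjoint (inSphere (Metric.ball w (2 * ε')))ᶜ (frontier (transport (F' j) U)) := by
      rw [disjoint_left]
      intro y hy hyf
      obtain ⟨v, rfl, -, h⟩ := hfr' y hyf
      exact hy ⟨v, by rwa [Metric.mem_ball, dist_eq_norm], rfl⟩
    intro y hy
    have : y ∈ inSphere (Metric.ball w (2 * ε')) := by
      by_contra hyn
      -- The exterior of the ball is connected and misses the frontier, so it would lie entirely in
      -- the transported set. But it contains the image of `z₀`, which is not in `U`.
      have hsub := (isPreconnected_compl_inSphere_ball w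
        (by positivity)).subset_of_disjoint_frontier hC ⟨y, hyn, hy⟩
      have h3 : f j z₀ ∈ (inSphere (Metric.ball w (2 * ε')))ᶜ := by
        intro h
        have h4 := toComplex_mem h
        rw [Metric.mem_ball, dist_eq_norm] at h4
        rw [dist_eq_norm, norm_sub_rev] at hj₀
        have := norm_sub_le_norm_sub_add_norm_sub (g z₀) (toComplex (f j z₀)) w
        linarith
      exact hz₀U (mem_of_mem_transport (F' j) hfG (hF' j z₀ (hG j hz₀)) (hsub h3))
    exact image_mono (Metric.ball_subset_ball h1) this
  · rw [disjoint_left]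
    rintro _ ⟨v, hv, rfl⟩ hvf
    obtain ⟨v', h, h3, -⟩ := hfr' _ hvf
    have h4 : v' = v := OnePoint.coe_injective h
    rw [Metric.mem_ball, dist_eq_norm] at hv
    rw [h4] at h3
    linarith

/-- All complementary components of the approximating images that come close to `w` are small. -/
theorem exists_small_classes (hΩ : IsSphereDomain Ω) {F : Hat Ω ≃ₜ Hat (inSphere (g '' Ω))}
    (hF : IsHatExtension (fun z => (g z : Sphere)) Ω (inSphere (g '' Ω)) F)
    {w : ℂ} (hwD : (w : Sphere) ∉ inSphere (g '' Ω))
    (hwc : connectedComponentIn (inSphere (g '' Ω))ᶜ (w : Sphere) = {(w : Sphere)})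
    {q : Set Sphere} (hqn : q.Nonempty)
    (hq : ∀ z ∈ q, F (proj Ω z) = proj (inSphere (g '' Ω)) (w : Sphere))
    {G D : ℕ → Set Sphere} {f : ℕ → Sphere → Sphere} (hG : ∀ j, Ω ⊆ G j)
    (F' : ∀ j, Hat (G j) ≃ₜ Hat (D j)) (hF' : ∀ j, IsHatExtension (f j) (G j) (D j) (F' j))
    (hm : ∀ j, MapsTo (f j) (G j) (D j)) (hfin : ∀ j, ∀ z ∈ G j, f j z ≠ OnePoint.infty)
    (hlim : TendstoLocallyUniformlyOn (fun j z => toComplex (f j z)) g atTop Ω)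
    {ε : ℝ} (hε : 0 < ε) :
    ∃ δ > 0, ∀ᶠ j in atTop, transport (F' j) q ⊆ inSphere (Metric.ball w ε) ∧
      ∀ y y' : Sphere, y ∈ inSphere (Metric.ball w δ) → proj (D j) y = proj (D j) y' →
        y' ∈ inSphere (Metric.ball w ε) := by
  obtain ⟨U, hqU, δ, hδ, h⟩ := exists_small_transport hΩ hF hwD hwc hq hG F' hF' hm hfin hlim hε
  obtain ⟨U', hqU', δ', hδ', h'⟩ :=
    exists_small_transport hΩ hF hwD hwc hq hG F' hF' hm hfin hlim hδ
  refine ⟨δ, hδ, ?_⟩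
  filter_upwards [h, h'] with j hj hj'
  refine ⟨(transport_mono _ hqU).trans hj.1, fun y y' hy hyy => hj.1 ?_⟩
  obtain ⟨v, hv⟩ := transport_nonempty (F' j) hqn
  -- The second neighborhood is chosen at scale `δ`: it puts a point of the image of `q` into the
  -- ball of radius `δ`. This ball misses the frontier of the transported `U`, hence lies inside it,
  -- and so do all classes that meet the ball.
  have hsub : inSphere (Metric.ball w δ) ⊆ transport (F' j) U :=
    (isPreconnected_inSphere (convex_ball w δ).isPreconnected).subset_of_disjoint_frontier hj.2
      ⟨v, hj'.1 (transport_mono _ hqU' hv), transport_mono _ hqU hv⟩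
  obtain ⟨z, hz, e⟩ := hsub hy
  exact ⟨z, hz, e.trans hyy⟩

end Limit

/-! ### Lower bounds for separating paths -/

/-- The square divides the sphere into its open inside, containing the image of `P`, and its
outside, containing the image of `J`. By `separation`, no connected set in the quotient joins the
two without meeting the loop. -/
theorem mem_separatingPaths {G G' : Set Sphere} {f : Sphere → Sphere} {F : Hat G ≃ₜ Hat G'}
    (hG' : IsOpen G') (hF : IsHatExtension f G G' F) (hm : MapsTo f G G') {P J : Set Sphere}
    (hJ : J ⊆ G) {w : ℂ} {t : ℝ} (hP : transport F P ⊆ inSphere {z | supDist w z < t})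
    (hJt : ∀ z ∈ J, f z ∉ inSphere {z | supDist w z ≤ t}) {η : C(I, Hat G')}
    (hη : range η = proj G' '' inSphere {z | supDist w z = t}) :
    η ∈ hatFamily f G G' (separatingPaths G P J) := by
  refine mem_hatFamily_iff_symm hF ?_
  set γ : C(I, Hat G) := ⟨fun t => F.symm (η t), F.symm.continuous.comp η.continuous⟩
  have hγP : ∀ s, γ s ∉ proj G '' P := by
    rintro s ⟨z, hz, h⟩
    have h1 : η s ∈ proj G' '' inSphere {z | supDist w z = t} := hη ▸ mem_range_self s
    obtain ⟨_, ⟨y, hy, rfl⟩, hys⟩ := h1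
    have h2 : F (proj G z) = η s := by rw [h]; exact F.apply_symm_apply _
    have h3 : ((y : ℂ) : Sphere) ∈ transport F P := ⟨z, hz, h2.trans hys.symm⟩
    exact (ne_of_lt (show supDist w y < t from coe_mem_inSphere.1 (hP h3))) hy
  have hγJ : ∀ s, γ s ∉ proj G '' J := by
    rintro s ⟨z, hz, h⟩
    have h1 : η s ∈ proj G' '' inSphere {z | supDist w z = t} := hη ▸ mem_range_self s
    obtain ⟨_, ⟨y, hy, rfl⟩, hys⟩ := h1
    have h2 : F (proj G z) = η s := by rw [h]; exact F.apply_symm_apply _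
    rw [hF z (hJ hz), ← hys] at h2
    have h3 := (proj_eq_iff_of_mem (hm (hJ hz))).1 h2
    exact hJt z hz (h3 ▸ ⟨y, (show supDist w y = t from hy).le, rfl⟩)
  refine ⟨hγP, hγJ, ?_⟩
  rintro _ ⟨z, hz, rfl⟩ _ ⟨y, hy, rfl⟩ heq
  have hzγ : proj G z ∈ (range γ)ᶜ := fun ⟨s, hs⟩ => hγJ s ⟨z, hz, hs.symm⟩
  have hyγ : proj G y ∈ (range γ)ᶜ := fun ⟨s, hs⟩ => hγP s ⟨y, hy, hs.symm⟩
  set C := connectedComponentIn (range γ)ᶜ (proj G z)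
  have hzC : proj G z ∈ C := mem_connectedComponentIn hzγ
  have hyC : proj G y ∈ C := heq ▸ mem_connectedComponentIn hyγ
  have hK : IsPreconnected (F '' C) :=
    isPreconnected_connectedComponentIn.image _ F.continuous.continuousOn
  obtain ⟨v, hv⟩ := proj_surjective (F (proj G y))
  have hbdd : ∀ A : Set ℂ, IsClosed A → A ⊆ {z | supDist w z ≤ t} → IsClosed (inSphere A) := by
    intro A hA hAt
    refine (isCompact_inSphere (Metric.isCompact_of_isClosed_isBounded hA ?_)).isClosed
    refine (Metric.isBounded_closedBall (x := w) (r := 2 * t)).subset fun z hz => ?_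
    have : supDist w z ≤ t := hAt hz
    rw [Metric.mem_closedBall, dist_eq_norm]
    linarith [norm_le_two_mul_supDist w z]
  have oA : IsOpen (inSphere {z | supDist w z < t}) :=
    isOpen_inSphere (isOpen_lt (continuous_supDist w) continuous_const)
  have oB : IsOpen (inSphere {z | supDist w z ≤ t})ᶜ :=
    (hbdd _ (isClosed_le (continuous_supDist w) continuous_const) subset_rfl).isOpen_compl
  have cZ : IsClosed (inSphere {z | supDist w z = t}) :=
    hbdd _ (isClosed_eq (continuous_supDist w) continuous_const) fun z hz => le_of_eq hz
  refine separation hG' oA oB ?_ ?_ cZ hK ?_ (hP ⟨y, hy, hv.symm⟩) (hJt z hz)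
    (by rw [hv]; exact ⟨_, hyC, rfl⟩) (by rw [← hF z (hJ hz)]; exact ⟨_, hzC, rfl⟩)
  · rw [disjoint_left]
    rintro _ ⟨z, hz, rfl⟩ h
    exact h ⟨z, (show supDist w z < t from hz).le, rfl⟩
  · intro y hy
    rw [compl_union, compl_compl] at hy
    obtain ⟨h1, v, hv, rfl⟩ := hy
    refine ⟨v, ?_, rfl⟩
    by_contra h
    exact h1 ⟨v, lt_of_le_of_ne hv h, rfl⟩
  · rintro y hy ⟨c, hc, h⟩
    have h1 : proj G' y ∈ range η := hη ▸ ⟨y, hy, rfl⟩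
    obtain ⟨s, hs⟩ := h1
    refine connectedComponentIn_subset _ _ hc ⟨s, ?_⟩
    change F.symm (η s) = c
    rw [hs, ← h, F.symm_apply_apply]

/-- Many disjoint square annuli such that no disk meets two of them give a large modulus. -/
theorem modulus_separating_ge {G G' : Set Sphere} {f : Sphere → Sphere} {F : Hat G ≃ₜ Hat G'}
    (hF : IsHatExtension f G G' F) (hm : MapsTo f G G') {n : ℕ} {x : ℕ → Hat G'}
    (hx : IsCircleConfig G' n x) {P J : Set Sphere} (hJ : J ⊆ G) {w : ℂ} {r : ℕ → ℝ}
    (hr : ∀ i, 0 < r i) (hr4 : ∀ i, r (i + 1) ≤ r i / 4)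
    (hb : Metric.ball w (4 * r 0) ⊆ Metric.ball 0 1) {m : ℕ}
    (hP : transport F P ⊆ inSphere (Metric.ball w (r m)))
    (hJr : ∀ z ∈ J, f z ∉ inSphere (Metric.ball w (4 * r 0)))
    (hcl : ∀ i < m, ∀ y y' : Sphere, y ∈ inSphere (Metric.ball w (4 * r (i + 1))) →
      proj G' y = proj G' y' → y' ∈ inSphere (Metric.ball w (r i))) :
    m * ENNReal.ofReal (1 / 5000) ≤ modulus (hatFamily f G G' (separatingPaths G P J)) := by
  classical
  refine le_modulus fun ρ hρ => ?_
  have hanti : Antitone r := antitone_nat_of_succ_le fun i => by linarith [hr4 i, hr i]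
  let S : ℕ → Set ℂ := fun i => {z | supDist w z ∈ Ioo (r i) (2 * r i)}
  let T : ℕ → Finset ℕ := fun i => (Finset.Icc 1 n).filter
    fun l => ∃ z : ℂ, proj G' (z : ℂ) = x l ∧ z ∈ S i
  have hS4 : ∀ {i t : ℝ} {z : ℂ}, supDist w z < 2 * t → z ∈ Metric.ball w (4 * t) := by
    intro _ t z hz
    rw [Metric.mem_ball, dist_eq_norm]
    linarith [norm_le_two_mul_supDist w z]
  have hstep : ∀ i < m, ENNReal.ofReal (1 / 5000) ≤
      (∫⁻ z in S i, planarDensity ρ z ^ 2) + ∑ l ∈ T i, ρ (x l) ^ 2 := by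
    intro i hi
    refine hx.mass_ge_of_annulus hρ.1 w (hr i) ?_ (Finset.filter_subset _ _) ?_ ?_
    · intro z hz
      exact hb (Metric.ball_subset_ball (by linarith [hanti (Nat.zero_le i)])
        (hS4 (i := 0) (show supDist w z ∈ Ioo (r i) (2 * r i) from hz).2))
    · intro l hl1 hl2 z hz hzS
      exact Finset.mem_filter.2 ⟨Finset.mem_Icc.2 ⟨hl1, hl2⟩, z, hz, hzS⟩
    · intro t ht γ hγ
      refine hρ.2 γ (mem_separatingPaths hx.isOpen hF hm hJ ?_ ?_ hγ)
      · refine hP.trans (image_mono fun z hz => ?_)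
        rw [Metric.mem_ball, dist_eq_norm] at hz
        exact ((supDist_le_norm w z).trans_lt hz).trans_le ((hanti hi.le).trans ht.1.le)
      · intro z hz h
        refine hJr z hz (image_mono (fun y hy => ?_) h)
        have hy' : supDist w y ≤ t := hy
        exact Metric.ball_subset_ball (by linarith [hanti (Nat.zero_le i)])
          (hS4 (i := 0) (hy'.trans_lt ht.2))
  have hSd : ∀ i i', i < i' → Disjoint (S i) (S i') := by
    intro i i' hii
    rw [disjoint_left]
    intro z hz hz'
    have h1 : supDist w z ∈ Ioo (r i) (2 * r i) := hz
    have h2 : supDist w z ∈ Ioo (r i') (2 * r i') := hz'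
    linarith [h1.1, h2.2, hanti (Nat.succ_le_of_lt hii), hr4 i, hr i]
  -- A disk that meets the inner annulus lies within distance `r e ≤ r i` of `w`, where `i' = e +
  -- 1`, so it cannot reach the annulus with index `i`.
  have hTd : ∀ i i', i < i' → i' < m → Disjoint (T i) (T i') := by
    intro i i' hii him
    rw [Finset.disjoint_left]
    intro l hl hl'
    obtain ⟨-, z, hz, hzS⟩ := Finset.mem_filter.1 hl
    obtain ⟨-, y, hy, hyS⟩ := Finset.mem_filter.1 hl'
    obtain ⟨e, rfl⟩ : ∃ e, i' = e + 1 := ⟨i' - 1, by omega⟩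
    have h1 := hcl e (by omega) y z ⟨y, hS4 (i := 0)
      (show supDist w y ∈ Ioo (r (e + 1)) (2 * r (e + 1)) from hyS).2, rfl⟩ (hy.trans hz.symm)
    have h2 := coe_mem_inSphere.1 h1
    rw [Metric.mem_ball, dist_eq_norm] at h2
    have h3 : r i < supDist w z := (show supDist w z ∈ Ioo (r i) (2 * r i) from hzS).1
    linarith [supDist_le_norm w z, hanti (Nat.le_of_lt_succ hii)]
  calc m * ENNReal.ofReal (1 / 5000)
      = ∑ i ∈ Finset.range m, ENNReal.ofReal (1 / 5000) := by
        rw [Finset.sum_const, Finset.card_range, nsmul_eq_mul]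
    _ ≤ ∑ i ∈ Finset.range m,
        ((∫⁻ z in S i, planarDensity ρ z ^ 2) + ∑ l ∈ T i, ρ (x l) ^ 2) :=
        Finset.sum_le_sum fun i hi => hstep i (Finset.mem_range.1 hi)
    _ = (∫⁻ z in ⋃ i ∈ Finset.range m, S i, planarDensity ρ z ^ 2) +
        ∑ l ∈ (Finset.range m).biUnion T, ρ (x l) ^ 2 := by
        rw [Finset.sum_add_distrib, lintegral_biUnion_finset, Finset.sum_biUnion]
        · intro i hi i' hi' hne
          rw [Finset.mem_coe, Finset.mem_range] at hi hi'
          rcases lt_or_gt_of_ne hne with h | h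
          · exact hTd i i' h hi'
          · exact (hTd i' i h hi).symm
        · intro i _ i' _ hne
          rcases lt_or_gt_of_ne hne with h | h
          · exact hSd i i' h
          · exact (hSd i' i h).symm
        · exact fun i _ => (continuous_supDist w).measurable measurableSet_Ioo
    _ ≤ (∫⁻ z, planarDensity ρ z ^ 2) + ∑ l ∈ Finset.range (n + 1), ρ (x l) ^ 2 := by
        refine add_le_add (setLIntegral_le_lintegral _ _) (Finset.sum_le_sum_of_subset ?_)
        intro l hl
        obtain ⟨i, -, hi⟩ := Finset.mem_biUnion.1 hl
        have := (Finset.mem_Icc.1 (Finset.mem_filter.1 hi).1).2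
        exact Finset.mem_range.2 (by omega)
    _ ≤ mass ρ := hx.le_mass

/-! ### The two types of complementary components -/

/-- Since `∞ ∈ Ω`, a component whose finite part has zero diameter is a single finite point. It is
never removed, so it becomes an ordinary point of the approximating domains. -/
theorem exists_eq_or_eq_singleton {Ω : Set Sphere} (hΩ : OnePoint.infty ∈ Ω) {p : ℕ → Set Sphere}
    (hp : range p = nontrivialComps Ω) {q : Set Sphere} (hq : q ∈ complComps Ω) :
    (∃ l, q = p l) ∨ ∃ a, q = {a} ∧ ∀ l, a ∉ p l := by
  by_cases h : 0 < Metric.ediam (finitePart q)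
  · left
    have : q ∈ range p := hp ▸ ⟨hq, h⟩
    obtain ⟨l, hl⟩ := this
    exact ⟨l, hl.symm⟩
  · right
    have hsub : (finitePart q).Subsingleton :=
      Metric.ediam_eq_zero_iff.1 (not_lt.1 h |>.antisymm bot_le)
    obtain ⟨a, ha⟩ := complComps_nonempty hq
    have hfin : ∀ z ∈ q, ((toComplex z : ℂ) : Sphere) = z := fun z hz =>
      coe_toComplex fun e => complComps_subset hq hz (e ▸ hΩ)
    refine ⟨a, Subset.antisymm (fun z hz => ?_) (singleton_subset_iff.2 ha), fun l hl => h ?_⟩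
    · rw [mem_singleton_iff, ← hfin z hz, ← hfin a ha]
      congr 1
      refine hsub ?_ ?_
      · rwa [← hfin z hz] at hz
      · rwa [← hfin a ha] at ha
    · have hpl : p l ∈ nontrivialComps Ω := hp ▸ mem_range_self l
      rw [(eq_connectedComponentIn hq ha).trans (eq_connectedComponentIn hpl.1 hl).symm]
      exact hpl.2

/-- The class of a complementary component of `Ω` in an approximating domain. -/
theorem class_of_component {Ω : Set Sphere} (hΩ : OnePoint.infty ∈ Ω) {p : ℕ → Set Sphere}
    (hp : range p = nontrivialComps Ω) {G' : Set Sphere} {f : Sphere → Sphere} {n : ℕ}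
    (hf : BijOn f (approxDomain p n) G') {F : Hat (approxDomain p n) ≃ₜ Hat G'}
    (hF : IsHatExtension f (approxDomain p n) G' F) {x : ℕ → Hat G'} (hx : IsCircleConfig G' n x)
    (hFx : ∀ l ≤ n, ∀ z ∈ p l, F (proj _ z) = x l)
    (hxp : ∀ l ≤ n, ∀ w, proj G' w = x l ↔ w ∈ hatImage f (approxDomain p n) G' (p l))
    {q : Set Sphere} (hq : q ∈ complComps Ω) (hqn : ∀ l, q = p l → l ≤ n)
    {a : Sphere} (ha : a ∈ q) :
    (∀ z, proj (approxDomain p n) z = proj (approxDomain p n) a ↔ z ∈ q) ∧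
    {z : ℂ | proj G' (z : ℂ) = F (proj _ a)} =
      finitePart (hatImage f (approxDomain p n) G' q) ∧
    (F (proj _ a) = x 0 ∨
      (F (proj _ a) ≠ x 0 ∧ Convex ℝ {z : ℂ | proj G' (z : ℂ) = F (proj _ a)})) := by
  have hpc : ∀ l, p l ∈ complComps Ω := fun l => (hp ▸ mem_range_self l : p l ∈ nontrivialComps Ω).1
  rcases exists_eq_or_eq_singleton hΩ hp hq with ⟨l, rfl⟩ | ⟨a', rfl, ha'⟩
  · have hl : l ≤ n := hqn l rfl
    rw [hFx l hl a ha]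
    refine ⟨fun z => proj_eq_iff_of_mem_comp (mem_complComps_approxDomain hpc hl) ha, ?_, ?_⟩
    · ext z
      exact hxp l hl z
    · rcases Nat.eq_zero_or_pos l with rfl | hl0
      · exact Or.inl rfl
      · refine Or.inr ⟨fun h => hl0.ne' (hx.inj l hl 0 (Nat.zero_le _) h), ?_⟩
        obtain ⟨c, r, -, h⟩ := hx.fiber l hl0 hl
        have : {z : ℂ | proj G' (z : Sphere) = x l} = Metric.closedBall c r :=
          Set.ext fun z => (h z).trans coe_mem_inSphere
        rw [this]
        exact convex_closedBall c r
  · obtain rfl : a = a' := ha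
    have haG : a ∈ approxDomain p n := by
      by_contra h
      obtain ⟨l, -, hl⟩ := mem_compl_approxDomain.1 h
      exact ha' l hl
    have hfa := hf.mapsTo haG
    refine ⟨fun z => ?_, ?_, Or.inr ⟨?_, ?_⟩⟩
    · rw [eq_comm, proj_eq_iff_of_mem haG, mem_singleton_iff, eq_comm]
    · ext z
      constructor
      · exact fun h => ⟨F, hF, a, rfl, (show proj G' (z : Sphere) = _ from h).symm⟩
      · rintro ⟨F₂, hF₂, _, rfl, h⟩
        change proj G' (z : Sphere) = _
        rw [mem_of_hat hF₂ hf haG h, hF _ haG]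
    · intro h
      rw [hF a haG] at h
      have : proj G' (f a) ∈ compPoints G' := by
        rw [hx.comp]
        exact ⟨0, Nat.zero_le _, h.symm⟩
      exact proj_mem_compPoints.1 this hfa
    · refine Subsingleton.convex fun z hz y hy => ?_
      rw [mem_ofPred_eq, hF a haG, eq_comm, proj_eq_iff_of_mem hfa] at hz hy
      exact OnePoint.coe_injective (hz.symm.trans hy)

/-- Each class has a point of the closed unit disk. -/
theorem IsCircleConfig.exists_norm_le_one {G : Set Sphere} {n : ℕ} {x : ℕ → Hat G}
    (hx : IsCircleConfig G n x) (y : Hat G) : ∃ z : ℂ, ‖z‖ ≤ 1 ∧ proj G (z : Sphere) = y := by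
  by_cases h : y = x 0
  · refine ⟨1, by simp, ?_⟩
    rw [h, hx.fiber_zero]
    exact fun h => by simpa using coe_mem_inSphere.1 h
  · obtain ⟨w, rfl⟩ := proj_surjective y
    have : w ∈ inSphere (Metric.ball 0 1) := by
      by_contra hw
      exact h ((hx.fiber_zero w).2 hw)
    obtain ⟨z, hz, rfl⟩ := this
    exact ⟨z, (mem_ball_zero_iff.1 hz).le, rfl⟩

theorem exists_homeomorph_const_mul_sq {κ : ℝ} (hκ : 0 < κ) :
    ∃ φ : ℝ≥0 ≃ₜ ℝ≥0, ∀ t, (φ t : ℝ) = κ * (t : ℝ) ^ 2 := by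
  lift κ to ℝ≥0 using hκ.le
  refine ⟨(NNReal.sqrt.symm.trans (OrderIso.mulLeft₀ κ (NNReal.coe_pos.1 hκ))).toHomeomorph,
    fun t => ?_⟩
  have : NNReal.sqrt.symm t = t ^ 2 := by
    rw [OrderIso.symm_apply_eq, NNReal.sqrt_sq]
  change ((κ * NNReal.sqrt.symm t : ℝ≥0) : ℝ) = _
  rw [this, NNReal.coe_mul, NNReal.coe_pow]

/-- If the closest point of a closed set to `b` is `a ≠ b`, then the half-open segment from `a` to
`b` does not meet the set. -/
theorem lineMap_notMem_of_dist_eq {A : Set ℂ} {a b : ℂ} (hab : a ≠ b)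
    (h : dist b a = Metric.infDist b A) {t : ℝ} (ht : t ∈ Ioc (0 : ℝ) 1) :
    (AffineMap.lineMap a b t : ℂ) ∉ A := by
  intro hA
  have h1 := Metric.infDist_le_dist_of_mem (x := b) hA
  rw [dist_comm b, dist_lineMap_right, Real.norm_of_nonneg (by linarith [ht.2]), ← h,
    dist_comm b] at h1
  nlinarith [dist_pos.2 hab, ht.1]

/-! ### Components whose image is a point -/

section PointComponent

variable {Ω : Set Sphere} {g : Sphere → ℂ}

/-- The extension of the limit map comes from the nonempty hat image, and it also makes the limit
map injective. -/
theorem exists_of_hatImage_eq_singleton (hΩ : IsSphereDomain Ω) (hg : ∀ z ∈ Ω, ‖g z‖ ≤ 1)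
    {q : Set Sphere} (hq : q ∈ complComps Ω) {w' : Sphere}
    (h : hatImage (fun z => (g z : Sphere)) Ω (inSphere (g '' Ω)) q = {w'}) :
    ∃ (F : Hat Ω ≃ₜ Hat (inSphere (g '' Ω))) (w : ℂ),
      IsHatExtension (fun z => (g z : Sphere)) Ω (inSphere (g '' Ω)) F ∧ ‖w‖ < 1 ∧
      (w : Sphere) ∉ inSphere (g '' Ω) ∧
      connectedComponentIn (inSphere (g '' Ω))ᶜ (w : Sphere) = {(w : Sphere)} ∧
      ∀ z ∈ q, F (proj Ω z) = proj (inSphere (g '' Ω)) (w : Sphere) := by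
  have hw' : w' ∈ hatImage (fun z => (g z : Sphere)) Ω (inSphere (g '' Ω)) q := h ▸ rfl
  obtain ⟨F, hF, z, hz, hzw⟩ := hw'
  have hmaps : MapsTo (fun z => (g z : Sphere)) Ω (inSphere (g '' Ω)) :=
    fun z hz => ⟨g z, ⟨z, hz, rfl⟩, rfl⟩
  have hsurj : SurjOn (fun z => (g z : Sphere)) Ω (inSphere (g '' Ω)) := by
    rintro _ ⟨_, ⟨z, hz, rfl⟩, rfl⟩
    exact ⟨z, hz, rfl⟩
  have hbij : BijOn (fun z => (g z : Sphere)) Ω (inSphere (g '' Ω)) := by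
    refine ⟨hmaps, fun y hy y' hy' e => ?_, hsurj⟩
    have e' : proj (inSphere (g '' Ω)) (g y : Sphere) = proj _ (g y' : Sphere) := congrArg _ e
    rw [← hF y hy, ← hF y' hy'] at e'
    exact (proj_eq_iff_of_mem hy).1 (F.injective e')
  have hD : IsOpen (inSphere (g '' Ω)) := isOpen_of_hat hΩ.1 hF hsurj hmaps
  have hwD : w' ∉ inSphere (g '' Ω) := notMem_of_hat hF hbij (complComps_subset hq hz) hzw
  -- Any connected set in the complement that contains `w'` lies in the class of `w'`, which is part
  -- of the one-point hat image.
  have hc : ∀ A : Set Sphere, IsPreconnected A → A ⊆ (inSphere (g '' Ω))ᶜ → w' ∈ A → A ⊆ {w'} := by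
    intro A hA hAD hwA v hv
    rw [← h]
    refine ⟨F, hF, z, hz, hzw.trans ?_⟩
    exact proj_eq_iff.2 (Or.inr ⟨_, ⟨w', hwD, rfl⟩, mem_connectedComponentIn hwD,
      hA.subset_connectedComponentIn hwA hAD hv⟩)
  have hball : inSphere (g '' Ω) ⊆ inSphere (Metric.ball 0 1) := by
    refine image_mono ?_
    rw [← interior_closedBall _ one_ne_zero]
    refine interior_maximal ?_ ?_
    · rintro _ ⟨y, hy, rfl⟩
      exact mem_closedBall_zero_iff.2 (hg y hy)
    · convert isOpen_finitePart hD using 1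
      ext y
      exact coe_mem_inSphere.symm
  have hwb : w' ∈ inSphere (Metric.ball 0 1) := by
    by_contra hw
    -- Otherwise the whole exterior of the unit disk would be the single point `w'`, yet it contains
    -- both `1` and `∞`.
    have hsub := hc _ (isPreconnected_compl_inSphere_ball 0 one_pos)
      (compl_subset_compl.2 hball) hw
    have h1 : OnePoint.infty = w' := hsub infty_notMem_inSphere
    have h2 : ((1 : ℂ) : Sphere) = w' := hsub fun h => by simpa using coe_mem_inSphere.1 h
    exact OnePoint.coe_ne_infty _ (h2.trans h1.symm)
  obtain ⟨w, hw, rfl⟩ := hwb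
  refine ⟨F, w, hF, mem_ball_zero_iff.1 hw, hwD, ?_, fun y hy => ?_⟩
  · exact (hc _ isPreconnected_connectedComponentIn (connectedComponentIn_subset _ _)
      (mem_connectedComponentIn hwD)).antisymm
      (singleton_subset_iff.2 (mem_connectedComponentIn hwD))
  · rw [(proj_eq_iff_of_mem_comp hq hz).2 hy, hzw]

/-- If the image of a complementary component is a point, then the moduli of the families of
separating paths tend to infinity. -/
theorem tendsto_modulus_separating (hΩ : IsSphereDomain Ω) (hg : ∀ z ∈ Ω, ‖g z‖ ≤ 1)
    {q : Set Sphere} (hq : q ∈ complComps Ω)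
    (hqw : ∃ w', hatImage (fun z => (g z : Sphere)) Ω (inSphere (g '' Ω)) q = {w'})
    {G D : ℕ → Set Sphere} {f : ℕ → Sphere → Sphere} (hG : ∀ j, Ω ⊆ G j)
    {F' : ∀ j, Hat (G j) ≃ₜ Hat (D j)} (hF' : ∀ j, IsHatExtension (f j) (G j) (D j) (F' j))
    (hm : ∀ j, MapsTo (f j) (G j) (D j)) {n : ℕ → ℕ} {x : ∀ j, ℕ → Hat (D j)}
    (hx : ∀ j, IsCircleConfig (D j) (n j) (x j))
    (hlim : TendstoLocallyUniformlyOn (fun j z => toComplex (f j z)) g atTop Ω)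
    {J : Set Sphere} (hJ : IsCompact J) (hJΩ : J ⊆ Ω) :
    Tendsto (fun j => modulus (hatFamily (f j) (G j) (D j) (separatingPaths (G j) q J))) atTop
      (𝓝 ⊤) := by
  obtain ⟨w', hw'⟩ := hqw
  obtain ⟨F, w, hF, hw1, hwD, hwc, hqF⟩ := exists_of_hatImage_eq_singleton hΩ hg hq hw'
  have hfin : ∀ j, ∀ z ∈ G j, f j z ≠ OnePoint.infty := fun j z hz =>
    ne_infty_of_mem_inSphere ((hx j).mem_ball (hm j) hz)
  have hmaps : MapsTo (fun z => (g z : Sphere)) Ω (inSphere (g '' Ω)) :=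
    fun z hz => ⟨g z, ⟨z, hz, rfl⟩, rfl⟩
  -- Stated for all real `ε`, with a dummy `δ = 1` for `ε ≤ 0`, so that `δ` can be chosen as a
  -- function and iterated.
  have hsm : ∀ ε : ℝ, ∃ δ > 0, 0 < ε → ∀ᶠ j in atTop,
      transport (F' j) q ⊆ inSphere (Metric.ball w ε) ∧
      ∀ y y' : Sphere, y ∈ inSphere (Metric.ball w δ) → proj (D j) y = proj (D j) y' →
        y' ∈ inSphere (Metric.ball w ε) := by
    intro ε
    by_cases hε : 0 < ε
    · obtain ⟨δ, hδ, h⟩ := exists_small_classes hΩ hF hwD hwc (complComps_nonempty hq) hqF hG F' hF'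
        hm hfin hlim hε
      exact ⟨δ, hδ, fun _ => h⟩
    · exact ⟨1, one_pos, fun h => absurd h hε⟩
  choose δ hδ hev using hsm
  obtain ⟨η, hη, hηJ⟩ : ∃ η > 0, ∀ z ∈ J, η ≤ ‖g z - w‖ := by
    have hc : IsClosed (transport F J) := by
      rw [transport_eq_preimage]
      exact (F.isClosedMap _ (isClosedMap_proj hΩ.1 _ hJ.isClosed)).preimage continuous_proj
    rw [transport_of_subset hF hmaps hJΩ] at hc
    have hwJ : w ∈ (finitePart ((fun z => (g z : Sphere)) '' J))ᶜ := by
      rintro ⟨z, hz, h⟩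
      exact hwD (h ▸ hmaps (hJΩ hz))
    obtain ⟨η, hη, h⟩ := Metric.isOpen_iff.1 (isClosed_finitePart hc).isOpen_compl w hwJ
    refine ⟨η, hη, fun z hz => ?_⟩
    by_contra! hlt
    exact h (show g z ∈ Metric.ball w η by rwa [Metric.mem_ball, dist_eq_norm]) ⟨z, hz, rfl⟩
  obtain ⟨r₀, hr₀, hr₀η, hr₀w⟩ : ∃ r₀ > 0, 8 * r₀ ≤ η ∧ 4 * r₀ + ‖w‖ ≤ 1 :=
    ⟨min (η / 8) ((1 - ‖w‖) / 4), lt_min (by positivity) (by linarith),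
      by linarith [min_le_left (η / 8) ((1 - ‖w‖) / 4)],
      by linarith [min_le_right (η / 8) ((1 - ‖w‖) / 4)]⟩
  -- Each radius is small enough that disks meeting the ball of radius `4 * r (i + 1)` stay in the
  -- ball of radius `r i`. The factor `4` covers the annulus with outer sup-norm radius `2 * r (i +
  -- 1)`.
  let r : ℕ → ℝ := fun i => Nat.rec r₀ (fun _ s => min (δ s) s / 4) i
  have hr : ∀ i, 0 < r i := by
    intro i
    induction i with
    | zero => exact hr₀
    | succ i ih => exact div_pos (lt_min (hδ (r i)) ih) (by norm_num)
  have hr4 : ∀ i, r (i + 1) ≤ r i / 4 := fun i =>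
    div_le_div_of_nonneg_right (min_le_right (δ (r i)) (r i)) (by norm_num)
  have hrδ : ∀ i, 4 * r (i + 1) ≤ δ (r i) := by
    intro i
    have h : r (i + 1) = min (δ (r i)) (r i) / 4 := rfl
    linarith [min_le_left (δ (r i)) (r i)]
  have hb : Metric.ball w (4 * r 0) ⊆ Metric.ball 0 1 := by
    refine Metric.ball_subset_ball' ?_
    rw [dist_zero_right]
    exact hr₀w
  have hunif : TendstoUniformlyOn (fun j z => toComplex (f j z)) g atTop J :=
    (tendstoLocallyUniformlyOn_iff_forall_isCompact hΩ.1).1 hlim J hJΩ hJ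
  have hJr : ∀ᶠ j in atTop, ∀ z ∈ J, f j z ∉ inSphere (Metric.ball w (4 * r 0)) := by
    filter_upwards [Metric.tendstoUniformlyOn_iff.1 hunif (η / 2) (by positivity)] with j hj z hz h
    have h1 := hj z hz
    have h2 := toComplex_mem h
    rw [Metric.mem_ball] at h2
    have h3 := dist_triangle (g z) (toComplex (f j z)) w
    have h4 := hηJ z hz
    rw [← dist_eq_norm] at h4
    have h5 : r 0 = r₀ := rfl
    linarith
  have hcl : ∀ m : ℕ, ∀ᶠ j in atTop, ∀ i < m, ∀ y y' : Sphere,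
      y ∈ inSphere (Metric.ball w (4 * r (i + 1))) → proj (D j) y = proj (D j) y' →
        y' ∈ inSphere (Metric.ball w (r i)) := by
    intro m
    have := (Finset.range m).eventually_all.2 fun i _ => hev (r i) (hr i)
    filter_upwards [this] with j hj i hi y y' hy h
    exact (hj i (Finset.mem_range.2 hi)).2 y y' (image_mono (Metric.ball_subset_ball (hrδ i)) hy) h
  refine ENNReal.tendsto_nhds_top fun N => ?_
  -- Each annulus contributes `1 / 5000`, so `5000 * (N + 1)` of them give at least `N + 1`.
  filter_upwards [hJr, hcl (5000 * (N + 1)), hev _ (hr (5000 * (N + 1)))] with j h1 h2 h3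
  refine lt_of_lt_of_le ?_
    (modulus_separating_ge (hF' j) (hm j) (hx j) (hJΩ.trans (hG j)) hr hr4 hb h3.1 h1 h2)
  have : ((5000 * (N + 1) : ℕ) : ℝ≥0∞) * ENNReal.ofReal (1 / 5000) = ((N + 1 : ℕ) : ℝ≥0∞) := by
    rw [← ENNReal.ofReal_natCast, ← ENNReal.ofReal_mul (by positivity), ← ENNReal.ofReal_natCast]
    congr 1
    push_cast
    ring
  rw [this]
  exact_mod_cast Nat.lt_succ_self N

end PointComponent

end Transboundary
end

/-! ### The two modulus estimates -/

theorem proposition3p2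
    -- the domain, and an enumeration of its infinitely many nontrivial complementary components
    (Ω : Set Sphere) (hΩ : IsSphereDomain Ω) (hΩ_infty : OnePoint.infty ∈ Ω)
    (H : ℝ) (hH : 1 ≤ H) (hΩ_tripod : QuasitripodCondition Ω H)
    (N : ℕ) (hN : 1 ≤ N) (hΩ_packing : PackingCondition Ω N)
    (p : ℕ → Set Sphere) (hp_inj : Function.Injective p) (hp_range : range p = nontrivialComps Ω)
    (hΩ_eq : Ω = (closure (⋃ l, p l))ᶜ)
    -- conformal maps of the approximating domains onto finitely connected circle domains
    (k : ℕ → ℕ) (hk : StrictMono k)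
    (D : ℕ → Set Sphere) (hD : ∀ j, IsSphereDomain (D j))
    (f : ℕ → Sphere → Sphere)
    (hf : ∀ j, IsConformalHomeo (f j) (approxDomain p (k j)) (D j))
    (hq_zero : ∀ j, hatImage (f j) (approxDomain p (k j)) (D j) (p 0)
      = (inSphere (Metric.ball 0 1))ᶜ)
    (hq_disk : ∀ j l, 1 ≤ l → l ≤ k j → ∃ (c : ℂ) (r : ℝ), 0 < r ∧
      hatImage (f j) (approxDomain p (k j)) (D j) (p l) = inSphere (Metric.closedBall c r))
    -- Hausdorff convergence of the disks to disks or points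
    (hq_lim : ∀ l, 1 ≤ l → ∃ (c : ℂ) (r : ℝ), 0 ≤ r ∧
      Tendsto (fun j => Metric.hausdorffEDist
        (finitePart (hatImage (f j) (approxDomain p (k j)) (D j) (p l)))
        (Metric.closedBall c r)) atTop (𝓝 0))
    -- the nonconstant locally uniform limit of the maps
    (g : Sphere → ℂ)
    (hg_lim : TendstoLocallyUniformlyOn (fun j z => toComplex (f j z)) g atTop Ω)
    (hg_nonconst : ∃ z ∈ Ω, ∃ w ∈ Ω, g z ≠ g w)
    -- a complementary component and a Jordan curve
    (pbar : Set Sphere) (hpbar : pbar ∈ complComps Ω)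
    (J : Set Sphere) (hJ : IsJordanCurve J) (hJΩ : J ⊆ Ω) :
    (∃ φ : ℂ → (ℝ≥0 ≃ₜ ℝ≥0), ∀ a b : ℂ, (b : Sphere) ∈ Ω →
      Metric.infEDist b (finitePart pbar) < setEDist (finitePart pbar) (finitePart J) →
      a ∈ frontier (finitePart pbar) → dist b a = Metric.infDist b (finitePart pbar) →
      limsup (fun j => (φ a (Metric.infNndist (toComplex (f j b))
          (finitePart (hatImage (f j) (approxDomain p (k j)) (D j) pbar))) : ℝ≥0∞)) atTop
        ≤ limsup (fun j => modulus (hatFamily (f j) (approxDomain p (k j)) (D j)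
          (joiningPaths (approxDomain p (k j)) pbar J (inSphere (segment ℝ a b))))) atTop) ∧
    ((∃ w : Sphere, hatImage (fun z => (g z : Sphere)) Ω
        (inSphere (g '' Ω)) pbar = {w}) →
      Tendsto (fun j => modulus (hatFamily (f j) (approxDomain p (k j)) (D j)
        (separatingPaths (approxDomain p (k j)) pbar J))) atTop (𝓝 ⊤)) := by
  have hp : ∀ l, p l ∈ complComps Ω := fun l =>
    (hp_range ▸ mem_range_self l : p l ∈ nontrivialComps Ω).1
  have hG : ∀ j, Ω ⊆ approxDomain p (k j) := fun j => subset_approxDomain hp (k j)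
  choose F x hF hx hFx hxp using fun j =>
    exists_circleConfig hp hp_inj (hD j).1 (hf j).2 (hq_zero j) (hq_disk j)
  have hm : ∀ j, MapsTo (f j) (approxDomain p (k j)) (D j) := fun j => (hf j).2.mapsTo
  have hball : ∀ j, ∀ z ∈ approxDomain p (k j), f j z ∈ inSphere (Metric.ball 0 1) :=
    fun j z hz => (hx j).mem_ball (hm j) hz
  have hJc := isCompact_of_isJordanCurve hJ
  constructor
  · obtain ⟨z₁, hz₁, z₂, hz₂, hne⟩ := exists_ne_of_nonconst hΩ hG (fun j => (hf j).1)
      (fun j z hz => ne_infty_of_mem_inSphere (hball j z hz)) hg_lim hg_nonconst hJc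
      (infinite_of_isJordanCurve hJ) hJΩ
    have hlim : Tendsto (fun j => ‖toComplex (f j z₁) - toComplex (f j z₂)‖) atTop
        (𝓝 ‖g z₁ - g z₂‖) :=
      ((hg_lim.tendsto_at (hJΩ hz₁)).sub (hg_lim.tendsto_at (hJΩ hz₂))).norm
    obtain ⟨c, hc, hc1, hcg⟩ : ∃ c > 0, c ≤ 1 ∧ c < ‖g z₁ - g z₂‖ := by
      have : 0 < ‖g z₁ - g z₂‖ := norm_pos_iff.2 (sub_ne_zero.2 hne)
      exact ⟨min 1 (‖g z₁ - g z₂‖ / 2), by positivity, min_le_left _ _,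
        (min_le_right _ _).trans_lt (by linarith)⟩
    -- With `d` the distance from `f j b` to the image of `pbar`, the joining estimate is applied to
    -- `c * d / 2`. Since `d ≤ 2` and `c ≤ 1`, this is at most both `c` and `d`, and `(c * d / 2 /
    -- 4) ^ 2 = (c / 8) ^ 2 * d ^ 2`.
    obtain ⟨φ, hφ⟩ := exists_homeomorph_const_mul_sq (κ := (c / 8) ^ 2 / 1440) (by positivity)
    refine ⟨fun _ => φ, fun a b hb _ ha hdist => limsup_le_limsup ?_⟩
    have haq : (a : Sphere) ∈ pbar :=
      (isClosed_finitePart (isClosed_of_mem_complComps hΩ.1 hpbar)).frontier_subset ha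
    have hab : a ≠ b := fun h => complComps_subset hpbar haq (h ▸ hb)
    -- A nontrivial `pbar` is one of the removed sets only from some index on.
    have hlarge : ∀ᶠ j in atTop, ∀ l, pbar = p l → l ≤ k j := by
      rcases exists_eq_or_eq_singleton hΩ_infty hp_range hpbar with ⟨l, rfl⟩ | ⟨y, rfl, hy⟩
      · filter_upwards [eventually_ge_atTop l] with j hj l' h
        exact (hp_inj h) ▸ hj.trans hk.le_apply
      · exact Eventually.of_forall fun j l h => absurd (h ▸ mem_singleton y) (hy l)
    filter_upwards [hlarge, hlim.eventually (eventually_gt_nhds hcg)] with j hj hcj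
    obtain ⟨h1, h2, h3⟩ := class_of_component hΩ_infty hp_range (hf j).2 (hF j) (hx j) (hFx j)
      (hxp j) hpbar hj haq
    rw [← h2]
    set S : Set ℂ := {z : ℂ | proj (D j) (z : Sphere) = F j (proj _ (a : Sphere))}
    set d := Metric.infNndist (toComplex (f j b)) S
    have hd : (d : ℝ) = Metric.infDist (toComplex (f j b)) S := Metric.coe_infNndist
    have hd2 : (d : ℝ) ≤ 2 := by
      obtain ⟨z, hz, hzS⟩ := (hx j).exists_norm_le_one (F j (proj _ (a : Sphere)))
      have h4 := mem_ball_zero_iff.1 (toComplex_mem (hball j b (hG j hb)))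
      have h5 := Metric.infDist_le_dist_of_mem (x := toComplex (f j b)) (show z ∈ S from hzS)
      rw [dist_eq_norm] at h5
      linarith [norm_sub_le (toComplex (f j b)) z]
    rcases eq_zero_or_pos d with hd0 | hd0
    · rw [hd0, NNReal.coe_injective (a₁ := φ 0) (a₂ := 0) (by rw [hφ]; simp)]
      exact bot_le
    · have hd0 : (0 : ℝ) < d := hd0
      have h := modulus_joining_ge (hF j) (hf j).2 (hx j) h1 h3
        (fun t ht => lineMap_notMem_of_dist_eq (A := finitePart pbar) hab hdist ht) (hG j hb)
        (isPreconnected_of_isJordanCurve hJ) (hJΩ.trans (hG j))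
        (disjoint_left.2 fun z hz hzp => complComps_subset hpbar hzp (hJΩ hz)) hz₁ hz₂
        (d := c * d / 2) (by positivity) (by nlinarith) (by rw [← hd]; nlinarith)
      refine le_of_eq_of_le ?_ h
      rw [← ENNReal.ofReal_coe_nnreal, hφ]
      congr 1
      ring
  · intro hw
    have hg1 : ∀ z ∈ Ω, ‖g z‖ ≤ 1 := fun z hz =>
      le_of_tendsto (hg_lim.tendsto_at hz).norm (Eventually.of_forall fun j =>
        (mem_ball_zero_iff.1 (toComplex_mem (hball j z (hG j hz)))).le)
    exact tendsto_modulus_separating hΩ hg1 hpbar hw hG hF hm hx hg_lim hJc hJΩ
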